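/- Let $G$ be a complex reductive group with root datum $(X,\Phi,X^\vee,\Phi^\vee)$ relative to a maximal torus $T$, Weyl group $W$, and simple roots $\alpha_i$ $(i\in I)$. Let $\tilde W=X^\vee\rtimes W$ be the extended affine Weyl group, with translations $t_\mu$ $(\mu\in X^\vee)$; it acts on $X$ at level zero ($t_\mu$ acts trivially, $W$ naturally). For $i\in I$ let $s_i$ be the simple reflection; for each irreducible component of $\Phi$, with highest root $\theta$, there is an affine node $0$ with $s_0=t_{\theta^\vee}s_\theta$ and $\alpha_0=-\theta$. Let $\tilde I$ be the set of all these nodes. The $s_i$ $(i\in\tilde I)$ generate the affine Weyl group $\hat W\subset\tilde W$, a Coxeter group, and $\tilde W=\Pi\ltimes\hat W$, where $\Pi\cong X^\vee/Q^\vee$ is the subgroup of elements preserving the set of positive real affine roots. Length and Bruhat order are extended to $\tilde W$ by $\ell(\sigma v)=\ell(v)$, and $\sigma v\le\sigma' v'$ iff $\sigma=\sigma'$ and $v\le v'$ $(\sigma,\sigma'\in\Pi,\ v,v'\in\hat W)$. Let $\tilde W^0$ be the set of affine Grassmannian elements, i.e. the $w\in\tilde W$ with $ws_i>w$ for all $i\in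 I$. Let $R=R(T)=\mathbb Z[X]$, $c(\alpha)=1-e^\alpha$, let $R^\Delta$ be the localization of $R$ at the multiplicative set generated by the $c(\alpha)$, $\alpha\in\Phi$, and let $\mathbb K^\Delta$ be the smash product of $R^\Delta$ and $\mathbb Z[\tilde W]$, with $(f w)(g v)=f\,w(g)\,wv$. For $i\in\tilde I$ put $T_i=c(\alpha_i)^{-1}(s_i-1)$ and $D_i=T_i+1$; for a reduced expression $w=\sigma s_{i_1}\cdots s_{i_l}$ with $\sigma\in\Pi$ put $T_w=\sigma T_{i_1}\cdots T_{i_l}$ and $D_w=\sigma D_{i_1}\cdots D_{i_l}$; these do not depend on the reduced expression. Let $\mathbb K_G\subset\mathbb K^\Delta$ be the subring generated by $R$, the $T_i$ $(i\in\tilde I)$ and $\Pi$; it contains $\tilde W$. Let $\mathbb L_G$ be the centralizer of $R$ in $\mathbb K_G$, and $\mathbb L^\Delta=R^\Delta\otimes_R\mathbb L_G$, regarded as the $R^\Delta$-span of $\mathbb L_G$ in $\mathbb K^\Delta$. For each $w\in\tilde W^0$ there is a unique element $k_w\in\mathbb L_G$ of the form $k_w=T_w+\sum_{v\notin\tilde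 W^0}k_w^v\,T_v$ (a finite sum with $k_w^v\in R$). All lower intervals of the Bruhat order are finite; let $\ell_w=\sum_{v\in\tilde W^0,\ v\le w}k_v$. Then there is a unique action $*$ of the ring $\mathbb K^\Delta$ on $\mathbb L^\Delta$ that extends the left $R^\Delta$-module structure and satisfies $u*b=u\,b\,u^{-1}$ for $u\in W$ and $t_\mu*b=t_\mu b$ for $\mu\in X^\vee$ $(b\in\mathbb L^\Delta)$. It restricts to an action of $\mathbb K_G$ on $\mathbb L_G$: for $b\in\mathbb L_G$, $$T_i*b=T_i\,b+b\,T_i+T_i\,b\,c(\alpha_i)\,T_i\qquad(i\in I),$$ $$T_0*b=t_{\theta^\vee}c(\alpha_0)^{-1}\big((s_\theta-1)*b\big)+c(\alpha_0)^{-1}(t_{\theta^\vee}-1)\,b$$ for every affine node $0$ with highest root $\theta$. Moreover, for every $w\in\tilde W^0$, $$k_w=T_w*1,\qquad \ell_w=D_w*1,$$ and $\mathbb L_G=\mathbb K_G*1$. The families $\{k_w\}_{w\in\tilde W^0}$ and $\{\ell_w\}_{w\in\tilde W^0}$ are both $R$-bases of $\mathbb L_G$. -/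

import Mathlib

noncomputable section

namespace KPeterson

open RootPairing

variable {ι X Y : Type*} [AddCommGroup X] [AddCommGroup Y]

section ExtendedAffineWeylGroup

/-- The natural left action of the finite Weyl group on the cocharacter lattice `Y`; Mathlib's
`coweightEquiv P P w` is the transpose of the action of `w` on `X`, whence the inverse. -/
def weylCochar (P : RootDatum ι X Y) : P.weylGroup →* MulAut (Multiplicative Y) where
  toFun w := AddEquiv.toMultiplicative
    (RootPairing.Equiv.coweightEquiv P P (w⁻¹ : P.weylGroup).1).toAddEquiv
  map_one' := by
    ext y
    rw [inv_one]
    rfl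
  map_mul' u v := by
    ext y
    rw [mul_inv_rev]
    rfl

/-- The extended affine Weyl group `X^∨ ⋊ W`. -/
abbrev ExtWeyl (P : RootDatum ι X Y) : Type _ :=
  SemidirectProduct (Multiplicative Y) P.weylGroup (weylCochar P)

variable {P : RootDatum ι X Y}

/-- The translation `t_μ`. -/
def transl (P : RootDatum ι X Y) (μ : Y) : ExtWeyl P :=
  SemidirectProduct.inl (Multiplicative.ofAdd μ)

/-- The inclusion of the finite Weyl group. -/
def finW (P : RootDatum ι X Y) (u : P.weylGroup) : ExtWeyl P := SemidirectProduct.inr u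

/-- The translation part of `w = t_μ u`. -/
def translPart (w : ExtWeyl P) : Y := Multiplicative.toAdd w.left

/-- `j` indexes the highest root of an irreducible component: `α_j` is maximal in the order
`β ≤ γ ↔ γ - β` is a sum of simple roots. -/
def IsHighest (b : P.Base) (j : ι) : Prop :=
  ∀ k, P.root k - P.root j ∈ AddSubmonoid.closure (P.root '' b.support) → k = j

/-- The nodes of the untwisted affine Dynkin diagram: the simple roots, and one affine node for
each irreducible component, labelled by the highest root of that component. -/
abbrev AffNode (b : P.Base) : Type _ := b.support ⊕ {j : ι // IsHighest b j}

/-- The affine simple reflections: `s_i` at an ordinary node, `t_{θ^∨} s_θ` at an affine node. -/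
def simpleRefl (b : P.Base) : AffNode b → ExtWeyl P
  | Sum.inl i => finW P (weylGroup.ofIdx P i)
  | Sum.inr j => transl P (P.coroot j) * finW P (weylGroup.ofIdx P j)

/-- The level zero simple roots: `α_i` at an ordinary node, `-θ` at an affine node. -/
def simpleRoot (b : P.Base) : AffNode b → X
  | Sum.inl i => P.root i
  | Sum.inr j => -P.root j

theorem pairing_weylCochar (u : P.weylGroup) (x : X) (μ : Y) :
    P.toLinearMap (u • x) (Multiplicative.toAdd (weylCochar P u (Multiplicative.ofAdd μ))) =
      P.toLinearMap x μ := by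
  have h : P.toLinearMap ((u⁻¹ : P.weylGroup) • (u • x)) μ =
      P.toLinearMap (u • x) (Multiplicative.toAdd (weylCochar P u (Multiplicative.ofAdd μ))) :=
    congrFun (congrArg DFunLike.coe
      (congrFun (congrArg DFunLike.coe (u⁻¹ : P.weylGroup).1.weight_coweight_transpose) μ))
      (u • x)
  rw [← h, inv_smul_smul]

/-- The action of the extended affine Weyl group on the real affine roots, where `(i, n)` stands
for `α_i + nδ`: the element `t_μ u` sends `α + nδ` to `uα + (n - ⟨μ, uα⟩)δ`. -/
def affAct (w : ExtWeyl P) (p : ι × ℤ) : ι × ℤ :=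
  (P.weylGroupToPerm w.right p.1,
    p.2 - P.toLinearMap (P.root (P.weylGroupToPerm w.right p.1)) (translPart w))

theorem affAct_one (p : ι × ℤ) : affAct (1 : ExtWeyl P) p = p := by
  refine Prod.ext ?_ ?_
  · simp [affAct]
  · simp [affAct, translPart]

theorem affAct_mul (v w : ExtWeyl P) (p : ι × ℤ) :
    affAct (v * w) p = affAct v (affAct w p) := by
  have h := pairing_weylCochar v.right (P.root (P.weylGroupToPerm w.right p.1)) (translPart w)
  rw [weylGroup_apply_root] at h
  refine Prod.ext ?_ ?_
  · simp only [affAct, SemidirectProduct.mul_right, map_mul]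
    rfl
  · simp only [affAct, SemidirectProduct.mul_right, map_mul]
    rw [sub_sub, ← h, ← map_add, add_comm]
    rfl

/-- The real affine root `α_i + nδ` is positive. -/
def AffPos (b : P.Base) (p : ι × ℤ) : Prop := 0 < p.2 ∨ (p.2 = 0 ∧ b.IsPos p.1)

/-- The subgroup of the elements of the extended affine Weyl group that preserve the set of
positive real affine roots. It is the image of the fundamental group `X^∨ / Q^∨` of the reductive
group. -/
def fundGroup (b : P.Base) : Subgroup (ExtWeyl P) where
  carrier := {w | ∀ p, AffPos b (affAct w p) ↔ AffPos b p}
  one_mem' := fun p => by rw [affAct_one]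
  mul_mem' := fun {v w} hv hw p => by rw [affAct_mul, hv, hw]
  inv_mem' := fun {w} hw p => by rw [← hw, ← affAct_mul, mul_inv_cancel, affAct_one]

/-- `w = σ s_{i_1} ⋯ s_{i_l}` with `σ` in the fundamental group. -/
def IsExpr (b : P.Base) (w σ : ExtWeyl P) (l : List (AffNode b)) : Prop :=
  σ ∈ fundGroup b ∧ w = σ * (l.map (simpleRefl b)).prod

/-- The length function. -/
def len (b : P.Base) (w : ExtWeyl P) : ℕ := sInf {n | ∃ σ l, IsExpr b w σ l ∧ l.length = n}

/-- `w = σ s_{i_1} ⋯ s_{i_l}` is a reduced expression. -/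
def IsReducedExpr (b : P.Base) (w σ : ExtWeyl P) (l : List (AffNode b)) : Prop :=
  IsExpr b w σ l ∧ l.length = len b w

/-- The (non-extended) affine Weyl group, generated by the affine simple reflections. -/
def affWeyl (b : P.Base) : Subgroup (ExtWeyl P) := Subgroup.closure (Set.range (simpleRefl b))

/-- The reflections of the Coxeter group `affWeyl b`. -/
def IsRefl (b : P.Base) (t : ExtWeyl P) : Prop :=
  ∃ x ∈ affWeyl b, ∃ i, t = x * simpleRefl b i * x⁻¹

/-- `w = v t` for a reflection `t`, and `v` is shorter than `w`. As `t` lies in the affine Weyl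
group, `v` and `w` have the same component in the fundamental group. -/
def BruhatStep (b : P.Base) (v w : ExtWeyl P) : Prop :=
  len b v < len b w ∧ ∃ t, IsRefl b t ∧ w = v * t

/-- The strict Bruhat order. -/
def BruhatLT (b : P.Base) (v w : ExtWeyl P) : Prop := Relation.TransGen (BruhatStep b) v w

/-- The Bruhat order. -/
def BruhatLE (b : P.Base) (v w : ExtWeyl P) : Prop := Relation.ReflTransGen (BruhatStep b) v w

/-- The affine Grassmannian elements: `w s_i > w` for every finite simple reflection `s_i`. -/
def IsGr (b : P.Base) (w : ExtWeyl P) : Prop :=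
  ∀ i : b.support, BruhatLT b w (w * simpleRefl b (Sum.inl i))

end ExtendedAffineWeylGroup

section Coefficients

/-- The representation ring `R(T) = ℤ[X]` of the torus with character lattice `X`. -/
abbrev RT (X : Type*) [AddCommGroup X] : Type _ := AddMonoidAlgebra ℤ X

/-- `c(α) = 1 - e^α`. -/
def c (α : X) : RT X := 1 - AddMonoidAlgebra.single α 1

/-- The multiplicative set generated by the `c(α)` for the roots `α`. -/
def Delta (P : RootDatum ι X Y) : Submonoid (RT X) :=
  Submonoid.closure (Set.range fun i => c (P.root i))

/-- The localization of `R(T)` at `Delta P`. -/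
abbrev RLoc (P : RootDatum ι X Y) : Type _ := Localization (Delta P)

/-- The action of a Weyl group element on `R(T)`: `e^λ ↦ e^{wλ}`. -/
def weylRT (P : RootDatum ι X Y) (w : P.weylGroup) : RT X →+* RT X :=
  AddMonoidAlgebra.mapDomainRingHom ℤ (RootPairing.Equiv.weightEquiv P P w.1).toAddMonoidHom

theorem weylRT_single (P : RootDatum ι X Y) (w : P.weylGroup) (x : X) (n : ℤ) :
    weylRT P w (AddMonoidAlgebra.single x n) = AddMonoidAlgebra.single (w • x) n := by
  simp only [weylRT, AddMonoidAlgebra.mapDomainRingHom_apply, AddMonoidAlgebra.mapDomain_single]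
  rfl

theorem weylRT_one (P : RootDatum ι X Y) : weylRT P 1 = RingHom.id _ := by
  refine AddMonoidAlgebra.ringHom_ext (fun n => ?_) fun x => ?_ <;>
    simp [weylRT_single]

theorem weylRT_mul (P : RootDatum ι X Y) (v w : P.weylGroup) :
    weylRT P (v * w) = (weylRT P v).comp (weylRT P w) := by
  refine AddMonoidAlgebra.ringHom_ext (fun n => ?_) fun x => ?_ <;>
    simp [weylRT_single, mul_smul]

theorem delta_le (P : RootDatum ι X Y) (w : P.weylGroup) :
    Delta P ≤ (Delta P).comap (weylRT P w) := by
  rw [Delta, Submonoid.closure_le]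
  rintro _ ⟨i, rfl⟩
  refine Submonoid.subset_closure ⟨P.weylGroupToPerm w i, ?_⟩
  simp only [c, map_sub, map_one, weylRT_single, weylGroup_apply_root]

/-- The level zero action of the extended affine Weyl group on the localization of `R(T)`:
`t_μ u` acts as `u`. -/
instance levelZero (P : RootDatum ι X Y) : MulSemiringAction (ExtWeyl P) (RLoc P) where
  smul w f := IsLocalization.map (RLoc P) (weylRT P w.right) (delta_le P w.right) f
  one_smul f := by
    change IsLocalization.map (RLoc P) (weylRT P 1) (delta_le P 1) f = f
    simp only [weylRT_one]
    exact IsLocalization.map_id f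
  mul_smul v w f := by
    change IsLocalization.map (RLoc P) (weylRT P (v.right * w.right)) (delta_le P _) f =
      IsLocalization.map (RLoc P) (weylRT P v.right) (delta_le P _)
        (IsLocalization.map (RLoc P) (weylRT P w.right) (delta_le P _) f)
    rw [IsLocalization.map_map]
    simp only [weylRT_mul]
  smul_zero w := map_zero (IsLocalization.map (RLoc P) (weylRT P w.right) (delta_le P w.right))
  smul_add w := map_add (IsLocalization.map (RLoc P) (weylRT P w.right) (delta_le P w.right))
  smul_one w := map_one (IsLocalization.map (RLoc P) (weylRT P w.right) (delta_le P w.right))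
  smul_mul w := map_mul (IsLocalization.map (RLoc P) (weylRT P w.right) (delta_le P w.right))

variable {P : RootDatum ι X Y}

theorem c_simpleRoot_mem (b : P.Base) (i : AffNode b) : c (simpleRoot b i) ∈ Delta P := by
  refine Submonoid.subset_closure ?_
  rcases i with i | j
  · exact ⟨i, rfl⟩
  · exact ⟨P.reflectionPerm j j, by simp [simpleRoot]⟩

/-- `c(α_i)⁻¹` for a node `i` of the affine Dynkin diagram. -/
def cInv (b : P.Base) (i : AffNode b) : RLoc P :=
  Localization.mk 1 ⟨c (simpleRoot b i), c_simpleRoot_mem b i⟩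

end Coefficients

section NilHecke

/-- The smash product of the localized representation ring and the group ring of the extended
affine Weyl group, with `(f w)(g v) = f w(g) w v`. -/
abbrev KDelta (P : RootDatum ι X Y) : Type _ := SkewMonoidAlgebra (RLoc P) (ExtWeyl P)

/-- The inclusion of the extended affine Weyl group in the smash product. -/
def grp (P : RootDatum ι X Y) : ExtWeyl P →* KDelta P := SkewMonoidAlgebra.of _ _

/-- The inclusion of the localized representation ring in the smash product. -/
def scal (P : RootDatum ι X Y) : RLoc P →+* KDelta P := SkewMonoidAlgebra.singleOneRingHom

/-- The inclusion of `R(T)` in the smash product. -/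
def scalRT (P : RootDatum ι X Y) : RT X →+* KDelta P := (scal P).comp (algebraMap (RT X) (RLoc P))

variable {P : RootDatum ι X Y}

/-- `T_i = c(α_i)⁻¹ (s_i - 1)`. -/
def simpleT (b : P.Base) (i : AffNode b) : KDelta P :=
  scal P (cInv b i) * (grp P (simpleRefl b i) - 1)

/-- `D_i = T_i + 1`. -/
def simpleD (b : P.Base) (i : AffNode b) : KDelta P := simpleT b i + 1

open Classical in
/-- `T_w = σ T_{i_1} ⋯ T_{i_l}` for a reduced expression `w = σ s_{i_1} ⋯ s_{i_l}`. -/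
def elemT (b : P.Base) (w : ExtWeyl P) : KDelta P :=
  if h : ∃ p : ExtWeyl P × List (AffNode b), IsReducedExpr b w p.1 p.2 then
    grp P h.choose.1 * (h.choose.2.map (simpleT b)).prod
  else 0

open Classical in
/-- `D_w = σ D_{i_1} ⋯ D_{i_l}` for a reduced expression `w = σ s_{i_1} ⋯ s_{i_l}`. -/
def elemD (b : P.Base) (w : ExtWeyl P) : KDelta P :=
  if h : ∃ p : ExtWeyl P × List (AffNode b), IsReducedExpr b w p.1 p.2 then
    grp P h.choose.1 * (h.choose.2.map (simpleD b)).prod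
  else 0

/-- The affine level zero `K`-nil-Hecke ring: the subring generated by `R(T)`, the `T_i` and the
fundamental group. -/
def KG (b : P.Base) : Subring (KDelta P) :=
  Subring.closure
    (Set.range (scalRT P) ∪ Set.range (simpleT b) ∪ grp P '' (fundGroup b : Set (ExtWeyl P)))

/-- The Peterson subalgebra: the centralizer of `R(T)` in `KG b`. -/
def LG (b : P.Base) : Subring (KDelta P) := KG b ⊓ Subring.centralizer (Set.range (scalRT P))

/-- The localized Peterson subalgebra, realized as the `RLoc P`-span of `LG b` in the smash
product. -/
def LDelta (b : P.Base) : Submodule (RLoc P) (KDelta P) :=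
  Submodule.span (RLoc P) (LG b : Set (KDelta P))

/-- The unit element of the Peterson subalgebra. -/
def oneL (b : P.Base) : LDelta b := ⟨1, Submodule.subset_span (LG b).one_mem⟩

/-- A ring homomorphism to the additive endomorphisms of `LDelta b`, that is, a left
`KDelta P`-module structure on the abelian group `LDelta b`, is the star action if it extends the
left `RLoc P`-module structure, `u * x = u x u⁻¹` for `u` in the finite Weyl group, and
`t_μ * x = t_μ x` for `μ` in the cocharacter lattice. -/
structure IsStarAction (b : P.Base) (star : KDelta P →+* AddMonoid.End (LDelta b)) : Prop where
  scalar : ∀ (f : RLoc P) (x : LDelta b), star (scal P f) x = f • x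
  finite_weyl : ∀ (u : P.weylGroup) (x : LDelta b),
    (star (grp P (finW P u)) x : KDelta P) =
      grp P (finW P u) * (x : KDelta P) * grp P (finW P u)⁻¹
  translation : ∀ (μ : Y) (x : LDelta b),
    (star (grp P (transl P μ)) x : KDelta P) = grp P (transl P μ) * (x : KDelta P)

/-- `k` is the element of the Peterson subalgebra of the form `T_w + ∑ k^v T_v`, the sum over
`v` that are not affine Grassmannian, with coefficients `k^v` in `R(T)`. -/
def IsSchubertK (b : P.Base) (w : ExtWeyl P) (k : KDelta P) : Prop :=
  k ∈ LG b ∧ k - elemT b w ∈ Submodule.span (RT X) (elemT b '' {v | ¬ IsGr b v})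

open Classical in
/-- The Schubert element `k_w`. -/
def schubertK (b : P.Base) (w : ExtWeyl P) : KDelta P :=
  if h : ∃ k, IsSchubertK b w k then h.choose else 0

/-- The Schubert element `ℓ_w`, the sum of the `k_v` over the affine Grassmannian `v ≤ w`. -/
def schubertL (b : P.Base) (w : ExtWeyl P) : KDelta P :=
  ∑ᶠ v ∈ {v | IsGr b v ∧ BruhatLE b v w}, schubertK b v

end NilHecke

end KPeterson

end

set_option linter.unusedSectionVars false
set_option linter.unusedSimpArgs false
set_option linter.unusedVariables false

noncomputable section

namespace KPeterson

open RootPairing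

/-! ### Linear action of the extended affine Weyl group on `X ⊕ ℤδ` -/

section AffineRoots

variable {ι X Y : Type*} [AddCommGroup X] [AddCommGroup Y] {P : RootDatum ι X Y}

/-! The smash product has the `RLoc P`-basis of elements `t_μ u`, and forgetting the finite part, `f
t_μ u ↦ f t_μ`, defines the projection `translProj`. The translation part of `v w` depends only on
`v` and on the translation part of `w`, so the kernel of `translProj` is a left ideal
(`translProj_mul_translProj`) and its image is a left module over the smash product under `a * x =
translProj P (a * x)`. The image is also the centralizer of `R(T)`: translations act trivially on
the coefficients, while `W` acts faithfully on `X` and the coefficients form a domain, so only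
translations can occur in the support of an element commuting with every `e^y`. Hence `LDelta b` is
exactly the image of `translProj` (`mem_LDelta_iff`), the action above is the star action, and it is
the only one because the elements `f t_μ u` span.

That `KG b` preserves `LG b` is a matter of integrality. It is checked on generators: the formula
for `T_i * x` at an ordinary node has all its factors in `KG b`, and at an affine node one needs the
Demazure operators of all finite roots together with `c(α₀)⁻¹ (t_{θ^∨} - 1) ∈ KG b`
(`translProj_mul_mem_LG`).

The Schubert statements then come from `translProj` applied to the `T_w`. The `T_w` span `KG b` over
`R(T)` (`mem_KG_iff_mem_spanT`). If `w` is not affine Grassmannian, then `T_w = T_{w s_i} T_i` for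
some finite `i`, and `T_i` is in the kernel; if `w` is affine Grassmannian, it is the shortest
element of `wW`, and the images of such `T_w` are triangular for the length (`coeff_elemT`,
`linearIndependent_translProj_elemT`). So the kernel of `translProj` on `KG b` is spanned by the
`T_v` with `v` not affine Grassmannian. This gives existence and uniqueness of `k_w` with `k_w =
translProj P (T_w) = T_w * 1`, and the basis property. Since `D_w` is the sum of the `T_v` over `v ≤
w` (`prod_simpleD_eq_sum`), also `ℓ_w = D_w * 1`, and the `ℓ_w` are unitriangular over the `k_w`.

All this rests on the Coxeter combinatorics of the extended affine Weyl group, developed from the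
real affine roots: the length is the number of inversions, the lifting property holds for the Bruhat
order, and Matsumoto's theorem makes `T_w` well defined. The braid relations for the `T_i` are
verified by direct computation in the four finite rank two types. -/

theorem transl_mul_finW (w : ExtWeyl P) : transl P (translPart w) * finW P w.right = w :=
  SemidirectProduct.inl_left_mul_inr_right w

theorem translPart_mul (v w : ExtWeyl P) :
    translPart (v * w) = translPart v +
      Multiplicative.toAdd (weylCochar P v.right (Multiplicative.ofAdd (translPart w))) := rfl

/-- The linear action of the extended affine Weyl group on `X ⊕ ℤδ`. -/
def linAct (w : ExtWeyl P) : X × ℤ →+ X × ℤ where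
  toFun v := (w.right • v.1, v.2 - P.toLinearMap (w.right • v.1) (translPart w))
  map_zero' := by simp
  map_add' u v := by
    refine Prod.ext (smul_add _ _ _) ?_
    simp only [Prod.fst_add, Prod.snd_add, smul_add, map_add, LinearMap.add_apply]
    abel

theorem linAct_apply (w : ExtWeyl P) (v : X × ℤ) :
    linAct w v = (w.right • v.1, v.2 - P.toLinearMap (w.right • v.1) (translPart w)) := rfl

theorem linAct_mul (v w : ExtWeyl P) (x : X × ℤ) : linAct (v * w) x = linAct v (linAct w x) := by
  have h := pairing_weylCochar v.right (w.right • x.1) (translPart w)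
  refine Prod.ext ?_ ?_
  · simp [linAct_apply, mul_smul]
  · simp only [linAct_apply, SemidirectProduct.mul_right, mul_smul, translPart_mul, map_add]
    rw [h]
    abel

theorem linAct_one (x : X × ℤ) : linAct (1 : ExtWeyl P) x = x := by
  simp [linAct_apply, translPart]

theorem weylGroup_ext {u v : P.weylGroup} (h : ∀ x : X, u • x = v • x) : u = v := by
  apply Subtype.ext
  apply RootPairing.Equiv.weightHom_injective P
  ext x
  exact h x

/-- `W` acts faithfully on `X`, and the perfect pairing recovers the translation part from the
`δ`-coordinate. Identities in the extended affine Weyl group thereby reduce to identities of linear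
maps. -/
theorem linAct_injective {v w : ExtWeyl P} (h : ∀ x, linAct v x = linAct w x) : v = w := by
  have hr : v.right = w.right := weylGroup_ext fun x => congrArg Prod.fst (h (x, 0))
  have hl : translPart v = translPart w := by
    apply (LinearMap.IsPerfPair.bijective_right P.toLinearMap).injective
    ext x
    have h2 := congrArg Prod.snd (h (v.right⁻¹ • x, 0))
    simp only [linAct_apply, ← hr, smul_inv_smul, zero_sub, neg_inj] at h2
    exact h2
  rw [← transl_mul_finW v, ← transl_mul_finW w, hr, hl]

/-- The vector `α_i + nδ`. -/
def affVec (P : RootDatum ι X Y) (p : ι × ℤ) : X × ℤ := (P.root p.1, p.2)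

theorem affVec_injective : Function.Injective (affVec P) := fun _ _ h =>
  Prod.ext (P.root.injective (congrArg Prod.fst h)) (congrArg (fun v : X × ℤ => v.2) h)

theorem affVec_affAct (w : ExtWeyl P) (p : ι × ℤ) :
    affVec P (affAct w p) = linAct w (affVec P p) := by
  simp only [affVec, affAct, linAct_apply, weylGroup_apply_root]

theorem affAct_inv_affAct (w : ExtWeyl P) (p : ι × ℤ) : affAct w⁻¹ (affAct w p) = p := by
  rw [← affAct_mul, inv_mul_cancel, affAct_one]

theorem affAct_affAct_inv (w : ExtWeyl P) (p : ι × ℤ) : affAct w (affAct w⁻¹ p) = p := by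
  rw [← affAct_mul, mul_inv_cancel, affAct_one]

theorem affAct_injective (w : ExtWeyl P) : Function.Injective (affAct w) :=
  Function.LeftInverse.injective (affAct_inv_affAct w)

/-- The negative of a real affine root. -/
def affNeg (P : RootDatum ι X Y) (p : ι × ℤ) : ι × ℤ := (P.reflectionPerm p.1 p.1, -p.2)

theorem affVec_affNeg (p : ι × ℤ) : affVec P (affNeg P p) = -affVec P p := by
  simp [affVec, affNeg]

theorem affAct_affNeg (w : ExtWeyl P) (p : ι × ℤ) :
    affAct w (affNeg P p) = affNeg P (affAct w p) :=
  affVec_injective (P := P) (by simp only [affVec_affNeg, affVec_affAct, map_neg])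

/-- The reflection in a real affine root. -/
def affRefl (P : RootDatum ι X Y) (p : ι × ℤ) : ExtWeyl P :=
  transl P (-p.2 • P.coroot p.1) * finW P (weylGroup.ofIdx P p.1)

theorem linAct_affRefl (p : ι × ℤ) (v : X × ℤ) :
    linAct (affRefl P p) v = v - P.toLinearMap v.1 (P.coroot p.1) • affVec P p := by
  have h1 : (affRefl P p).right = weylGroup.ofIdx P p.1 := by
    rw [affRefl, SemidirectProduct.mul_right]
    exact one_mul _
  have h2 : translPart (affRefl P p) = -p.2 • P.coroot p.1 := by
    rw [affRefl, translPart_mul]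
    change -p.2 • P.coroot p.1 + Multiplicative.toAdd (weylCochar P 1 1) = _
    simp
  have h3 : weylGroup.ofIdx P p.1 • v.1 =
      v.1 - P.toLinearMap v.1 (P.coroot p.1) • P.root p.1 := P.reflection_apply p.1 v.1
  refine Prod.ext ?_ ?_
  · simp only [linAct_apply, h1, h3, affVec, Prod.fst_sub, Prod.smul_fst]
  · simp only [linAct_apply, h1, h2, h3, affVec, Prod.snd_sub, Prod.smul_snd, map_sub, map_smul,
      LinearMap.sub_apply, LinearMap.smul_apply, P.root_coroot_two, smul_eq_mul]
    ring

theorem pairing_smul_coroot (u : P.weylGroup) (x : X) (i : ι) :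
    P.toLinearMap (u • x) (P.coroot (P.weylGroupToPerm u i)) = P.toLinearMap x (P.coroot i) := by
  rw [← pairing_weylCochar u x (P.coroot i)]
  congr 1
  exact (RootPairing.Hom.coroot_coweightMap_apply P P i ((u⁻¹ : P.weylGroup).1).toHom).symm

theorem affRefl_conj (w : ExtWeyl P) (p : ι × ℤ) :
    w * affRefl P p * w⁻¹ = affRefl P (affAct w p) := by
  refine linAct_injective fun v => ?_
  obtain ⟨v, rfl⟩ : ∃ v', linAct w v' = v := ⟨linAct w⁻¹ v, by
    rw [← linAct_mul, mul_inv_cancel, linAct_one]⟩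
  rw [← linAct_mul, inv_mul_cancel_right, linAct_mul, linAct_affRefl, linAct_affRefl, map_sub,
    map_zsmul, affVec_affAct]
  congr 2
  exact (pairing_smul_coroot w.right v.1 p.1).symm

theorem affRefl_mul_self (p : ι × ℤ) : affRefl P p * affRefl P p = 1 := by
  refine linAct_injective fun v => ?_
  rw [linAct_mul, linAct_one, linAct_affRefl, linAct_affRefl]
  simp only [affVec, Prod.fst_sub, Prod.smul_fst, map_sub, map_smul, LinearMap.sub_apply,
    LinearMap.smul_apply, P.root_coroot_two]
  module

theorem affRefl_inv (p : ι × ℤ) : (affRefl P p)⁻¹ = affRefl P p :=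
  inv_eq_of_mul_eq_one_right (affRefl_mul_self p)

theorem affRefl_affNeg (p : ι × ℤ) : affRefl P (affNeg P p) = affRefl P p := by
  refine linAct_injective fun v => ?_
  rw [linAct_affRefl, linAct_affRefl, affVec_affNeg]
  simp [affNeg]

theorem affAct_affRefl_self (p : ι × ℤ) : affAct (affRefl P p) p = affNeg P p := by
  refine affVec_injective (P := P) ?_
  rw [affVec_affAct, linAct_affRefl, affVec_affNeg]
  simp only [affVec, P.root_coroot_two]
  module

end AffineRoots

/-! ### Positive affine roots, highest roots and simple reflections -/

section Positivity

variable {ι X Y : Type*} [AddCommGroup X] [AddCommGroup Y] {P : RootDatum ι X Y}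

/-- The perfect pairing embeds `X` in the homomorphisms from `Y` to `ℤ`. Torsion-freeness is what
makes `ℤ[X]` a domain. -/
theorem isAddTorsionFree_of_perfectPairing (P : RootDatum ι X Y) : IsAddTorsionFree X where
  nsmul_right_injective n hn x x' h := by
    refine (LinearMap.IsPerfPair.bijective_left P.toLinearMap).injective (LinearMap.ext fun y => ?_)
    have h2 := congrArg (fun x => P.toLinearMap x y) h
    simp only [map_nsmul, LinearMap.smul_apply, nsmul_eq_mul] at h2
    exact mul_left_cancel₀ (Nat.cast_ne_zero.mpr hn) h2

theorem root_reflectionPerm_self (P : RootDatum ι X Y) (i : ι) :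
    P.root (P.reflectionPerm i i) = -P.root i := by
  simp

theorem pairingIn_int (P : RootDatum ι X Y) (i j : ι) : P.pairingIn ℤ i j = P.pairing i j :=
  P.algebraMap_pairingIn ℤ i j

theorem exists_eq_sum_of_mem_closure (b : P.Base) {m : X}
    (hm : m ∈ AddSubmonoid.closure (P.root '' b.support)) :
    ∃ f : ι → ℤ, 0 ≤ f ∧ m = ∑ j ∈ b.support, f j • P.root j := by
  classical
  induction hm using AddSubmonoid.closure_induction with
  | mem x hx =>
    obtain ⟨j, hj, rfl⟩ := hx
    refine ⟨Pi.single j 1, by simp, ?_⟩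
    rw [Finset.sum_eq_single_of_mem j hj fun k _ hk => by simp [hk]]
    simp
  | zero => exact ⟨0, le_rfl, by simp⟩
  | add x y _ _ hx hy =>
    obtain ⟨f, hf, rfl⟩ := hx
    obtain ⟨g, hg, rfl⟩ := hy
    exact ⟨f + g, add_nonneg hf hg, by simp [add_smul, Finset.sum_add_distrib]⟩

theorem height_le_of_sub_mem_closure (b : P.Base) {i k : ι}
    (h : P.root k - P.root i ∈ AddSubmonoid.closure (P.root '' b.support)) :
    b.height i ≤ b.height k ∧ (b.height i = b.height k → i = k) := by
  obtain ⟨f, hf, hm⟩ := exists_eq_sum_of_mem_closure b h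
  obtain ⟨g, -, -, hg⟩ := b.exists_root_eq_sum_int i
  have hk : P.root k = ∑ j ∈ b.support, (f + g) j • P.root j := by
    rw [← sub_add_cancel (P.root k) (P.root i), hm]
    nth_rewrite 1 [hg]
    simp [add_smul, Finset.sum_add_distrib]
  have hs : 0 ≤ ∑ j ∈ b.support, f j := Finset.sum_nonneg fun j _ => hf j
  rw [Base.height_eq_sum hg, Base.height_eq_sum hk]
  simp only [Pi.add_apply, Finset.sum_add_distrib]
  refine ⟨by linarith, fun h0 => P.root.injective ?_⟩
  have h1 := (Finset.sum_eq_zero_iff_of_nonneg fun j _ => hf j).mp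
    (show ∑ j ∈ b.support, f j = 0 by linarith)
  rw [Finset.sum_eq_zero fun j hj => by rw [h1 j hj, zero_smul]] at hm
  exact (sub_eq_zero.mp hm).symm

theorem isPos_of_mem_closure (b : P.Base) {i : ι}
    (h : P.root i ∈ AddSubmonoid.closure (P.root '' b.support)) : b.IsPos i := by
  obtain ⟨f, hf, hm⟩ := exists_eq_sum_of_mem_closure b h
  rw [Base.isPos_iff', Base.height_eq_sum hm]
  exact Finset.sum_nonneg fun j _ => hf j

theorem isPos_reflectionPerm_self (b : P.Base) (i : ι) :
    b.IsPos (P.reflectionPerm i i) ↔ ¬ b.IsPos i :=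
  RootPairing.Base.IsPos.neg_iff_not b i

theorem isPos_iff_mem_closure (b : P.Base) (i : ι) :
    b.IsPos i ↔ P.root i ∈ AddSubmonoid.closure (P.root '' b.support) := by
  refine ⟨fun h => (b.root_mem_or_neg_mem i).resolve_right fun hn => ?_, isPos_of_mem_closure b⟩
  rw [← root_reflectionPerm_self P] at hn
  exact (isPos_reflectionPerm_self b i).mp (isPos_of_mem_closure b hn) h

/-- The affine root `α_i`, or `-θ + δ` at an affine node. -/
def nodeRoot (b : P.Base) : AffNode b → ι × ℤ
  | Sum.inl i => (i, 0)
  | Sum.inr j => (P.reflectionPerm j j, 1)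

theorem simpleRefl_eq (b : P.Base) (i : AffNode b) : simpleRefl b i = affRefl P (nodeRoot b i) := by
  rcases i with i | j
  · simp [simpleRefl, affRefl, nodeRoot, transl]
  · have h : weylGroup.ofIdx P (P.reflectionPerm j j) = weylGroup.ofIdx P j := by
      refine weylGroup_ext fun x => ?_
      simp [RootPairing.reflection_apply]
      module
    simp [simpleRefl, affRefl, nodeRoot, h]

theorem simpleRoot_eq (b : P.Base) (i : AffNode b) : simpleRoot b i = P.root (nodeRoot b i).1 := by
  rcases i with i | j <;> simp [simpleRoot, nodeRoot]

theorem affPos_affNeg (b : P.Base) (p : ι × ℤ) : AffPos b (affNeg P p) ↔ ¬ AffPos b p := by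
  simp only [AffPos, affNeg, isPos_reflectionPerm_self]
  by_cases hp : b.IsPos p.1 <;> simp only [hp] <;> grind

theorem affPos_nodeRoot (b : P.Base) (i : AffNode b) : AffPos b (nodeRoot b i) := by
  rcases i with i | j
  · exact Or.inr ⟨rfl, Base.isPos_of_mem_support i.2⟩
  · exact Or.inl one_pos

/-- The monoid generated by the simple affine roots in `X ⊕ ℤδ`. -/
def affCone (b : P.Base) : AddSubmonoid (X × ℤ) :=
  AddSubmonoid.closure (Set.range fun i => affVec P (nodeRoot b i))

variable [Finite ι]

/-- A root of maximal height among the finitely many roots above the given one is maximal for the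
dominance order as well, since going up strictly raises the height. -/
theorem exists_isHighest (b : P.Base) (i : ι) :
    ∃ j, IsHighest b j ∧ P.root j - P.root i ∈ AddSubmonoid.closure (P.root '' b.support) := by
  obtain ⟨j, hj, hmax⟩ := Set.exists_max_image
    {j | P.root j - P.root i ∈ AddSubmonoid.closure (P.root '' b.support)} b.height
    (Set.toFinite _) ⟨i, by simp⟩
  refine ⟨j, fun k hk => ?_, hj⟩
  have h1 := height_le_of_sub_mem_closure b hk
  refine (h1.2 (le_antisymm h1.1 (hmax k ?_))).symm
  simpa using add_mem hk hj

theorem IsHighest.isPos {b : P.Base} {j : ι} (hj : IsHighest b j) : b.IsPos j := by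
  by_contra h
  have h1 := (isPos_reflectionPerm_self b j).mpr h
  have h2 := (isPos_iff_mem_closure b _).mp h1
  have h3 := hj (P.reflectionPerm j j) (by
    have h4 := add_mem h2 h2
    rw [root_reflectionPerm_self P] at h4 ⊢
    rwa [sub_eq_add_neg])
  rw [h3] at h1
  exact h h1

theorem IsHighest.not_add_pos {b : P.Base} {j k m : ι} (hj : IsHighest b j) (hk : b.IsPos k) :
    P.root m ≠ P.root j + P.root k := by
  intro h
  have h1 : m = j := hj m (by
    rw [h, add_sub_cancel_left]
    exact (isPos_iff_mem_closure b k).mp hk)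
  rw [h1, left_eq_add] at h
  exact P.ne_zero k h

theorem IsHighest.pairing_nonneg {b : P.Base} {j k : ι} (hj : IsHighest b j) (hk : b.IsPos k) :
    0 ≤ P.pairing k j := by
  by_contra! h
  have h1 : P.root k ≠ -P.root j := fun h2 => by
    rw [← root_reflectionPerm_self P] at h2
    rw [P.root.injective h2, isPos_reflectionPerm_self] at hk
    exact hk hj.isPos
  obtain ⟨m, hm⟩ := P.root_add_root_mem_of_pairingIn_neg (i := k) (j := j)
    (by rwa [pairingIn_int]) h1
  exact hj.not_add_pos hk (hm.trans (add_comm _ _))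

variable [P.IsReduced]

theorem pairing_mem_set (P : RootDatum ι X Y) [P.IsReduced] (i j : ι) :
    (P.pairing i j, P.pairing j i) ∈
      ({(0, 0), (1, 1), (-1, -1), (1, 2), (2, 1), (-1, -2), (-2, -1), (1, 3), (3, 1), (-1, -3),
        (-3, -1), (2, 2), (-2, -2)} : Set (ℤ × ℤ)) := by
  simpa only [pairingIn_int] using P.pairingIn_pairingIn_mem_set_of_isCrystal_of_isRed i j

theorem pairing_mem_set_of_ne (P : RootDatum ι X Y) [P.IsReduced] {i j : ι} (hij : i ≠ j)
    (hij' : P.root i ≠ -P.root j) :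
    (P.pairing i j, P.pairing j i) ∈
      ({(0, 0), (1, 1), (-1, -1), (1, 2), (2, 1), (-1, -2), (-2, -1), (1, 3), (3, 1), (-1, -3),
        (-3, -1)} : Set (ℤ × ℤ)) := by
  simpa only [pairingIn_int] using P.pairingIn_pairingIn_mem_set_of_isCrystal_of_isRed' i j
    (P.root.injective.ne hij) hij'

/-- Write `θ` for the root of `j` and `β` for that of `k`. If the pairing of `β` with `θ^∨` were `2`
or `3`, then `θ - β` would be a root, positive because otherwise `β` would lie above `θ`. Reflecting
`-β` (pairing 2) or `θ - β` (pairing 3) in `θ` shows that `θ + (θ - β)` is a root, against the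
maximality of `θ`. -/
theorem IsHighest.pairing_le_one {b : P.Base} {j k : ι} (hj : IsHighest b j) (hkj : k ≠ j)
    (hkj' : P.root k ≠ -P.root j) : P.pairing k j ≤ 1 := by
  by_contra! h
  have h1 := pairing_mem_set_of_ne P hkj hkj'
  simp only [Set.mem_insert_iff, Set.mem_singleton_iff, Prod.mk.injEq] at h1
  obtain ⟨h2, h3⟩ : (P.pairing k j = 2 ∨ P.pairing k j = 3) ∧ P.pairing j k = 1 := by omega
  obtain ⟨m, hm⟩ := P.root_sub_root_mem_of_pairingIn_pos (i := j) (j := k)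
    (by rw [pairingIn_int, h3]; exact one_pos) hkj.symm
  have hmpos : b.IsPos m := by
    by_contra hneg
    refine hj.not_add_pos ((isPos_reflectionPerm_self b m).mpr hneg) (m := k) ?_
    rw [root_reflectionPerm_self, hm]
    abel
  obtain ⟨l, hl⟩ : ∃ l, P.root l = P.root j + P.root m := by
    rcases h2 with h2 | h2
    · refine ⟨P.reflectionPerm j (P.reflectionPerm k k), ?_⟩
      rw [P.root_reflectionPerm, root_reflectionPerm_self, P.reflection_apply, hm]
      simp only [map_neg, RootPairing.root_coroot'_eq_pairing, h2]
      module
    · refine ⟨P.reflectionPerm j m, ?_⟩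
      rw [P.root_reflectionPerm, P.reflection_apply, hm]
      simp only [map_sub, RootPairing.root_coroot'_eq_pairing, RootPairing.pairing_same, h2]
      module
  exact hj.not_add_pos hmpos hl

theorem IsHighest.neg_one_le_pairing {b : P.Base} {j k : ι} (hj : IsHighest b j) (hkj : k ≠ j)
    (hkj' : P.root k ≠ -P.root j) : -1 ≤ P.pairing k j := by
  have h := hj.pairing_le_one (k := P.reflectionPerm k k)
    (fun h => hkj' (by rw [← h, root_reflectionPerm_self P, neg_neg])) (by simpa using hkj)
  rw [P.pairing_reflectionPerm_self_left] at h
  linarith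

theorem affVec_mem_affCone_of_isPos {b : P.Base} {m : X}
    (hm : m ∈ AddSubmonoid.closure (P.root '' b.support)) : (m, (0 : ℤ)) ∈ affCone b := by
  have h : AddSubmonoid.closure (P.root '' b.support) ≤
      (affCone b).comap (AddMonoidHom.inl X ℤ) := by
    rw [AddSubmonoid.closure_le]
    rintro _ ⟨i, hi, rfl⟩
    exact AddSubmonoid.subset_closure ⟨Sum.inl ⟨i, hi⟩, rfl⟩
  exact h hm

/-- Since `δ = θ + (-θ + δ)`, the vector `δ` is in the cone, and every `α + nδ` with `n > 0` is
reached from `-θ + δ` for a highest root `θ` above `-α`. Conversely the cone has nonnegative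
`δ`-coordinate and is the finite cone at level zero. Positivity under a linear map can then be
tested on simple affine roots. -/
theorem affPos_iff_mem_affCone (b : P.Base) (p : ι × ℤ) : AffPos b p ↔ affVec P p ∈ affCone b := by
  constructor
  · obtain ⟨k, n⟩ := p
    rintro (hn | ⟨hn, hk⟩)
    · have key : ∀ j, IsHighest b j → (-P.root j, (1 : ℤ)) ∈ affCone b := fun j hj =>
        AddSubmonoid.subset_closure ⟨Sum.inr ⟨j, hj⟩, by simp [affVec, nodeRoot]⟩
      obtain ⟨j, hj, hjk⟩ := exists_isHighest b (P.reflectionPerm k k)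
      rw [root_reflectionPerm_self P, sub_neg_eq_add] at hjk
      have hδ : ((0 : X), (1 : ℤ)) ∈ affCone b := by
        simpa using add_mem (key j hj) (affVec_mem_affCone_of_isPos
          ((isPos_iff_mem_closure b j).mp hj.isPos))
      have h := add_mem (add_mem (affVec_mem_affCone_of_isPos hjk) (key j hj))
        (nsmul_mem hδ (n - 1).toNat)
      convert h using 1
      simp only at hn
      simp [affVec]
      omega
    · simp only at hn hk
      subst hn
      exact affVec_mem_affCone_of_isPos ((isPos_iff_mem_closure b k).mp hk)
  · intro h
    have key : ∀ v ∈ affCone b, 0 < v.2 ∨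
        (v.2 = 0 ∧ v.1 ∈ AddSubmonoid.closure (P.root '' b.support)) := by
      intro v hv
      induction hv using AddSubmonoid.closure_induction with
      | mem x hx =>
        obtain ⟨i | j, rfl⟩ := hx
        · exact Or.inr ⟨rfl, AddSubmonoid.subset_closure ⟨i, i.2, rfl⟩⟩
        · exact Or.inl one_pos
      | zero => exact Or.inr ⟨rfl, zero_mem _⟩
      | add x y _ _ hx hy =>
        rcases hx with hx | ⟨hx, hx'⟩ <;> rcases hy with hy | ⟨hy, hy'⟩
        · exact Or.inl (add_pos hx hy)
        · exact Or.inl (by simp [hx, hy])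
        · exact Or.inl (by simp [hx, hy])
        · exact Or.inr ⟨by simp [hx, hy], add_mem hx' hy'⟩
    exact (key _ h).imp_right fun h => ⟨h.1, (isPos_iff_mem_closure b _).mpr h.2⟩

/-- A simple reflection permutes the positive affine roots other than its own simple root. At an
affine node the shift of the `δ`-coordinate is the pairing with `θ^∨`, which lies in `{-1, 0, 1}`
away from `±θ`, so the only delicate cases are those landing at level zero. -/
theorem affPos_affRefl_nodeRoot (b : P.Base) (i : AffNode b) {p : ι × ℤ} (hp : AffPos b p)
    (hpi : p ≠ nodeRoot b i) : AffPos b (affAct (affRefl P (nodeRoot b i)) p) := by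
  obtain ⟨k, n⟩ := p
  rcases i with i | ⟨j, hj⟩
  · have h : affAct (affRefl P (nodeRoot b (Sum.inl i))) (k, n) =
        (P.reflectionPerm i k, n) := by
      refine affVec_injective (P := P) ?_
      rw [affVec_affAct, linAct_affRefl]
      simp [affVec, nodeRoot, RootPairing.reflection_apply]
    rw [h]
    refine hp.imp_right fun hp => ⟨hp.1, hp.2.reflectionPerm i.2 fun hki => hpi ?_⟩
    exact Prod.ext hki hp.1
  · have h : affAct (affRefl P (nodeRoot b (Sum.inr ⟨j, hj⟩))) (k, n) =
        (P.reflectionPerm j k, n + P.pairing k j) := by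
      refine affVec_injective (P := P) ?_
      rw [affVec_affAct, linAct_affRefl]
      simp [affVec, nodeRoot, RootPairing.reflection_apply]
      module
    rw [h]
    by_cases hkj : k = j
    · subst hkj
      rcases hp with hp | hp <;> simp only at hp <;> left <;>
        simp only [RootPairing.pairing_same] <;> omega
    by_cases hkj' : P.root k = -P.root j
    · rw [← root_reflectionPerm_self] at hkj'
      obtain rfl := P.root.injective hkj'
      have h2 : n ≠ 1 := fun h => hpi (Prod.ext rfl h)
      have h3 : 0 < n := by
        rcases hp with hp | hp
        · exact hp
        · exact absurd hp.2 (by rw [isPos_reflectionPerm_self, not_not]; exact hj.isPos)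
      simp only [AffPos, RootPairing.pairing_reflectionPerm_self_left, RootPairing.pairing_same,
        RootPairing.reflectionPerm_self]
      by_cases h4 : n = 2
      · exact Or.inr ⟨by omega, hj.isPos⟩
      · exact Or.inl (by omega)
    have h1 := hj.neg_one_le_pairing hkj hkj'
    have h2 := hj.pairing_le_one hkj hkj'
    have h3 : P.root (P.reflectionPerm j k) = P.root k - P.pairing k j • P.root j := by
      rw [P.root_reflectionPerm, P.reflection_apply_root]
    rcases hp with hp | ⟨hp, hkpos⟩
    · simp only at hp
      by_cases h4 : 0 < n + P.pairing k j
      · exact Or.inl h4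
      · refine Or.inr ⟨by simp only; omega, ?_⟩
        by_contra hneg
        refine hj.not_add_pos ((isPos_reflectionPerm_self b _).mpr hneg)
          (m := P.reflectionPerm k k) ?_
        rw [root_reflectionPerm_self, root_reflectionPerm_self, h3,
          show P.pairing k j = -1 by omega]
        module
    · simp only at hp
      have h4 : 0 ≤ P.pairing k j := hj.pairing_nonneg hkpos
      by_cases h5 : P.pairing k j = 0
      · refine Or.inr ⟨by simp only; omega, ?_⟩
        rw [h5, zero_smul, sub_zero] at h3
        simpa only [P.root.injective h3] using hkpos
      · exact Or.inl (by simp only; omega)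

end Positivity

/-! ### Length as the number of inversions -/

section Length

variable {ι X Y : Type*} [AddCommGroup X] [AddCommGroup Y] {P : RootDatum ι X Y} [Finite ι]
  [P.IsReduced]

/-- The positive real affine roots that `w` sends to negative ones. -/
def invSet (b : P.Base) (w : ExtWeyl P) : Set (ι × ℤ) := {p | AffPos b p ∧ ¬ AffPos b (affAct w p)}

theorem finite_invSet (b : P.Base) (w : ExtWeyl P) : (invSet b w).Finite := by
  -- For a fixed finite root, a positive affine root has level at least `0`, and its image is still
  -- positive once the level exceeds the pairing of the image root with the translation part.
  refine (Set.finite_iUnion fun k : ι => (Set.finite_Icc (0 : ℤ)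
    (P.toLinearMap (P.root (P.weylGroupToPerm w.right k)) (translPart w))).image
      fun n => (k, n)).subset ?_
  rintro ⟨k, n⟩ ⟨h1, h2⟩
  refine Set.mem_iUnion.mpr ⟨k, n, ⟨?_, ?_⟩, rfl⟩
  · rcases h1 with h1 | h1
    · exact h1.le
    · exact h1.1.ge
  · by_contra! h
    exact h2 (Or.inl (sub_pos.mpr h))

theorem nodeRoot_simpleRefl (b : P.Base) (i : AffNode b) :
    affAct (simpleRefl b i) (nodeRoot b i) = affNeg P (nodeRoot b i) := by
  rw [simpleRefl_eq, affAct_affRefl_self]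

theorem simpleRefl_mul_self (b : P.Base) (i : AffNode b) : simpleRefl b i * simpleRefl b i = 1 := by
  rw [simpleRefl_eq, affRefl_mul_self]

theorem affPos_simpleRefl (b : P.Base) (i : AffNode b) {p : ι × ℤ} (hp : AffPos b p)
    (hpi : p ≠ nodeRoot b i) : AffPos b (affAct (simpleRefl b i) p) := by
  rw [simpleRefl_eq]
  exact affPos_affRefl_nodeRoot b i hp hpi

theorem affPos_mul_simpleRefl_iff (b : P.Base) (w : ExtWeyl P) (i : AffNode b) :
    AffPos b (affAct (w * simpleRefl b i) (nodeRoot b i)) ↔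
      ¬ AffPos b (affAct w (nodeRoot b i)) := by
  rw [affAct_mul, nodeRoot_simpleRefl, affAct_affNeg, affPos_affNeg]

theorem invSet_mul_simpleRefl (b : P.Base) {w : ExtWeyl P} {i : AffNode b}
    (h : AffPos b (affAct w (nodeRoot b i))) :
    invSet b (w * simpleRefl b i) =
      insert (nodeRoot b i) (affAct (simpleRefl b i) '' invSet b w) := by
  ext p
  constructor
  · rintro ⟨h1, h2⟩
    by_cases hp : p = nodeRoot b i
    · exact Or.inl hp
    · refine Or.inr ⟨affAct (simpleRefl b i) p, ⟨affPos_simpleRefl b i h1 hp, ?_⟩, ?_⟩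
      · rwa [← affAct_mul]
      · rw [← affAct_mul, simpleRefl_mul_self, affAct_one]
  · rintro (rfl | ⟨q, ⟨h1, h2⟩, rfl⟩)
    · exact ⟨affPos_nodeRoot b i, by rwa [affPos_mul_simpleRefl_iff, not_not]⟩
    · refine ⟨affPos_simpleRefl b i h1 fun hq => h2 (hq ▸ h), ?_⟩
      rwa [← affAct_mul, mul_assoc, simpleRefl_mul_self, mul_one]

theorem ncard_invSet_mul_simpleRefl (b : P.Base) {w : ExtWeyl P} {i : AffNode b}
    (h : AffPos b (affAct w (nodeRoot b i))) :
    (invSet b (w * simpleRefl b i)).ncard = (invSet b w).ncard + 1 := by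
  rw [invSet_mul_simpleRefl b h, Set.ncard_insert_of_notMem _ ((finite_invSet b w).image _),
    Set.ncard_image_of_injective _ (affAct_injective _)]
  rintro ⟨q, ⟨h1, _⟩, hq⟩
  have h3 : q = affNeg P (nodeRoot b i) := by
    rw [← nodeRoot_simpleRefl, ← hq, ← affAct_mul, simpleRefl_mul_self, affAct_one]
  rw [h3, affPos_affNeg] at h1
  exact h1 (affPos_nodeRoot b i)

theorem ncard_invSet_mul_simpleRefl_of_neg (b : P.Base) {w : ExtWeyl P} {i : AffNode b}
    (h : ¬ AffPos b (affAct w (nodeRoot b i))) :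
    (invSet b (w * simpleRefl b i)).ncard + 1 = (invSet b w).ncard := by
  rw [← ncard_invSet_mul_simpleRefl b ((affPos_mul_simpleRefl_iff b w i).mpr h), mul_assoc,
    simpleRefl_mul_self, mul_one]

theorem mem_fundGroup_of_forall_affPos (b : P.Base) {w : ExtWeyl P}
    (h : ∀ p, AffPos b p → AffPos b (affAct w p)) : w ∈ fundGroup b := by
  refine fun p => ⟨fun hp => ?_, h p⟩
  by_contra hn
  have h1 := h _ ((affPos_affNeg b p).mpr hn)
  rw [affAct_affNeg, affPos_affNeg] at h1
  exact h1 hp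

/-- Elements without descents preserve the cone generated by the simple affine roots, hence all
positive roots. -/
theorem affPos_of_forall_nodeRoot (b : P.Base) {w : ExtWeyl P}
    (h : ∀ i, AffPos b (affAct w (nodeRoot b i))) : w ∈ fundGroup b := by
  refine mem_fundGroup_of_forall_affPos b fun p hp => ?_
  have h1 : affCone b ≤ (affCone b).comap (linAct w) := by
    rw [affCone, AddSubmonoid.closure_le]
    rintro _ ⟨i, rfl⟩
    have := (affPos_iff_mem_affCone b _).mp (h i)
    rwa [affVec_affAct] at this
  rw [affPos_iff_mem_affCone, affVec_affAct]
  exact h1 ((affPos_iff_mem_affCone b p).mp hp)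

theorem ncard_invSet_eq_zero (b : P.Base) {w : ExtWeyl P} :
    (invSet b w).ncard = 0 ↔ w ∈ fundGroup b := by
  rw [Set.ncard_eq_zero (finite_invSet b w)]
  constructor
  · intro h
    refine mem_fundGroup_of_forall_affPos b fun p hp => ?_
    by_contra hn
    exact Set.notMem_empty p (h ▸ (⟨hp, hn⟩ : p ∈ invSet b w))
  · intro h
    ext p
    simp only [invSet, Set.mem_ofPred_eq, Set.mem_empty_iff_false, iff_false, not_and, not_not]
    exact (h p).mpr

theorem exists_isExpr (b : P.Base) (w : ExtWeyl P) :
    ∃ σ l, IsExpr b w σ l ∧ l.length = (invSet b w).ncard := by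
  induction hn : (invSet b w).ncard generalizing w with
  | zero => exact ⟨w, [], ⟨(ncard_invSet_eq_zero b).mp hn, by simp⟩, rfl⟩
  | succ n ih =>
    obtain ⟨i, hi⟩ : ∃ i, ¬ AffPos b (affAct w (nodeRoot b i)) := by
      by_contra! h
      rw [(ncard_invSet_eq_zero b).mpr (affPos_of_forall_nodeRoot b h)] at hn
      omega
    have h1 := ncard_invSet_mul_simpleRefl_of_neg b hi
    obtain ⟨σ, l, ⟨hσ, hl⟩, hlen⟩ := ih (w * simpleRefl b i) (by omega)
    refine ⟨σ, l ++ [i], ⟨hσ, ?_⟩, by simp [hlen]⟩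
    rw [List.map_append, List.prod_append, ← mul_assoc, ← hl]
    simp [mul_assoc, simpleRefl_mul_self]

theorem IsExpr.ncard_invSet_le {b : P.Base} {w σ : ExtWeyl P} {l : List (AffNode b)}
    (h : IsExpr b w σ l) : (invSet b w).ncard ≤ l.length := by
  induction l using List.reverseRecOn generalizing w with
  | nil =>
    have h1 : w = σ := by simpa using h.2
    rw [h1, (ncard_invSet_eq_zero b).mpr h.1]
    simp
  | append_singleton l i ih =>
    have h1 := ih (w := σ * (l.map (simpleRefl b)).prod) ⟨h.1, rfl⟩
    have h2 : w = σ * (l.map (simpleRefl b)).prod * simpleRefl b i := by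
      rw [h.2, List.map_append, List.prod_append]
      simp [mul_assoc]
    rw [h2, List.length_append, List.length_singleton]
    by_cases h3 : AffPos b (affAct (σ * (l.map (simpleRefl b)).prod) (nodeRoot b i))
    · have := ncard_invSet_mul_simpleRefl b h3
      omega
    · have := ncard_invSet_mul_simpleRefl_of_neg b h3
      omega

/-- Right multiplication by a simple reflection changes the number of inversions by exactly one, and
this number vanishes precisely on `fundGroup b`. Peeling off descents gives an expression of this
length, and no expression can be shorter. -/
theorem len_eq_ncard_invSet (b : P.Base) (w : ExtWeyl P) : len b w = (invSet b w).ncard := by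
  apply le_antisymm
  · obtain ⟨σ, l, h, hl⟩ := exists_isExpr b w
    exact Nat.sInf_le ⟨σ, l, h, hl⟩
  · refine le_csInf ?_ ?_
    · obtain ⟨σ, l, h, hl⟩ := exists_isExpr b w
      exact ⟨_, σ, l, h, hl⟩
    · rintro n ⟨σ, l, h, rfl⟩
      exact h.ncard_invSet_le

theorem exists_isReducedExpr (b : P.Base) (w : ExtWeyl P) : ∃ σ l, IsReducedExpr b w σ l := by
  obtain ⟨σ, l, h, hl⟩ := exists_isExpr b w
  exact ⟨σ, l, h, by rw [hl, len_eq_ncard_invSet]⟩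

theorem len_mul_simpleRefl (b : P.Base) {w : ExtWeyl P} {i : AffNode b}
    (h : AffPos b (affAct w (nodeRoot b i))) : len b (w * simpleRefl b i) = len b w + 1 := by
  simp only [len_eq_ncard_invSet, ncard_invSet_mul_simpleRefl b h]

theorem len_mul_simpleRefl_of_neg (b : P.Base) {w : ExtWeyl P} {i : AffNode b}
    (h : ¬ AffPos b (affAct w (nodeRoot b i))) : len b (w * simpleRefl b i) + 1 = len b w := by
  simp only [len_eq_ncard_invSet, ncard_invSet_mul_simpleRefl_of_neg b h]

theorem len_mul_simpleRefl_le (b : P.Base) (w : ExtWeyl P) (i : AffNode b) :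
    len b (w * simpleRefl b i) ≤ len b w + 1 := by
  by_cases h : AffPos b (affAct w (nodeRoot b i))
  · exact (len_mul_simpleRefl b h).le
  · have := len_mul_simpleRefl_of_neg b h
    omega

theorem len_eq_zero_iff (b : P.Base) {w : ExtWeyl P} : len b w = 0 ↔ w ∈ fundGroup b := by
  rw [len_eq_ncard_invSet, ncard_invSet_eq_zero]

theorem exists_descent (b : P.Base) {w : ExtWeyl P} (h : w ∉ fundGroup b) :
    ∃ i, ¬ AffPos b (affAct w (nodeRoot b i)) := by
  by_contra! h1
  exact h (affPos_of_forall_nodeRoot b h1)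

theorem simpleRefl_mul_affRefl (b : P.Base) (i : AffNode b) (p : ι × ℤ) :
    simpleRefl b i * affRefl P p = affRefl P (affAct (simpleRefl b i) p) * simpleRefl b i := by
  rw [← affRefl_conj, inv_mul_cancel_right]

/-- Induction on the length: strip a descent `s_i` of `w` and replace the root by its image under
`s_i`, which stays positive unless the root is the simple one. In that exceptional case the
reflection is `s_i` itself. -/
theorem len_mul_affRefl_lt (b : P.Base) {w : ExtWeyl P} {p : ι × ℤ} (hp : AffPos b p)
    (h : ¬ AffPos b (affAct w p)) : len b (w * affRefl P p) < len b w := by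
  induction hn : len b w generalizing w p with
  | zero => exact absurd (((len_eq_zero_iff b).mp hn p).mpr hp) h
  | succ n ih =>
    obtain ⟨i, hi⟩ := exists_descent b (w := w) fun hw => by
      rw [(len_eq_zero_iff b).mpr hw] at hn
      omega
    have h1 := len_mul_simpleRefl_of_neg b hi
    by_cases hpi : p = nodeRoot b i
    · rw [hpi, ← simpleRefl_eq]
      omega
    · have h2 := ih (w := w * simpleRefl b i) (affPos_simpleRefl b i hp hpi)
        (by rwa [← affAct_mul, mul_assoc, simpleRefl_mul_self, mul_one]) (by omega)
      have h3 := len_mul_simpleRefl_le b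
        (w * simpleRefl b i * affRefl P (affAct (simpleRefl b i) p)) i
      rw [mul_assoc, ← simpleRefl_mul_affRefl, mul_assoc, ← mul_assoc (simpleRefl b i),
        simpleRefl_mul_self, one_mul] at h3
      omega

theorem lt_len_mul_affRefl (b : P.Base) {w : ExtWeyl P} {p : ι × ℤ} (hp : AffPos b p)
    (h : AffPos b (affAct w p)) : len b w < len b (w * affRefl P p) := by
  have h1 := len_mul_affRefl_lt b (w := w * affRefl P p) hp (by
    rwa [affAct_mul, affAct_affRefl_self, affAct_affNeg, affPos_affNeg, not_not])
  rwa [mul_assoc, affRefl_mul_self, mul_one] at h1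

theorem lt_len_mul_affRefl_iff (b : P.Base) {w : ExtWeyl P} {p : ι × ℤ} (hp : AffPos b p) :
    len b w < len b (w * affRefl P p) ↔ AffPos b (affAct w p) := by
  refine ⟨fun h => ?_, lt_len_mul_affRefl b hp⟩
  by_contra hn
  exact absurd (len_mul_affRefl_lt b hp hn) (by omega)

/-- The conjugate `σ s_i σ⁻¹` negates a positive root, so it has some descent `j`. As `σ` preserves
positivity, `s_i` must negate the positive root `σ⁻¹ α_j`, which forces this root to be `α_i`. -/
theorem exists_affAct_nodeRoot_of_mem_fundGroup (b : P.Base) {σ : ExtWeyl P} (hσ : σ ∈ fundGroup b)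
    (i : AffNode b) : ∃ j, affAct σ (nodeRoot b i) = nodeRoot b j := by
  have hp : AffPos b (affAct σ (nodeRoot b i)) := (hσ _).mpr (affPos_nodeRoot b i)
  obtain ⟨j, hj⟩ := exists_descent b (w := affRefl P (affAct σ (nodeRoot b i))) fun h => by
    have h1 := (h _).mpr hp
    rw [affAct_affRefl_self, affPos_affNeg] at h1
    exact h1 hp
  refine ⟨j, ?_⟩
  rw [← affRefl_conj, ← simpleRefl_eq, mul_assoc, affAct_mul, hσ, affAct_mul] at hj
  have h1 : affAct σ⁻¹ (nodeRoot b j) = nodeRoot b i := by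
    by_contra h
    exact hj (affPos_simpleRefl b i
      (((fundGroup b).inv_mem hσ _).mpr (affPos_nodeRoot b j)) h)
  rw [← h1, affAct_affAct_inv]

end Length

/-! ### The finite Weyl group and its simple reflections -/

section FiniteWeyl

variable {ι X Y : Type*} [AddCommGroup X] [AddCommGroup Y] {P : RootDatum ι X Y} [Finite ι]
  [P.IsReduced]

theorem finW_mul (u v : P.weylGroup) : finW P (u * v) = finW P u * finW P v := map_mul _ u v

theorem finW_one : finW P 1 = 1 := map_one _

theorem affRefl_zero (k : ι) : affRefl P (k, 0) = finW P (weylGroup.ofIdx P k) := by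
  simp [affRefl, transl]

theorem exists_finW_ofIdx_eq_prod (b : P.Base) (k : ι) : ∃ l : List b.support,
    finW P (weylGroup.ofIdx P k) = (l.map fun i => simpleRefl b (Sum.inl i)).prod := by
  simp only [← affRefl_zero]
  refine b.induction_reflect (p := fun k => ∃ l : List b.support,
    affRefl P (k, 0) = (l.map fun i => simpleRefl b (Sum.inl i)).prod) k ?_ ?_ ?_
  · rintro i ⟨l, hl⟩
    refine ⟨l, ?_⟩
    rw [← hl, ← affRefl_affNeg (i, 0)]
    simp only [affNeg, neg_zero]
  · intro i hi
    exact ⟨[⟨i, hi⟩], by rw [affRefl_zero]; simp [simpleRefl]⟩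
  · rintro i j ⟨l, hl⟩ hj
    refine ⟨⟨j, hj⟩ :: (l ++ [⟨j, hj⟩]), ?_⟩
    have h1 : affAct (affRefl P (j, 0)) (i, 0) = (P.reflectionPerm j i, 0) := by
      refine affVec_injective (P := P) ?_
      rw [affVec_affAct, linAct_affRefl]
      simp [affVec, RootPairing.reflection_apply]
    rw [← h1, ← affRefl_conj, affRefl_inv, hl]
    simp [simpleRefl, affRefl_zero, mul_assoc]

theorem exists_finW_eq_prod (b : P.Base) (u : P.weylGroup) : ∃ l : List b.support,
    finW P u = (l.map fun i => simpleRefl b (Sum.inl i)).prod := by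
  obtain ⟨u, hu⟩ := u
  induction hu using weylGroup.induction with
  | mem i => exact exists_finW_ofIdx_eq_prod b i
  | one => exact ⟨[], finW_one⟩
  | mul x y hx hy h1 h2 =>
    obtain ⟨l, hl⟩ := h1
    obtain ⟨m, hm⟩ := h2
    refine ⟨l ++ m, ?_⟩
    rw [List.map_append, List.prod_append, ← hl, ← hm, ← finW_mul]
    rfl

/-- The exchange condition for words in the finite simple reflections only. It is needed separately
from the length function because the letters of the shortened word must remain finite nodes. -/
theorem exists_shorter_word (b : P.Base) (l : List b.support) {p : ι × ℤ} (hp : AffPos b p)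
    (h : ¬ AffPos b (affAct (l.map fun i => simpleRefl b (Sum.inl i)).prod p)) :
    ∃ m : List b.support, m.length < l.length ∧
      (l.map fun i => simpleRefl b (Sum.inl i)).prod * affRefl P p =
        (m.map fun i => simpleRefl b (Sum.inl i)).prod := by
  induction l using List.reverseRecOn generalizing p with
  | nil => exact absurd hp (by simpa [affAct_one] using h)
  | append_singleton l i ih =>
    simp only [List.map_append, List.prod_append, List.map_singleton, List.prod_singleton] at h ⊢
    by_cases hpi : p = nodeRoot b (Sum.inl i)
    · refine ⟨l, by simp, ?_⟩
      rw [hpi, ← simpleRefl_eq, mul_assoc, simpleRefl_mul_self, mul_one]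
    · rw [affAct_mul] at h
      obtain ⟨m, hm, hm'⟩ := ih (affPos_simpleRefl b _ hp hpi) h
      refine ⟨m ++ [i], by simpa using hm, ?_⟩
      rw [mul_assoc, simpleRefl_mul_affRefl, ← mul_assoc, hm']
      simp

theorem prod_eq_one_of_mem_fundGroup (b : P.Base) (l : List b.support)
    (h : (l.map fun i => simpleRefl b (Sum.inl i)).prod ∈ fundGroup b) :
    (l.map fun i => simpleRefl b (Sum.inl i)).prod = 1 := by
  induction hn : l.length using Nat.strong_induction_on generalizing l with
  | _ n ih =>
    rcases l.eq_nil_or_concat with rfl | ⟨m, i, rfl⟩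
    · simp
    · have h0 : ((m.concat i).map fun i => simpleRefl b (Sum.inl i)).prod =
          (m.map fun i => simpleRefl b (Sum.inl i)).prod * simpleRefl b (Sum.inl i) := by simp
      have h1 := (h (nodeRoot b (Sum.inl i))).mpr (affPos_nodeRoot b _)
      rw [h0, affPos_mul_simpleRefl_iff] at h1
      -- The whole word keeps `α_i` positive, so the word without its last letter sends `α_i` to a
      -- negative root, and exchange shortens the product with `s_i`.
      obtain ⟨m', hm, hm'⟩ := exists_shorter_word b m (affPos_nodeRoot b _) h1
      rw [← simpleRefl_eq, ← h0] at hm'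
      rw [hm'] at h ⊢
      exact ih m'.length (by simp at hn; omega) m' h rfl

theorem affAct_finW (u : P.weylGroup) (p : ι × ℤ) :
    affAct (finW P u) p = (P.weylGroupToPerm u p.1, p.2) := by
  simp [affAct, finW, translPart]

/-- An element of the finite Weyl group that preserves the positive roots is trivial. -/
theorem weylGroup_eq_one_of_isPos (b : P.Base) {u : P.weylGroup}
    (h : ∀ i : b.support, AffPos b (affAct (finW P u) (nodeRoot b (Sum.inl i)))) : u = 1 := by
  have h1 : finW P u ∈ fundGroup b := by
    refine mem_fundGroup_of_forall_affPos b fun p hp => ?_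
    rw [affAct_finW]
    refine hp.imp_right fun hp => ⟨hp.1, ?_⟩
    have h2 : AddSubmonoid.closure (P.root '' b.support) ≤
        (AddSubmonoid.closure (P.root '' b.support)).comap
          (DistribSMul.toAddMonoidHom X u) := by
      rw [AddSubmonoid.closure_le]
      rintro _ ⟨i, hi, rfl⟩
      have h3 := h ⟨i, hi⟩
      rw [affAct_finW] at h3
      have h4 := (isPos_iff_mem_closure b _).mp (h3.resolve_left (lt_irrefl 0)).2
      rwa [← weylGroup_apply_root] at h4
    rw [isPos_iff_mem_closure, ← weylGroup_apply_root]
    exact h2 ((isPos_iff_mem_closure b _).mp hp.2)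
  obtain ⟨l, hl⟩ := exists_finW_eq_prod b u
  rw [hl] at h1
  have h2 := hl.trans (prod_eq_one_of_mem_fundGroup b l h1)
  exact SemidirectProduct.inr_injective h2

end FiniteWeyl

/-! ### Bruhat order, lifting property and minimal coset representatives -/

section Bruhat

variable {ι X Y : Type*} [AddCommGroup X] [AddCommGroup Y] {P : RootDatum ι X Y} [Finite ι]
  [P.IsReduced]

theorem IsRefl.exists_affPos {b : P.Base} {t : ExtWeyl P} (ht : IsRefl b t) :
    ∃ p, AffPos b p ∧ t = affRefl P p := by
  obtain ⟨x, -, i, rfl⟩ := ht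
  rw [simpleRefl_eq, affRefl_conj]
  by_cases h : AffPos b (affAct x (nodeRoot b i))
  · exact ⟨_, h, rfl⟩
  · exact ⟨_, (affPos_affNeg b _).mpr h, (affRefl_affNeg _).symm⟩

theorem simpleRefl_mem_affWeyl (b : P.Base) (i : AffNode b) : simpleRefl b i ∈ affWeyl b :=
  Subgroup.subset_closure ⟨i, rfl⟩

theorem isRefl_simpleRefl (b : P.Base) (i : AffNode b) : IsRefl b (simpleRefl b i) :=
  ⟨1, one_mem _, i, by simp⟩

theorem simpleRefl_inv (b : P.Base) (i : AffNode b) : (simpleRefl b i)⁻¹ = simpleRefl b i :=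
  inv_eq_of_mul_eq_one_right (simpleRefl_mul_self b i)

theorem IsRefl.conj {b : P.Base} {t : ExtWeyl P} (ht : IsRefl b t) (i : AffNode b) :
    IsRefl b (simpleRefl b i * t * simpleRefl b i) := by
  obtain ⟨x, hx, j, rfl⟩ := ht
  refine ⟨simpleRefl b i * x, mul_mem (simpleRefl_mem_affWeyl b i) hx, j, ?_⟩
  rw [mul_inv_rev, simpleRefl_inv]
  simp only [mul_assoc]

theorem BruhatLE.len_le {b : P.Base} {v w : ExtWeyl P} (h : BruhatLE b v w) :
    len b v ≤ len b w := by
  induction h with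
  | refl => exact le_rfl
  | tail _ h1 ih => exact ih.trans h1.1.le

theorem BruhatLT.len_lt {b : P.Base} {v w : ExtWeyl P} (h : BruhatLT b v w) :
    len b v < len b w := by
  induction h with
  | single h1 => exact h1.1
  | tail _ h1 ih => exact ih.trans h1.1

theorem BruhatLE.eq_of_len_le {b : P.Base} {v w : ExtWeyl P} (h : BruhatLE b v w)
    (hl : len b w ≤ len b v) : v = w := by
  rcases Relation.reflTransGen_iff_eq_or_transGen.mp h with h | h
  · exact h.symm
  · exact absurd (BruhatLT.len_lt h) (by omega)

theorem bruhatStep_mul_simpleRefl (b : P.Base) {w : ExtWeyl P} {i : AffNode b}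
    (h : AffPos b (affAct w (nodeRoot b i))) : BruhatStep b w (w * simpleRefl b i) :=
  ⟨by rw [len_mul_simpleRefl b h]; omega, _, isRefl_simpleRefl b i, rfl⟩

theorem bruhatStep_of_mul_simpleRefl (b : P.Base) {w : ExtWeyl P} {i : AffNode b}
    (h : ¬ AffPos b (affAct w (nodeRoot b i))) : BruhatStep b (w * simpleRefl b i) w := by
  have h1 := bruhatStep_mul_simpleRefl b ((affPos_mul_simpleRefl_iff b w i).mpr h)
  rwa [mul_assoc, simpleRefl_mul_self, mul_one] at h1

theorem isGr_iff (b : P.Base) (w : ExtWeyl P) :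
    IsGr b w ↔ ∀ i : b.support, AffPos b (affAct w (nodeRoot b (Sum.inl i))) := by
  refine forall_congr' fun i => ⟨fun h => ?_, fun h => .single (bruhatStep_mul_simpleRefl b h)⟩
  by_contra hn
  have h1 := len_mul_simpleRefl_of_neg b hn
  have h2 := BruhatLT.len_lt h
  omega

/-- The longer of `w` and `w s_i`. -/
def upper (b : P.Base) (i : AffNode b) (w : ExtWeyl P) : ExtWeyl P :=
  open Classical in if AffPos b (affAct w (nodeRoot b i)) then w * simpleRefl b i else w

/-- The shorter of `w` and `w s_i`. -/
def lower (b : P.Base) (i : AffNode b) (w : ExtWeyl P) : ExtWeyl P :=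
  open Classical in if AffPos b (affAct w (nodeRoot b i)) then w else w * simpleRefl b i

theorem bruhatLE_upper (b : P.Base) (i : AffNode b) (w : ExtWeyl P) :
    BruhatLE b w (upper b i w) ∧ BruhatLE b (w * simpleRefl b i) (upper b i w) := by
  unfold upper
  split_ifs with h
  · exact ⟨.single (bruhatStep_mul_simpleRefl b h), .refl⟩
  · exact ⟨.refl, .single (bruhatStep_of_mul_simpleRefl b h)⟩

theorem lower_bruhatLE (b : P.Base) (i : AffNode b) (w : ExtWeyl P) :
    BruhatLE b (lower b i w) w ∧ BruhatLE b (lower b i w) (w * simpleRefl b i) := by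
  unfold lower
  split_ifs with h
  · exact ⟨.refl, .single (bruhatStep_mul_simpleRefl b h)⟩
  · exact ⟨.single (bruhatStep_of_mul_simpleRefl b h), .refl⟩

theorem upper_mul_simpleRefl (b : P.Base) (i : AffNode b) (w : ExtWeyl P) :
    upper b i (w * simpleRefl b i) = upper b i w := by
  unfold upper
  rw [affPos_mul_simpleRefl_iff, mul_assoc, simpleRefl_mul_self, mul_one]
  split_ifs <;> rfl

theorem lower_mul_simpleRefl (b : P.Base) (i : AffNode b) (w : ExtWeyl P) :
    lower b i (w * simpleRefl b i) = lower b i w := by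
  unfold lower
  rw [affPos_mul_simpleRefl_iff, mul_assoc, simpleRefl_mul_self, mul_one]
  split_ifs <;> rfl

theorem BruhatStep.upper_lower {b : P.Base} {v w : ExtWeyl P} (h : BruhatStep b v w)
    (i : AffNode b) : BruhatLE b (upper b i v) (upper b i w) ∧
      BruhatLE b (lower b i v) (lower b i w) := by
  obtain ⟨hlt, t, ht, rfl⟩ := h
  obtain ⟨p, hp, rfl⟩ := ht.exists_affPos
  by_cases hpi : p = nodeRoot b i
  · rw [hpi, ← simpleRefl_eq, upper_mul_simpleRefl, lower_mul_simpleRefl]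
    exact ⟨.refl, .refl⟩
  have h0 : simpleRefl b i * (simpleRefl b i * affRefl P p * simpleRefl b i) =
      affRefl P p * simpleRefl b i := by
    rw [← mul_assoc, ← mul_assoc, simpleRefl_mul_self, one_mul]
  -- Away from `t = s_i`, conjugating `t` by `s_i` keeps its root positive, so multiplying both ends
  -- on the right by `s_i` gives another Bruhat step. The bounds for `upper` and `lower` combine
  -- this step with the original one.
  have h1 : BruhatStep b (v * simpleRefl b i) (v * affRefl P p * simpleRefl b i) := by
    refine ⟨?_, _, ht.conj i, ?_⟩
    · rw [lt_len_mul_affRefl_iff b hp] at hlt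
      have h3 := affPos_simpleRefl b i hp hpi
      have h2 := (lt_len_mul_affRefl_iff b (w := v * simpleRefl b i) h3).mpr (by
        rwa [← affAct_mul, mul_assoc, simpleRefl_mul_self, mul_one])
      rwa [← affRefl_conj, simpleRefl_inv, mul_assoc, h0, ← mul_assoc] at h2
    · rw [mul_assoc v (simpleRefl b i), h0, ← mul_assoc]
  have h2 : BruhatStep b v (v * affRefl P p) := ⟨hlt, _, ht, rfl⟩
  constructor
  · obtain ⟨h3, h4⟩ := bruhatLE_upper b i (v * affRefl P p)
    by_cases h5 : AffPos b (affAct v (nodeRoot b i))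
    · rw [upper, if_pos h5]
      exact (Relation.ReflTransGen.single h1).trans h4
    · rw [upper, if_neg h5]
      exact (Relation.ReflTransGen.single h2).trans h3
  · obtain ⟨h3, h4⟩ := lower_bruhatLE b i v
    by_cases h5 : AffPos b (affAct (v * affRefl P p) (nodeRoot b i))
    · rw [lower.eq_def _ _ (v * _), if_pos h5]
      exact h3.trans (.single h2)
    · rw [lower.eq_def _ _ (v * _), if_neg h5]
      exact h4.trans (.single h1)

theorem BruhatLE.upper_lower {b : P.Base} {v w : ExtWeyl P} (h : BruhatLE b v w)
    (i : AffNode b) : BruhatLE b (upper b i v) (upper b i w) ∧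
      BruhatLE b (lower b i v) (lower b i w) := by
  induction h with
  | refl => exact ⟨.refl, .refl⟩
  | tail _ h1 ih => exact ⟨ih.1.trans (h1.upper_lower i).1, ih.2.trans (h1.upper_lower i).2⟩

/-- The lifting property. -/
theorem bruhatLE_mul_simpleRefl_iff (b : P.Base) {w : ExtWeyl P} {i : AffNode b}
    (h : AffPos b (affAct w (nodeRoot b i))) (v : ExtWeyl P) :
    BruhatLE b v (w * simpleRefl b i) ↔ BruhatLE b (lower b i v) w := by
  constructor
  · intro h1
    have h2 := (h1.upper_lower i).2
    rwa [lower_mul_simpleRefl, lower.eq_def _ _ w, if_pos h] at h2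
  · intro h1
    have h2 := (h1.upper_lower i).1
    rw [upper.eq_def _ _ w, if_pos h] at h2
    refine Relation.ReflTransGen.trans ?_ h2
    have h3 : upper b i (lower b i v) = upper b i v := by
      rw [lower]
      split_ifs
      · rfl
      · rw [upper_mul_simpleRefl]
    rw [h3]
    exact (bruhatLE_upper b i v).1

/-- The elements one step below `w` are products of `w` with reflections in inversions of `w`, a
finite set. Induction on the length does the rest. -/
theorem finite_bruhatLE (b : P.Base) (w : ExtWeyl P) : {v | BruhatLE b v w}.Finite := by
  induction hn : len b w using Nat.strong_induction_on generalizing w with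
  | _ n ih =>
    have h1 : {v | BruhatStep b v w}.Finite := by
      refine ((finite_invSet b w).image fun p => w * affRefl P p).subset ?_
      rintro v ⟨hlt, t, ht, rfl⟩
      obtain ⟨p, hp, rfl⟩ := ht.exists_affPos
      refine ⟨p, ⟨hp, ?_⟩, by simp [mul_assoc, affRefl_mul_self]⟩
      rwa [affAct_mul, affAct_affRefl_self, affAct_affNeg, affPos_affNeg, not_not,
        ← lt_len_mul_affRefl_iff b hp]
    refine ((h1.biUnion fun v hv => ih (len b v) (hn ▸ hv.1) v rfl).insert w).subset ?_
    intro v hv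
    rcases Relation.ReflTransGen.cases_tail hv with h | ⟨u, h, h'⟩
    · exact Or.inl h.symm
    · exact Or.inr (Set.mem_biUnion h' h)

theorem simpleRefl_inl (b : P.Base) (i : b.support) :
    simpleRefl b (Sum.inl i) = finW P (weylGroup.ofIdx P i) := rfl

/-- An affine Grassmannian element keeps all finite positive roots positive. If `x` negated a simple
root, `v` would send a negative finite root to a positive affine root. -/
theorem isGr_mul_finW_unique (b : P.Base) {v : ExtWeyl P} {x : P.weylGroup} (hv : IsGr b v)
    (hx : IsGr b (v * finW P x)) : x = 1 := by
  refine weylGroup_eq_one_of_isPos b fun i => ?_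
  by_contra h
  have h1 := (isGr_iff b _).mp hx i
  rw [affAct_mul] at h1
  rw [isGr_iff] at hv
  have h2 : ∀ k, b.IsPos k → AffPos b (affAct v (k, 0)) := by
    intro k hk
    have h3 : affVec P (affAct v (k, 0)) ∈ affCone b := by
      have h4 : AddSubmonoid.closure (P.root '' b.support) ≤
          (affCone b).comap ((linAct v).comp (AddMonoidHom.inl X ℤ)) := by
        rw [AddSubmonoid.closure_le]
        rintro _ ⟨i, hi, rfl⟩
        have h5 := (affPos_iff_mem_affCone b _).mp (hv ⟨i, hi⟩)
        rwa [affVec_affAct] at h5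
      rw [affVec_affAct]
      exact h4 ((isPos_iff_mem_closure b k).mp hk)
    exact (affPos_iff_mem_affCone b _).mpr h3
  rw [affAct_finW] at h h1
  have h6 : ¬ b.IsPos (P.weylGroupToPerm x i) := fun h7 => h (Or.inr ⟨rfl, h7⟩)
  have h8 := h2 _ ((isPos_reflectionPerm_self b _).mpr h6)
  have h9 : (P.reflectionPerm (P.weylGroupToPerm x i) (P.weylGroupToPerm x i), (0 : ℤ)) =
      affNeg P (P.weylGroupToPerm x i, 0) := by simp [affNeg]
  rw [h9, affAct_affNeg, affPos_affNeg] at h8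
  exact h8 h1

/-- Any element of the coset `vW` that is not affine Grassmannian can be shortened within the coset
by a finite descent, and the descent stops only at `v`. Thus `v` is the unique shortest element of
`vW`, which is what the triangularity of the Schubert elements uses. -/
theorem IsGr.len_le_mul_finW {b : P.Base} {v : ExtWeyl P} (hv : IsGr b v) (x : P.weylGroup) :
    len b v ≤ len b (v * finW P x) ∧ (len b (v * finW P x) ≤ len b v → x = 1) := by
  induction hn : len b (v * finW P x) using Nat.strong_induction_on generalizing x with
  | _ n ih =>
    by_cases hx : IsGr b (v * finW P x)
    · obtain rfl := isGr_mul_finW_unique b hv hx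
      rw [finW_one, mul_one] at hn
      exact ⟨hn.le, fun _ => rfl⟩
    · rw [isGr_iff] at hx
      push Not at hx
      obtain ⟨i, hi⟩ := hx
      have h1 := len_mul_simpleRefl_of_neg b hi
      rw [mul_assoc, simpleRefl_inl, ← finW_mul] at h1
      have h2 := (ih (len b (v * finW P (x * weylGroup.ofIdx P i))) (by omega) _ rfl).1
      exact ⟨by omega, fun h => by omega⟩

end Bruhat

/-! ### Rank two expansions of words in Demazure operators -/

section RankTwo

/-- This lemma and the next five expand the longest words of rank two. The suffix of the name is the
pair `(a, a')` with `a = -⟨β, α^∨⟩` and `a' = -⟨α, β^∨⟩`; `u m n` stands for `(1 - e^{mα + nβ})⁻¹`,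
the list in `hu` consists of the positive roots, and `x`, `y` are the images of `e^α`, `e^β` in a
field. With `ψ₀ = s₂ - 1` the innermost argument is `T₂`, and the word becomes the product of the
`u` over the positive roots times an alternating sum. The result is symmetric in the two nodes,
which is the source of the braid relation. -/
theorem demazure_word_zero {F K M : Type*} [CommRing F] [Field K] [AddCommGroup M]
    [Module F M] (φ : F →+* K) (hφ : Function.Injective φ) (σ₁ σ₂ : F →+* F) (s₁ s₂ : M →+ M)
    (hs₁ : ∀ f m, s₁ (f • m) = σ₁ f • s₁ m) (hs₂ : ∀ f m, s₂ (f • m) = σ₂ f • s₂ m)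
    (u : ℤ → ℤ → F) (hσ₁ : ∀ m n, σ₁ (u m n) = u (-m + 0 * n) n)
    (hσ₂ : ∀ m n, σ₂ (u m n) = u m (0 * m - n)) (x y : K)
    (hu : ∀ p ∈ [((1 : ℤ), (0 : ℤ)), (0, 1)],
      x ^ p.1 * y ^ p.2 ≠ 1 ∧ φ (u p.1 p.2) = (1 - x ^ p.1 * y ^ p.2)⁻¹ ∧
      φ (u (-p.1) (-p.2)) = -(x ^ p.1 * y ^ p.2) * (1 - x ^ p.1 * y ^ p.2)⁻¹)
    (ψ₀ ψ₁ : M)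
    (h₀ : s₂ ψ₀ = -ψ₀) (h₁ : s₁ ψ₀ = ψ₁)
    (T₁ T₂ : M → M) (hT₁ : ∀ m, T₁ m = u 1 0 • (s₁ m - m))
    (hT₂ : ∀ m, T₂ m = u 0 1 • (s₂ m - m)) :
    T₁ (u 0 1 • ψ₀) =
      (u 1 0 * u 0 1) • (ψ₁ - ψ₀) := by
  simp only [List.forall_mem_cons, zpow_one, zpow_zero, mul_one, one_mul, neg_zero, zpow_ofNat,
    pow_one, pow_zero] at hu
  obtain ⟨⟨n1, e1, f1⟩, ⟨n2, e2, f2⟩, -⟩ := hu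
  have g1 := sub_ne_zero.mpr n1.symm
  have g2 := sub_ne_zero.mpr n2.symm
  simp only [hT₁, hT₂, hs₁, hs₂, map_sub, map_add, map_neg, smul_sub, smul_add, smul_neg,
    smul_smul, map_mul, hσ₁, hσ₂, h₀, h₁]
  norm_num

theorem demazure_word_one_one {F K M : Type*} [CommRing F] [Field K] [AddCommGroup M]
    [Module F M] (φ : F →+* K) (hφ : Function.Injective φ) (σ₁ σ₂ : F →+* F) (s₁ s₂ : M →+ M)
    (hs₁ : ∀ f m, s₁ (f • m) = σ₁ f • s₁ m) (hs₂ : ∀ f m, s₂ (f • m) = σ₂ f • s₂ m)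
    (u : ℤ → ℤ → F) (hσ₁ : ∀ m n, σ₁ (u m n) = u (-m + 1 * n) n)
    (hσ₂ : ∀ m n, σ₂ (u m n) = u m (1 * m - n)) (x y : K)
    (hu : ∀ p ∈ [((1 : ℤ), (0 : ℤ)), (0, 1), (1, 1)],
      x ^ p.1 * y ^ p.2 ≠ 1 ∧ φ (u p.1 p.2) = (1 - x ^ p.1 * y ^ p.2)⁻¹ ∧
      φ (u (-p.1) (-p.2)) = -(x ^ p.1 * y ^ p.2) * (1 - x ^ p.1 * y ^ p.2)⁻¹)
    (ψ₀ ψ₁ ψ₂ : M)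
    (h₀ : s₂ ψ₀ = -ψ₀) (h₁ : s₁ ψ₀ = ψ₁) (h₂ : s₂ ψ₁ = ψ₂)
    (T₁ T₂ : M → M) (hT₁ : ∀ m, T₁ m = u 1 0 • (s₁ m - m))
    (hT₂ : ∀ m, T₂ m = u 0 1 • (s₂ m - m)) :
    T₂ (T₁ (u 0 1 • ψ₀)) =
      (u 1 0 * u 0 1 * u 1 1) • (ψ₂ - ψ₁ + ψ₀) := by
  simp only [List.forall_mem_cons, zpow_one, zpow_zero, mul_one, one_mul, neg_zero, zpow_ofNat,
    pow_one, pow_zero] at hu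
  obtain ⟨⟨n1, e1, f1⟩, ⟨n2, e2, f2⟩, ⟨n3, e3, f3⟩, -⟩ := hu
  have g1 := sub_ne_zero.mpr n1.symm
  have g2 := sub_ne_zero.mpr n2.symm
  have g3 := sub_ne_zero.mpr n3.symm
  have g3' : 1 - y * x ≠ 0 := by rwa [mul_comm y x]
  simp only [hT₁, hT₂, hs₁, hs₂, map_sub, map_add, map_neg, smul_sub, smul_add, smul_neg,
    smul_smul, map_mul, hσ₁, hσ₂, h₀, h₁, h₂]
  norm_num
  -- Comparing coefficients of the `ψ`'s leaves identities between rational functions of `x` and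
  -- `y`, which can be checked in the field `K` by injectivity of `φ`.
  match_scalars
  all_goals
    apply hφ
    simp only [map_mul, map_add, map_sub, map_neg, map_one, e1, e2, e3, f1, f2, f3]
    field_simp
    try ring

theorem demazure_word_two_one {F K M : Type*} [CommRing F] [Field K] [AddCommGroup M]
    [Module F M] (φ : F →+* K) (hφ : Function.Injective φ) (σ₁ σ₂ : F →+* F) (s₁ s₂ : M →+ M)
    (hs₁ : ∀ f m, s₁ (f • m) = σ₁ f • s₁ m) (hs₂ : ∀ f m, s₂ (f • m) = σ₂ f • s₂ m)
    (u : ℤ → ℤ → F) (hσ₁ : ∀ m n, σ₁ (u m n) = u (-m + 2 * n) n)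
    (hσ₂ : ∀ m n, σ₂ (u m n) = u m (1 * m - n)) (x y : K)
    (hu : ∀ p ∈ [((1 : ℤ), (0 : ℤ)), (0, 1), (1, 1), (2, 1)],
      x ^ p.1 * y ^ p.2 ≠ 1 ∧ φ (u p.1 p.2) = (1 - x ^ p.1 * y ^ p.2)⁻¹ ∧
      φ (u (-p.1) (-p.2)) = -(x ^ p.1 * y ^ p.2) * (1 - x ^ p.1 * y ^ p.2)⁻¹)
    (ψ₀ ψ₁ ψ₂ ψ₃ : M)
    (h₀ : s₂ ψ₀ = -ψ₀) (h₁ : s₁ ψ₀ = ψ₁) (h₂ : s₁ ψ₁ = ψ₀) (h₃ : s₂ ψ₁ = ψ₂) (h₄ : s₁ ψ₂ = ψ₃)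
    (T₁ T₂ : M → M) (hT₁ : ∀ m, T₁ m = u 1 0 • (s₁ m - m))
    (hT₂ : ∀ m, T₂ m = u 0 1 • (s₂ m - m)) :
    T₁ (T₂ (T₁ (u 0 1 • ψ₀))) =
      (u 1 0 * u 0 1 * u 1 1 * u 2 1) • (ψ₃ - ψ₂ + ψ₁ - ψ₀) := by
  simp only [List.forall_mem_cons, zpow_one, zpow_zero, mul_one, one_mul, neg_zero, zpow_ofNat,
    pow_one, pow_zero] at hu
  obtain ⟨⟨n1, e1, f1⟩, ⟨n2, e2, f2⟩, ⟨n3, e3, f3⟩, ⟨n4, e4, f4⟩, -⟩ := hu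
  have g1 := sub_ne_zero.mpr n1.symm
  have g2 := sub_ne_zero.mpr n2.symm
  have g3 := sub_ne_zero.mpr n3.symm
  have g4 := sub_ne_zero.mpr n4.symm
  simp only [hT₁, hT₂, hs₁, hs₂, map_sub, map_add, map_neg, smul_sub, smul_add, smul_neg,
    smul_smul, map_mul, hσ₁, hσ₂, h₀, h₁, h₂, h₃, h₄]
  norm_num
  match_scalars
  all_goals
    apply hφ
    simp only [map_mul, map_add, map_sub, map_neg, map_one, e1, e2, e3, e4, f1, f2, f3, f4]
    field_simp
    try ring

/-- Exchanging the two nodes exchanges `a` and `a'`, so each non-simply-laced type needs both orders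
for the two sides of its braid relation. -/
theorem demazure_word_one_two {F K M : Type*} [CommRing F] [Field K] [AddCommGroup M]
    [Module F M] (φ : F →+* K) (hφ : Function.Injective φ) (σ₁ σ₂ : F →+* F) (s₁ s₂ : M →+ M)
    (hs₁ : ∀ f m, s₁ (f • m) = σ₁ f • s₁ m) (hs₂ : ∀ f m, s₂ (f • m) = σ₂ f • s₂ m)
    (u : ℤ → ℤ → F) (hσ₁ : ∀ m n, σ₁ (u m n) = u (-m + 1 * n) n)
    (hσ₂ : ∀ m n, σ₂ (u m n) = u m (2 * m - n)) (x y : K)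
    (hu : ∀ p ∈ [((1 : ℤ), (0 : ℤ)), (0, 1), (1, 1), (1, 2)],
      x ^ p.1 * y ^ p.2 ≠ 1 ∧ φ (u p.1 p.2) = (1 - x ^ p.1 * y ^ p.2)⁻¹ ∧
      φ (u (-p.1) (-p.2)) = -(x ^ p.1 * y ^ p.2) * (1 - x ^ p.1 * y ^ p.2)⁻¹)
    (ψ₀ ψ₁ ψ₂ ψ₃ : M)
    (h₀ : s₂ ψ₀ = -ψ₀) (h₁ : s₁ ψ₀ = ψ₁) (h₂ : s₁ ψ₁ = ψ₀) (h₃ : s₂ ψ₁ = ψ₂) (h₄ : s₁ ψ₂ = ψ₃)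
    (T₁ T₂ : M → M) (hT₁ : ∀ m, T₁ m = u 1 0 • (s₁ m - m))
    (hT₂ : ∀ m, T₂ m = u 0 1 • (s₂ m - m)) :
    T₁ (T₂ (T₁ (u 0 1 • ψ₀))) =
      (u 1 0 * u 0 1 * u 1 1 * u 1 2) • (ψ₃ - ψ₂ + ψ₁ - ψ₀) := by
  simp only [List.forall_mem_cons, zpow_one, zpow_zero, mul_one, one_mul, neg_zero, zpow_ofNat,
    pow_one, pow_zero] at hu
  obtain ⟨⟨n1, e1, f1⟩, ⟨n2, e2, f2⟩, ⟨n3, e3, f3⟩, ⟨n4, e4, f4⟩, -⟩ := hu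
  have g1 := sub_ne_zero.mpr n1.symm
  have g2 := sub_ne_zero.mpr n2.symm
  have g3 := sub_ne_zero.mpr n3.symm
  have g4 := sub_ne_zero.mpr n4.symm
  simp only [hT₁, hT₂, hs₁, hs₂, map_sub, map_add, map_neg, smul_sub, smul_add, smul_neg,
    smul_smul, map_mul, hσ₁, hσ₂, h₀, h₁, h₂, h₃, h₄]
  norm_num
  match_scalars
  all_goals
    apply hφ
    simp only [map_mul, map_add, map_sub, map_neg, map_one, e1, e2, e3, e4, f1, f2, f3, f4]
    field_simp
    try ring

set_option maxHeartbeats 2000000 in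
theorem demazure_word_three_one {F K M : Type*} [CommRing F] [Field K] [AddCommGroup M]
    [Module F M] (φ : F →+* K) (hφ : Function.Injective φ) (σ₁ σ₂ : F →+* F) (s₁ s₂ : M →+ M)
    (hs₁ : ∀ f m, s₁ (f • m) = σ₁ f • s₁ m) (hs₂ : ∀ f m, s₂ (f • m) = σ₂ f • s₂ m)
    (u : ℤ → ℤ → F) (hσ₁ : ∀ m n, σ₁ (u m n) = u (-m + 3 * n) n)
    (hσ₂ : ∀ m n, σ₂ (u m n) = u m (1 * m - n)) (x y : K)
    (hu : ∀ p ∈ [((1 : ℤ), (0 : ℤ)), (0, 1), (1, 1), (2, 1), (3, 1), (3, 2)],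
      x ^ p.1 * y ^ p.2 ≠ 1 ∧ φ (u p.1 p.2) = (1 - x ^ p.1 * y ^ p.2)⁻¹ ∧
      φ (u (-p.1) (-p.2)) = -(x ^ p.1 * y ^ p.2) * (1 - x ^ p.1 * y ^ p.2)⁻¹)
    (ψ₀ ψ₁ ψ₂ ψ₃ ψ₄ ψ₅ : M)
    (h₀ : s₂ ψ₀ = -ψ₀) (h₁ : s₁ ψ₀ = ψ₁) (h₂ : s₁ ψ₁ = ψ₀) (h₃ : s₂ ψ₁ = ψ₂) (h₄ : s₂ ψ₂ = ψ₁) (h₅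
      : s₁ ψ₂ = ψ₃) (h₆ : s₁ ψ₃ = ψ₂) (h₇ : s₂ ψ₃ = ψ₄) (h₈ : s₁ ψ₄ = ψ₅)
    (T₁ T₂ : M → M) (hT₁ : ∀ m, T₁ m = u 1 0 • (s₁ m - m))
    (hT₂ : ∀ m, T₂ m = u 0 1 • (s₂ m - m)) :
    T₁ (T₂ (T₁ (T₂ (T₁ (u 0 1 • ψ₀))))) =
      (u 1 0 * u 0 1 * u 1 1 * u 2 1 * u 3 1 * u 3 2) • (ψ₅ - ψ₄ + ψ₃ - ψ₂ + ψ₁ - ψ₀) := by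
  simp only [List.forall_mem_cons, zpow_one, zpow_zero, mul_one, one_mul, neg_zero, zpow_ofNat,
    pow_one, pow_zero] at hu
  obtain ⟨⟨n1, e1, f1⟩, ⟨n2, e2, f2⟩, ⟨n3, e3, f3⟩, ⟨n4, e4, f4⟩, ⟨n5, e5, f5⟩, ⟨n6, e6, f6⟩, -⟩ :=
      hu
  have g1 := sub_ne_zero.mpr n1.symm
  have g2 := sub_ne_zero.mpr n2.symm
  have g3 := sub_ne_zero.mpr n3.symm
  have g4 := sub_ne_zero.mpr n4.symm
  have g5 := sub_ne_zero.mpr n5.symm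
  have g6 := sub_ne_zero.mpr n6.symm
  simp only [hT₁, hT₂, hs₁, hs₂, map_sub, map_add, map_neg, smul_sub, smul_add, smul_neg,
    smul_smul, map_mul, hσ₁, hσ₂, h₀, h₁, h₂, h₃, h₄, h₅, h₆, h₇, h₈]
  norm_num
  match_scalars
  all_goals
    apply hφ
    simp only [map_mul, map_add, map_sub, map_neg, map_one, e1, e2, e3, e4, e5, e6, f1, f2, f3, f4,
        f5, f6]
    field_simp
    try ring

set_option maxHeartbeats 2000000 in
theorem demazure_word_one_three {F K M : Type*} [CommRing F] [Field K] [AddCommGroup M]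
    [Module F M] (φ : F →+* K) (hφ : Function.Injective φ) (σ₁ σ₂ : F →+* F) (s₁ s₂ : M →+ M)
    (hs₁ : ∀ f m, s₁ (f • m) = σ₁ f • s₁ m) (hs₂ : ∀ f m, s₂ (f • m) = σ₂ f • s₂ m)
    (u : ℤ → ℤ → F) (hσ₁ : ∀ m n, σ₁ (u m n) = u (-m + 1 * n) n)
    (hσ₂ : ∀ m n, σ₂ (u m n) = u m (3 * m - n)) (x y : K)
    (hu : ∀ p ∈ [((1 : ℤ), (0 : ℤ)), (0, 1), (1, 1), (1, 2), (1, 3), (2, 3)],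
      x ^ p.1 * y ^ p.2 ≠ 1 ∧ φ (u p.1 p.2) = (1 - x ^ p.1 * y ^ p.2)⁻¹ ∧
      φ (u (-p.1) (-p.2)) = -(x ^ p.1 * y ^ p.2) * (1 - x ^ p.1 * y ^ p.2)⁻¹)
    (ψ₀ ψ₁ ψ₂ ψ₃ ψ₄ ψ₅ : M)
    (h₀ : s₂ ψ₀ = -ψ₀) (h₁ : s₁ ψ₀ = ψ₁) (h₂ : s₁ ψ₁ = ψ₀) (h₃ : s₂ ψ₁ = ψ₂) (h₄ : s₂ ψ₂ = ψ₁) (h₅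
      : s₁ ψ₂ = ψ₃) (h₆ : s₁ ψ₃ = ψ₂) (h₇ : s₂ ψ₃ = ψ₄) (h₈ : s₁ ψ₄ = ψ₅)
    (T₁ T₂ : M → M) (hT₁ : ∀ m, T₁ m = u 1 0 • (s₁ m - m))
    (hT₂ : ∀ m, T₂ m = u 0 1 • (s₂ m - m)) :
    T₁ (T₂ (T₁ (T₂ (T₁ (u 0 1 • ψ₀))))) =
      (u 1 0 * u 0 1 * u 1 1 * u 1 2 * u 1 3 * u 2 3) • (ψ₅ - ψ₄ + ψ₃ - ψ₂ + ψ₁ - ψ₀) := by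
  simp only [List.forall_mem_cons, zpow_one, zpow_zero, mul_one, one_mul, neg_zero, zpow_ofNat,
    pow_one, pow_zero] at hu
  obtain ⟨⟨n1, e1, f1⟩, ⟨n2, e2, f2⟩, ⟨n3, e3, f3⟩, ⟨n4, e4, f4⟩, ⟨n5, e5, f5⟩, ⟨n6, e6, f6⟩, -⟩ :=
      hu
  have g1 := sub_ne_zero.mpr n1.symm
  have g2 := sub_ne_zero.mpr n2.symm
  have g3 := sub_ne_zero.mpr n3.symm
  have g4 := sub_ne_zero.mpr n4.symm
  have g5 := sub_ne_zero.mpr n5.symm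
  have g6 := sub_ne_zero.mpr n6.symm
  simp only [hT₁, hT₂, hs₁, hs₂, map_sub, map_add, map_neg, smul_sub, smul_add, smul_neg,
    smul_smul, map_mul, hσ₁, hσ₂, h₀, h₁, h₂, h₃, h₄, h₅, h₆, h₇, h₈]
  norm_num
  match_scalars
  all_goals
    apply hφ
    simp only [map_mul, map_add, map_sub, map_neg, map_one, e1, e2, e3, e4, e5, e6, f1, f2, f3, f4,
        f5, f6]
    field_simp
    try ring

end RankTwo

/-! ### Smash product arithmetic and the localized coefficient ring -/

section SmashProduct

variable {ι X Y : Type*} [AddCommGroup X] [AddCommGroup Y] {P : RootDatum ι X Y}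

/-! The generic lemmas on signs are slow or fail to rewrite in `KDelta P`, where the subtraction
and the ring structure of the coefficients come from different instance paths. -/

theorem KDelta.eq_neg {x y : KDelta P} (h : x + y = 0) : x = -y := by
  have h1 : x = x + y + -y := by abel
  rw [h1, h]
  abel

theorem KDelta.neg_add (x : KDelta P) : -x + x = 0 := by abel

theorem KDelta.neg_mul (x y : KDelta P) : -x * y = -(x * y) :=
  KDelta.eq_neg (by rw [← add_mul, KDelta.neg_add, zero_mul])

theorem KDelta.mul_neg (x y : KDelta P) : x * -y = -(x * y) :=
  KDelta.eq_neg (by rw [← mul_add, KDelta.neg_add, mul_zero])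

theorem KDelta.neg_smul (f : RLoc P) (x : KDelta P) : -f • x = -(f • x) :=
  KDelta.eq_neg (by rw [← add_smul, neg_add_cancel, zero_smul])

theorem KDelta.smul_neg (f : RLoc P) (x : KDelta P) : f • -x = -(f • x) :=
  KDelta.eq_neg (by rw [← smul_add, KDelta.neg_add, smul_zero])

theorem KDelta.sub_mul (x y z : KDelta P) : (x - y) * z = x * z - y * z := by
  rw [sub_eq_add_neg, add_mul, KDelta.neg_mul]
  abel

theorem KDelta.mul_sub (x y z : KDelta P) : x * (y - z) = x * y - x * z := by
  rw [sub_eq_add_neg, mul_add, KDelta.mul_neg]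
  abel

theorem KDelta.sub_smul (f g : RLoc P) (x : KDelta P) : (f - g) • x = f • x - g • x := by
  rw [sub_eq_add_neg, add_smul, KDelta.neg_smul]
  abel

theorem KDelta.smul_sub (f : RLoc P) (x y : KDelta P) : f • (x - y) = f • x - f • y := by
  rw [sub_eq_add_neg, smul_add, KDelta.smul_neg]
  abel

theorem scal_mul (f : RLoc P) (x : KDelta P) : scal P f * x = f • x := by
  ext w
  exact SkewMonoidAlgebra.coeff_single_one_mul x f w

theorem grp_mul_scal (w : ExtWeyl P) (f : RLoc P) :
    grp P w * scal P f = scal P (w • f) * grp P w := by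
  change SkewMonoidAlgebra.single w 1 * SkewMonoidAlgebra.single 1 f =
    SkewMonoidAlgebra.single 1 (w • f) * SkewMonoidAlgebra.single w 1
  simp [SkewMonoidAlgebra.single_mul_single]

theorem grp_mul_smul (w : ExtWeyl P) (f : RLoc P) (x : KDelta P) :
    grp P w * (f • x) = (w • f) • (grp P w * x) := by
  rw [← scal_mul, ← scal_mul, ← mul_assoc, grp_mul_scal, mul_assoc]

/-- The image of `e^x` in the localized representation ring. -/
def expLoc (P : RootDatum ι X Y) (x : X) : RLoc P :=
  algebraMap (RT X) (RLoc P) (AddMonoidAlgebra.single x 1)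

theorem smul_algebraMap (w : ExtWeyl P) (f : RT X) :
    w • algebraMap (RT X) (RLoc P) f = algebraMap (RT X) (RLoc P) (weylRT P w.right f) :=
  IsLocalization.map_eq (delta_le P w.right) f

theorem smul_expLoc (w : ExtWeyl P) (x : X) : w • expLoc P x = expLoc P (w.right • x) := by
  rw [expLoc, smul_algebraMap, weylRT_single]
  rfl

theorem expLoc_zero : expLoc P 0 = 1 := map_one _

theorem expLoc_add (x y : X) : expLoc P (x + y) = expLoc P x * expLoc P y := by
  rw [expLoc, expLoc, expLoc, ← map_mul, AddMonoidAlgebra.single_mul_single, one_mul]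

open Classical in
/-- The inverse of `1 - e^x` in the localized representation ring, when it exists there because
`1 - e^x` is in the multiplicative set. -/
def invLoc (P : RootDatum ι X Y) (x : X) : RLoc P :=
  if h : c x ∈ Delta P then Localization.mk 1 ⟨c x, h⟩ else 0

theorem c_root_mem (P : RootDatum ι X Y) (k : ι) : c (P.root k) ∈ Delta P :=
  Submonoid.subset_closure ⟨k, rfl⟩

theorem algebraMap_c (x : X) : algebraMap (RT X) (RLoc P) (c x) = 1 - expLoc P x := by
  rw [c, map_sub, map_one]
  rfl

theorem invLoc_mul (k : ι) : invLoc P (P.root k) * (1 - expLoc P (P.root k)) = 1 := by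
  rw [invLoc, dif_pos (c_root_mem P k), ← algebraMap_c, Localization.mk_eq_mk']
  exact (IsLocalization.mk'_spec (RLoc P) 1 (⟨c (P.root k), c_root_mem P k⟩ : Delta P)).trans
    (map_one _)

theorem cInv_eq (b : P.Base) (i : AffNode b) : cInv b i = invLoc P (P.root (nodeRoot b i).1) := by
  rw [← simpleRoot_eq, invLoc, dif_pos (c_simpleRoot_mem b i), cInv]

theorem simpleT_mul (b : P.Base) (i : AffNode b) (x : KDelta P) :
    simpleT b i * x = invLoc P (P.root (nodeRoot b i).1) •
      (grp P (simpleRefl b i) * x - x) := by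
  rw [simpleT, cInv_eq, mul_assoc, scal_mul, KDelta.sub_mul, one_mul]

theorem c_ne_zero {x : X} (hx : x ≠ 0) : c x ≠ 0 := by
  rw [c, sub_ne_zero]
  intro h
  have h1 : AddMonoidAlgebra.single (0 : X) (1 : ℤ) = AddMonoidAlgebra.single x 1 := h
  exact hx ((AddMonoidAlgebra.single_left_inj one_ne_zero).mp h1).symm

variable [Module.Finite ℤ X]

/-- The group algebra of a finitely generated torsion-free abelian group over `ℤ` has no zero
divisors. Consequently `R(T)` embeds in its localization, which is again a domain. -/
theorem isDomain_RT (P : RootDatum ι X Y) : IsDomain (RT X) := by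
  have := isAddTorsionFree_of_perfectPairing P
  have : AddMonoid.FG X := AddGroup.fg_iff_addMonoid_fg.mp (Module.Finite.iff_addGroup_fg.mp ‹_›)
  have : NoZeroDivisors (RT X) := inferInstance
  exact NoZeroDivisors.to_isDomain _

theorem delta_le_nonZeroDivisors (P : RootDatum ι X Y) : Delta P ≤ nonZeroDivisors (RT X) := by
  have := isDomain_RT P
  rw [Delta, Submonoid.closure_le]
  rintro _ ⟨k, rfl⟩
  exact mem_nonZeroDivisors_of_ne_zero (c_ne_zero (P.ne_zero k))

theorem isDomain_RLoc (P : RootDatum ι X Y) : IsDomain (RLoc P) :=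
  have := isDomain_RT P
  IsLocalization.isDomain_localization (delta_le_nonZeroDivisors P)

theorem algebraMap_RLoc_injective (P : RootDatum ι X Y) :
    Function.Injective (algebraMap (RT X) (RLoc P)) :=
  IsLocalization.injective _ (delta_le_nonZeroDivisors P)

theorem expLoc_injective : Function.Injective (expLoc P) := fun x y h => by
  exact (AddMonoidAlgebra.single_left_inj one_ne_zero).mp (algebraMap_RLoc_injective P h)

end SmashProduct

/-! ### Denominators of rank two root combinations -/

section BraidRelations

variable {ι X Y : Type*} [AddCommGroup X] [AddCommGroup Y] {P : RootDatum ι X Y}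

theorem simpleRefl_right_smul (b : P.Base) (i : AffNode b) (x : X) :
    (simpleRefl b i).right • x =
      x - P.toLinearMap x (P.coroot (nodeRoot b i).1) • P.root (nodeRoot b i).1 := by
  have h := congrArg Prod.fst (linAct_affRefl (P := P) (nodeRoot b i) (x, 0))
  rw [← simpleRefl_eq] at h
  simpa [linAct_apply, affVec] using h

/-- `(1 - e^{mα + nβ})⁻¹`. -/
def pairLoc (P : RootDatum ι X Y) (k l : ι) (m n : ℤ) : RLoc P :=
  invLoc P (m • P.root k + n • P.root l)

theorem pairLoc_swap (k l : ι) (m n : ℤ) : pairLoc P k l m n = pairLoc P l k n m := by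
  rw [pairLoc, pairLoc, add_comm]

theorem c_mem_iff (w : P.weylGroup) (x : X) : c (w • x) ∈ Delta P ↔ c x ∈ Delta P := by
  have key : ∀ (w : P.weylGroup) (x : X), c x ∈ Delta P → c (w • x) ∈ Delta P := fun w x h => by
    have := delta_le P w h
    rwa [Submonoid.mem_comap, c, map_sub, map_one, weylRT_single] at this
  refine ⟨fun h => ?_, key w x⟩
  simpa using key w⁻¹ _ h

/-- Membership of `1 - e^x` in `Delta P` is invariant under `W`, so the rule also holds where
`invLoc` takes its default value `0`. This allows `pairLoc` to be used for all integers `m`, `n`. -/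
theorem smul_invLoc (w : ExtWeyl P) (x : X) : w • invLoc P x = invLoc P (w.right • x) := by
  have key : ∀ x : X, c x ∈ Delta P → invLoc P x * (1 - expLoc P x) = 1 := fun x h => by
    rw [invLoc, dif_pos h, ← algebraMap_c, Localization.mk_eq_mk']
    exact (IsLocalization.mk'_spec (RLoc P) 1 (⟨c x, h⟩ : Delta P)).trans (map_one _)
  by_cases h : c x ∈ Delta P
  · have h1 := congrArg (w • ·) (key x h)
    have h2 := key _ ((c_mem_iff w.right x).mpr h)
    simp only [smul_mul', smul_sub, smul_one, smul_expLoc] at h1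
    exact left_inv_eq_right_inv h1 ((mul_comm _ _).trans h2)
  · rw [invLoc, invLoc, dif_neg h, dif_neg (mt (c_mem_iff w.right x).mp h), smul_zero]

theorem simpleRefl_right_smul_comb (b : P.Base) (i j : AffNode b) {a : ℤ}
    (ha : P.pairing (nodeRoot b j).1 (nodeRoot b i).1 = -a) (m n : ℤ) :
    (simpleRefl b i).right • (m • P.root (nodeRoot b i).1 + n • P.root (nodeRoot b j).1) =
      (-m + a * n) • P.root (nodeRoot b i).1 + n • P.root (nodeRoot b j).1 := by
  rw [simpleRefl_right_smul]
  simp only [map_add, map_zsmul, LinearMap.add_apply, LinearMap.smul_apply,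
    P.root_coroot_eq_pairing, ha, P.pairing_same]
  module

theorem smul_pairLoc_left (b : P.Base) (i j : AffNode b) {a : ℤ}
    (ha : P.pairing (nodeRoot b j).1 (nodeRoot b i).1 = -a) (m n : ℤ) :
    simpleRefl b i • pairLoc P (nodeRoot b i).1 (nodeRoot b j).1 m n =
      pairLoc P (nodeRoot b i).1 (nodeRoot b j).1 (-m + a * n) n := by
  rw [pairLoc, smul_invLoc, simpleRefl_right_smul_comb b i j ha, pairLoc]

theorem smul_pairLoc_right (b : P.Base) (i j : AffNode b) {a : ℤ}
    (ha : P.pairing (nodeRoot b i).1 (nodeRoot b j).1 = -a) (m n : ℤ) :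
    simpleRefl b j • pairLoc P (nodeRoot b i).1 (nodeRoot b j).1 m n =
      pairLoc P (nodeRoot b i).1 (nodeRoot b j).1 m (a * m - n) := by
  rw [pairLoc_swap, smul_pairLoc_left b j i ha, pairLoc_swap, neg_add_eq_sub]

/-- `mα + nβ` is a root. -/
def IsRootComb (P : RootDatum ι X Y) (k l : ι) (m n : ℤ) : Prop :=
  m • P.root k + n • P.root l ∈ Set.range P.root

theorem isRootComb_left (k l : ι) : IsRootComb P k l 1 0 := ⟨k, by simp⟩

theorem isRootComb_right (k l : ι) : IsRootComb P k l 0 1 := ⟨l, by simp⟩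

theorem IsRootComb.reflect_left {b : P.Base} {i j : AffNode b} {a m n : ℤ}
    (h : IsRootComb P (nodeRoot b i).1 (nodeRoot b j).1 m n)
    (ha : P.pairing (nodeRoot b j).1 (nodeRoot b i).1 = -a) :
    IsRootComb P (nodeRoot b i).1 (nodeRoot b j).1 (-m + a * n) n := by
  obtain ⟨k, hk⟩ := h
  refine ⟨P.weylGroupToPerm (simpleRefl b i).right k, ?_⟩
  rw [← weylGroup_apply_root, hk, simpleRefl_right_smul_comb b i j ha]

theorem IsRootComb.swap {k l : ι} {m n : ℤ} (h : IsRootComb P k l m n) :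
    IsRootComb P l k n m := by rwa [IsRootComb, add_comm]

theorem IsRootComb.reflect_right {b : P.Base} {i j : AffNode b} {a m n : ℤ}
    (h : IsRootComb P (nodeRoot b i).1 (nodeRoot b j).1 m n)
    (ha : P.pairing (nodeRoot b i).1 (nodeRoot b j).1 = -a) :
    IsRootComb P (nodeRoot b i).1 (nodeRoot b j).1 m (a * m - n) := by
  have := (h.swap.reflect_left ha).swap
  rwa [neg_add_eq_sub] at this

theorem algebraMap_expLoc_ne_zero {K : Type*} [Field K] (φ : RLoc P →+* K) (x : X) :
    φ (expLoc P x) ≠ 0 := by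
  intro h
  have h1 : expLoc P x * expLoc P (-x) = 1 := by rw [← expLoc_add, add_neg_cancel, expLoc_zero]
  have h2 := congrArg φ h1
  rw [map_mul, h, zero_mul, map_one] at h2
  exact zero_ne_one h2

theorem map_expLoc_zsmul {K : Type*} [Field K] (φ : RLoc P →+* K) (x : X) (n : ℤ) :
    φ (expLoc P (n • x)) = φ (expLoc P x) ^ n := by
  have key : ∀ n : ℕ, φ (expLoc P (n • x)) = φ (expLoc P x) ^ n := fun n => by
    induction n with
    | zero => rw [zero_smul, expLoc_zero, map_one, pow_zero]
    | succ n ih => rw [add_smul, one_smul, expLoc_add, map_mul, ih, pow_succ]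
  obtain ⟨n, rfl | rfl⟩ := n.eq_nat_or_neg
  · rw [natCast_zsmul, key, zpow_natCast]
  · rw [neg_smul, natCast_zsmul, zpow_neg, zpow_natCast, ← key]
    refine eq_inv_of_mul_eq_one_left ?_
    rw [← map_mul, ← expLoc_add, neg_add_cancel, expLoc_zero, map_one]

variable [Module.Finite ℤ X]

/-- Roots are nonzero and `e^x` determines `x`, so the denominators do not vanish. At a negative
root, `(1 - z⁻¹)⁻¹ = -z (1 - z)⁻¹`. -/
theorem map_pairLoc {K : Type*} [Field K] (φ : RLoc P →+* K) (hφ : Function.Injective φ)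
    {k l : ι} {m n : ℤ} (h : IsRootComb P k l m n) :
    φ (expLoc P (P.root k)) ^ m * φ (expLoc P (P.root l)) ^ n ≠ 1 ∧
    φ (pairLoc P k l m n) =
      (1 - φ (expLoc P (P.root k)) ^ m * φ (expLoc P (P.root l)) ^ n)⁻¹ ∧
    φ (pairLoc P k l (-m) (-n)) =
      -(φ (expLoc P (P.root k)) ^ m * φ (expLoc P (P.root l)) ^ n) *
        (1 - φ (expLoc P (P.root k)) ^ m * φ (expLoc P (P.root l)) ^ n)⁻¹ := by
  obtain ⟨p, hp⟩ := h
  have hz : φ (expLoc P (P.root k)) ^ m * φ (expLoc P (P.root l)) ^ n =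
      φ (expLoc P (P.root p)) := by
    rw [← map_expLoc_zsmul, ← map_expLoc_zsmul, ← map_mul, ← expLoc_add, ← hp]
  have hne : φ (expLoc P (P.root p)) ≠ 1 := fun hh => by
    rw [← map_one φ, ← expLoc_zero (P := P)] at hh
    exact P.ne_zero p (expLoc_injective (hφ hh))
  have h0 := algebraMap_expLoc_ne_zero φ (P.root p)
  have h1 : (1 : K) - φ (expLoc P (P.root p)) ≠ 0 := sub_ne_zero.mpr hne.symm
  rw [hz, pairLoc, pairLoc, ← hp]
  refine ⟨hne, ?_, ?_⟩
  · have := congrArg φ (invLoc_mul (P := P) p)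
    rw [map_mul, map_sub, map_one] at this
    exact eq_inv_of_mul_eq_one_left this
  · have hneg : (-m) • P.root k + (-n) • P.root l = P.root (P.reflectionPerm p p) := by
      rw [root_reflectionPerm_self, hp]
      module
    have := congrArg φ (invLoc_mul (P := P) (P.reflectionPerm p p))
    have h2 : φ (expLoc P (-P.root p)) = (φ (expLoc P (P.root p)))⁻¹ := by
      rw [← neg_one_zsmul, map_expLoc_zsmul, zpow_neg_one]
    rw [map_mul, map_sub, map_one, root_reflectionPerm_self, h2] at this
    rw [hneg, root_reflectionPerm_self]
    rw [eq_comm] at this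
    have h3 : φ (invLoc P (-P.root p)) = (1 - (φ (expLoc P (P.root p)))⁻¹)⁻¹ :=
      eq_inv_of_mul_eq_one_left this.symm
    have h4 : 1 - (φ (expLoc P (P.root p)))⁻¹ =
        (1 - φ (expLoc P (P.root p))) * (-(φ (expLoc P (P.root p)))⁻¹) := by field_simp; ring
    rw [h3, h4, mul_inv, inv_neg, inv_inv, mul_comm]

end BraidRelations

/-! ### Braid relations for Demazure elements in rank two -/

section RankTwoBraid

/-- In this and the next three lemmas each side is expanded by a `demazure_word` lemma with the
nodes in opposite roles. The scalar factors agree by commutativity, and the two alternating sums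
over the dihedral group agree by the braid relation of `g₁` and `g₂`. -/
theorem demazure_braid_zero {F K A : Type*} [CommRing F] [Field K] [Ring A] [Module F A]
    (φ : F →+* K) (hφ : Function.Injective φ) (σ₁ σ₂ : F →+* F) (g₁ g₂ t₁ t₂ : A)
    (hs₁ : ∀ (f : F) (x : A), g₁ * (f • x) = σ₁ f • (g₁ * x))
    (hs₂ : ∀ (f : F) (x : A), g₂ * (f • x) = σ₂ f • (g₂ * x))
    (hg₁ : g₁ * g₁ = 1) (hg₂ : g₂ * g₂ = 1)
    (hg : g₁ * g₂ = g₂ * g₁)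
    (u : ℤ → ℤ → F) (hσ₁ : ∀ m n, σ₁ (u m n) = u (-m + 0 * n) n)
    (hσ₂ : ∀ m n, σ₂ (u m n) = u m (0 * m - n)) (x y : K)
    (hu : ∀ p ∈ [((1 : ℤ), (0 : ℤ)), (0, 1)],
      x ^ p.1 * y ^ p.2 ≠ 1 ∧ φ (u p.1 p.2) = (1 - x ^ p.1 * y ^ p.2)⁻¹ ∧
      φ (u (-p.1) (-p.2)) = -(x ^ p.1 * y ^ p.2) * (1 - x ^ p.1 * y ^ p.2)⁻¹)
    (ht₁ : ∀ x, t₁ * x = u 1 0 • (g₁ * x - x)) (ht₂ : ∀ x, t₂ * x = u 0 1 • (g₂ * x - x)) :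
    t₁ * t₂ = t₂ * t₁ := by
  have hu' : ∀ p ∈ [((1 : ℤ), (0 : ℤ)), (0, 1)],
      y ^ p.1 * x ^ p.2 ≠ 1 ∧ φ (u p.2 p.1) = (1 - y ^ p.1 * x ^ p.2)⁻¹ ∧
      φ (u (-p.2) (-p.1)) = -(y ^ p.1 * x ^ p.2) * (1 - y ^ p.1 * x ^ p.2)⁻¹ := by
    rintro ⟨p, q⟩ hp
    have h := hu (q, p) (by simp at hp ⊢; omega)
    rwa [mul_comm (x ^ _)] at h
  have c₁ : ∀ z : A, g₁ * (g₁ * z) = z := fun z => by rw [← mul_assoc, hg₁, one_mul]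
  have c₂ : ∀ z : A, g₂ * (g₂ * z) = z := fun z => by rw [← mul_assoc, hg₂, one_mul]
  have e₁ : t₁ = u 1 0 • (g₁ - 1) := by rw [← mul_one t₁, ht₁, mul_one]
  have e₂ : t₂ = u 0 1 • (g₂ - 1) := by rw [← mul_one t₂, ht₂, mul_one]
  have k₁ := demazure_word_zero φ hφ σ₁ σ₂ (AddMonoidHom.mulLeft g₁) (AddMonoidHom.mulLeft g₂)
    hs₁ hs₂ u hσ₁ hσ₂ x y hu
    (g₂ - 1) (g₁ * (g₂ - 1))
    (by rw [AddMonoidHom.coe_mulLeft, mul_sub, hg₂, mul_one, neg_sub]) rfl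
    (fun z => t₁ * z) (fun z => t₂ * z) ht₁ ht₂
  have k₂ := demazure_word_zero φ hφ σ₂ σ₁ (AddMonoidHom.mulLeft g₂) (AddMonoidHom.mulLeft g₁)
    hs₂ hs₁ (fun m n => u n m) (fun m n => by rw [hσ₂, neg_add_eq_sub]) (fun m n => by rw [hσ₁,
        neg_add_eq_sub]) y x hu'
    (g₁ - 1) (g₂ * (g₁ - 1))
    (by rw [AddMonoidHom.coe_mulLeft, mul_sub, hg₁, mul_one, neg_sub]) rfl
    (fun z => t₂ * z) (fun z => t₁ * z) ht₂ ht₁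
  rw [← e₂] at k₁
  rw [← e₁] at k₂
  rw [k₁, k₂]
  congr 1
  · ring
  · simp only [mul_sub, mul_one]
    rw [hg]
    abel

theorem demazure_braid_one_one {F K A : Type*} [CommRing F] [Field K] [Ring A] [Module F A]
    (φ : F →+* K) (hφ : Function.Injective φ) (σ₁ σ₂ : F →+* F) (g₁ g₂ t₁ t₂ : A)
    (hs₁ : ∀ (f : F) (x : A), g₁ * (f • x) = σ₁ f • (g₁ * x))
    (hs₂ : ∀ (f : F) (x : A), g₂ * (f • x) = σ₂ f • (g₂ * x))
    (hg₁ : g₁ * g₁ = 1) (hg₂ : g₂ * g₂ = 1)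
    (hg : g₁ * g₂ * g₁ = g₂ * g₁ * g₂)
    (u : ℤ → ℤ → F) (hσ₁ : ∀ m n, σ₁ (u m n) = u (-m + 1 * n) n)
    (hσ₂ : ∀ m n, σ₂ (u m n) = u m (1 * m - n)) (x y : K)
    (hu : ∀ p ∈ [((1 : ℤ), (0 : ℤ)), (0, 1), (1, 1)],
      x ^ p.1 * y ^ p.2 ≠ 1 ∧ φ (u p.1 p.2) = (1 - x ^ p.1 * y ^ p.2)⁻¹ ∧
      φ (u (-p.1) (-p.2)) = -(x ^ p.1 * y ^ p.2) * (1 - x ^ p.1 * y ^ p.2)⁻¹)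
    (ht₁ : ∀ x, t₁ * x = u 1 0 • (g₁ * x - x)) (ht₂ : ∀ x, t₂ * x = u 0 1 • (g₂ * x - x)) :
    t₁ * t₂ * t₁ = t₂ * t₁ * t₂ := by
  have hu' : ∀ p ∈ [((1 : ℤ), (0 : ℤ)), (0, 1), (1, 1)],
      y ^ p.1 * x ^ p.2 ≠ 1 ∧ φ (u p.2 p.1) = (1 - y ^ p.1 * x ^ p.2)⁻¹ ∧
      φ (u (-p.2) (-p.1)) = -(y ^ p.1 * x ^ p.2) * (1 - y ^ p.1 * x ^ p.2)⁻¹ := by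
    rintro ⟨p, q⟩ hp
    have h := hu (q, p) (by simp at hp ⊢; omega)
    rwa [mul_comm (x ^ _)] at h
  have c₁ : ∀ z : A, g₁ * (g₁ * z) = z := fun z => by rw [← mul_assoc, hg₁, one_mul]
  have c₂ : ∀ z : A, g₂ * (g₂ * z) = z := fun z => by rw [← mul_assoc, hg₂, one_mul]
  have e₁ : t₁ = u 1 0 • (g₁ - 1) := by rw [← mul_one t₁, ht₁, mul_one]
  have e₂ : t₂ = u 0 1 • (g₂ - 1) := by rw [← mul_one t₂, ht₂, mul_one]
  have k₁ := demazure_word_one_one φ hφ σ₁ σ₂ (AddMonoidHom.mulLeft g₁) (AddMonoidHom.mulLeft g₂)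
    hs₁ hs₂ u hσ₁ hσ₂ x y hu
    (g₂ - 1) (g₁ * (g₂ - 1)) (g₂ * (g₁ * (g₂ - 1)))
    (by rw [AddMonoidHom.coe_mulLeft, mul_sub, hg₂, mul_one, neg_sub]) rfl rfl
    (fun z => t₁ * z) (fun z => t₂ * z) ht₁ ht₂
  have k₂ := demazure_word_one_one φ hφ σ₂ σ₁ (AddMonoidHom.mulLeft g₂) (AddMonoidHom.mulLeft g₁)
    hs₂ hs₁ (fun m n => u n m) (fun m n => by rw [hσ₂, neg_add_eq_sub]) (fun m n => by rw [hσ₁,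
        neg_add_eq_sub]) y x hu'
    (g₁ - 1) (g₂ * (g₁ - 1)) (g₁ * (g₂ * (g₁ - 1)))
    (by rw [AddMonoidHom.coe_mulLeft, mul_sub, hg₁, mul_one, neg_sub]) rfl rfl
    (fun z => t₂ * z) (fun z => t₁ * z) ht₂ ht₁
  rw [← e₂] at k₁
  rw [← e₁] at k₂
  simp only [mul_assoc] at k₁ k₂ hg ⊢
  rw [k₁, k₂]
  congr 1
  · ring
  · simp only [mul_sub, mul_one]
    rw [hg]
    abel

theorem demazure_braid_two_one {F K A : Type*} [CommRing F] [Field K] [Ring A] [Module F A]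
    (φ : F →+* K) (hφ : Function.Injective φ) (σ₁ σ₂ : F →+* F) (g₁ g₂ t₁ t₂ : A)
    (hs₁ : ∀ (f : F) (x : A), g₁ * (f • x) = σ₁ f • (g₁ * x))
    (hs₂ : ∀ (f : F) (x : A), g₂ * (f • x) = σ₂ f • (g₂ * x))
    (hg₁ : g₁ * g₁ = 1) (hg₂ : g₂ * g₂ = 1)
    (hg : g₁ * g₂ * g₁ * g₂ = g₂ * g₁ * g₂ * g₁)
    (u : ℤ → ℤ → F) (hσ₁ : ∀ m n, σ₁ (u m n) = u (-m + 2 * n) n)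
    (hσ₂ : ∀ m n, σ₂ (u m n) = u m (1 * m - n)) (x y : K)
    (hu : ∀ p ∈ [((1 : ℤ), (0 : ℤ)), (0, 1), (1, 1), (2, 1)],
      x ^ p.1 * y ^ p.2 ≠ 1 ∧ φ (u p.1 p.2) = (1 - x ^ p.1 * y ^ p.2)⁻¹ ∧
      φ (u (-p.1) (-p.2)) = -(x ^ p.1 * y ^ p.2) * (1 - x ^ p.1 * y ^ p.2)⁻¹)
    (ht₁ : ∀ x, t₁ * x = u 1 0 • (g₁ * x - x)) (ht₂ : ∀ x, t₂ * x = u 0 1 • (g₂ * x - x)) :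
    t₁ * t₂ * t₁ * t₂ = t₂ * t₁ * t₂ * t₁ := by
  have hu' : ∀ p ∈ [((1 : ℤ), (0 : ℤ)), (0, 1), (1, 1), (1, 2)],
      y ^ p.1 * x ^ p.2 ≠ 1 ∧ φ (u p.2 p.1) = (1 - y ^ p.1 * x ^ p.2)⁻¹ ∧
      φ (u (-p.2) (-p.1)) = -(y ^ p.1 * x ^ p.2) * (1 - y ^ p.1 * x ^ p.2)⁻¹ := by
    rintro ⟨p, q⟩ hp
    have h := hu (q, p) (by simp at hp ⊢; omega)
    rwa [mul_comm (x ^ _)] at h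
  have c₁ : ∀ z : A, g₁ * (g₁ * z) = z := fun z => by rw [← mul_assoc, hg₁, one_mul]
  have c₂ : ∀ z : A, g₂ * (g₂ * z) = z := fun z => by rw [← mul_assoc, hg₂, one_mul]
  have e₁ : t₁ = u 1 0 • (g₁ - 1) := by rw [← mul_one t₁, ht₁, mul_one]
  have e₂ : t₂ = u 0 1 • (g₂ - 1) := by rw [← mul_one t₂, ht₂, mul_one]
  have k₁ := demazure_word_two_one φ hφ σ₁ σ₂ (AddMonoidHom.mulLeft g₁) (AddMonoidHom.mulLeft g₂)
    hs₁ hs₂ u hσ₁ hσ₂ x y hu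
    (g₂ - 1) (g₁ * (g₂ - 1)) (g₂ * (g₁ * (g₂ - 1))) (g₁ * (g₂ * (g₁ * (g₂ - 1))))
    (by rw [AddMonoidHom.coe_mulLeft, mul_sub, hg₂, mul_one, neg_sub]) rfl (c₁ _) rfl rfl
    (fun z => t₁ * z) (fun z => t₂ * z) ht₁ ht₂
  have k₂ := demazure_word_one_two φ hφ σ₂ σ₁ (AddMonoidHom.mulLeft g₂) (AddMonoidHom.mulLeft g₁)
    hs₂ hs₁ (fun m n => u n m) (fun m n => by rw [hσ₂, neg_add_eq_sub]) (fun m n => by rw [hσ₁,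
        neg_add_eq_sub]) y x hu'
    (g₁ - 1) (g₂ * (g₁ - 1)) (g₁ * (g₂ * (g₁ - 1))) (g₂ * (g₁ * (g₂ * (g₁ - 1))))
    (by rw [AddMonoidHom.coe_mulLeft, mul_sub, hg₁, mul_one, neg_sub]) rfl (c₂ _) rfl rfl
    (fun z => t₂ * z) (fun z => t₁ * z) ht₂ ht₁
  rw [← e₂] at k₁
  rw [← e₁] at k₂
  simp only [mul_assoc] at k₁ k₂ hg ⊢
  rw [k₁, k₂]
  congr 1
  · ring
  · simp only [mul_sub, mul_one]
    rw [hg]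
    abel

theorem demazure_braid_three_one {F K A : Type*} [CommRing F] [Field K] [Ring A] [Module F A]
    (φ : F →+* K) (hφ : Function.Injective φ) (σ₁ σ₂ : F →+* F) (g₁ g₂ t₁ t₂ : A)
    (hs₁ : ∀ (f : F) (x : A), g₁ * (f • x) = σ₁ f • (g₁ * x))
    (hs₂ : ∀ (f : F) (x : A), g₂ * (f • x) = σ₂ f • (g₂ * x))
    (hg₁ : g₁ * g₁ = 1) (hg₂ : g₂ * g₂ = 1)
    (hg : g₁ * g₂ * g₁ * g₂ * g₁ * g₂ = g₂ * g₁ * g₂ * g₁ * g₂ * g₁)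
    (u : ℤ → ℤ → F) (hσ₁ : ∀ m n, σ₁ (u m n) = u (-m + 3 * n) n)
    (hσ₂ : ∀ m n, σ₂ (u m n) = u m (1 * m - n)) (x y : K)
    (hu : ∀ p ∈ [((1 : ℤ), (0 : ℤ)), (0, 1), (1, 1), (2, 1), (3, 1), (3, 2)],
      x ^ p.1 * y ^ p.2 ≠ 1 ∧ φ (u p.1 p.2) = (1 - x ^ p.1 * y ^ p.2)⁻¹ ∧
      φ (u (-p.1) (-p.2)) = -(x ^ p.1 * y ^ p.2) * (1 - x ^ p.1 * y ^ p.2)⁻¹)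
    (ht₁ : ∀ x, t₁ * x = u 1 0 • (g₁ * x - x)) (ht₂ : ∀ x, t₂ * x = u 0 1 • (g₂ * x - x)) :
    t₁ * t₂ * t₁ * t₂ * t₁ * t₂ = t₂ * t₁ * t₂ * t₁ * t₂ * t₁ := by
  have hu' : ∀ p ∈ [((1 : ℤ), (0 : ℤ)), (0, 1), (1, 1), (1, 2), (1, 3), (2, 3)],
      y ^ p.1 * x ^ p.2 ≠ 1 ∧ φ (u p.2 p.1) = (1 - y ^ p.1 * x ^ p.2)⁻¹ ∧
      φ (u (-p.2) (-p.1)) = -(y ^ p.1 * x ^ p.2) * (1 - y ^ p.1 * x ^ p.2)⁻¹ := by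
    rintro ⟨p, q⟩ hp
    have h := hu (q, p) (by simp at hp ⊢; omega)
    rwa [mul_comm (x ^ _)] at h
  have c₁ : ∀ z : A, g₁ * (g₁ * z) = z := fun z => by rw [← mul_assoc, hg₁, one_mul]
  have c₂ : ∀ z : A, g₂ * (g₂ * z) = z := fun z => by rw [← mul_assoc, hg₂, one_mul]
  have e₁ : t₁ = u 1 0 • (g₁ - 1) := by rw [← mul_one t₁, ht₁, mul_one]
  have e₂ : t₂ = u 0 1 • (g₂ - 1) := by rw [← mul_one t₂, ht₂, mul_one]
  have k₁ := demazure_word_three_one φ hφ σ₁ σ₂ (AddMonoidHom.mulLeft g₁) (AddMonoidHom.mulLeft g₂)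
    hs₁ hs₂ u hσ₁ hσ₂ x y hu
    (g₂ - 1) (g₁ * (g₂ - 1)) (g₂ * (g₁ * (g₂ - 1))) (g₁ * (g₂ * (g₁ * (g₂ - 1)))) (g₂ * (g₁ * (g₂ *
      (g₁ * (g₂ - 1))))) (g₁ * (g₂ * (g₁ * (g₂ * (g₁ * (g₂ - 1))))))
    (by rw [AddMonoidHom.coe_mulLeft, mul_sub, hg₂, mul_one, neg_sub]) rfl (c₁ _) rfl (c₂ _) rfl
      (c₁ _) rfl rfl
    (fun z => t₁ * z) (fun z => t₂ * z) ht₁ ht₂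
  have k₂ := demazure_word_one_three φ hφ σ₂ σ₁ (AddMonoidHom.mulLeft g₂) (AddMonoidHom.mulLeft g₁)
    hs₂ hs₁ (fun m n => u n m) (fun m n => by rw [hσ₂, neg_add_eq_sub]) (fun m n => by rw [hσ₁,
        neg_add_eq_sub]) y x hu'
    (g₁ - 1) (g₂ * (g₁ - 1)) (g₁ * (g₂ * (g₁ - 1))) (g₂ * (g₁ * (g₂ * (g₁ - 1)))) (g₁ * (g₂ * (g₁ *
      (g₂ * (g₁ - 1))))) (g₂ * (g₁ * (g₂ * (g₁ * (g₂ * (g₁ - 1))))))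
    (by rw [AddMonoidHom.coe_mulLeft, mul_sub, hg₁, mul_one, neg_sub]) rfl (c₂ _) rfl (c₁ _) rfl
      (c₂ _) rfl rfl
    (fun z => t₂ * z) (fun z => t₁ * z) ht₂ ht₁
  rw [← e₂] at k₁
  rw [← e₁] at k₂
  simp only [mul_assoc] at k₁ k₂ hg ⊢
  rw [k₁, k₂]
  congr 1
  · ring
  · simp only [mul_sub, mul_one]
    rw [hg]
    abel

end RankTwoBraid

/-! ### Braid relations for linear reflections -/

section ReflectionBraids

variable {M : Type*} [AddCommGroup M] (r₁ r₂ : M →+ M) (f g : M →+ ℤ) (x y : M)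

theorem reflection_braid_zero (h₁ : ∀ v, r₁ v = v - f v • x) (h₂ : ∀ v, r₂ v = v - g v • y)
    (hfy : f y = -0) (hgx : g x = -0) (v : M) :
    r₁ (r₂ v) = r₂ (r₁ v) := by
  simp only [h₁, h₂, map_sub, map_zsmul, hfy, hgx, smul_eq_mul]
  module

theorem reflection_braid_one_one (h₁ : ∀ v, r₁ v = v - f v • x) (h₂ : ∀ v, r₂ v = v - g v • y)
    (hfx : f x = 2) (hgy : g y = 2) (hfy : f y = -1) (hgx : g x = -1) (v : M) :
    r₁ (r₂ (r₁ v)) = r₂ (r₁ (r₂ v)) := by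
  simp only [h₁, h₂, map_sub, map_zsmul, hfx, hgy, hfy, hgx, smul_eq_mul]
  module

theorem reflection_braid_two_one (h₁ : ∀ v, r₁ v = v - f v • x) (h₂ : ∀ v, r₂ v = v - g v • y)
    (hfx : f x = 2) (hgy : g y = 2) (hfy : f y = -2) (hgx : g x = -1) (v : M) :
    r₁ (r₂ (r₁ (r₂ v))) = r₂ (r₁ (r₂ (r₁ v))) := by
  simp only [h₁, h₂, map_sub, map_zsmul, hfx, hgy, hfy, hgx, smul_eq_mul]
  module

theorem reflection_braid_three_one (h₁ : ∀ v, r₁ v = v - f v • x)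
    (h₂ : ∀ v, r₂ v = v - g v • y)
    (hfx : f x = 2) (hgy : g y = 2) (hfy : f y = -3) (hgx : g x = -1) (v : M) :
    r₁ (r₂ (r₁ (r₂ (r₁ (r₂ v))))) = r₂ (r₁ (r₂ (r₁ (r₂ (r₁ v))))) := by
  simp only [h₁, h₂, map_sub, map_zsmul, hfx, hgy, hfy, hgx, smul_eq_mul]
  module

end ReflectionBraids

/-! ### Elements with two descents -/

section Descents

variable {ι X Y : Type*} [AddCommGroup X] [AddCommGroup Y] {P : RootDatum ι X Y} [Finite ι]
  [P.IsReduced]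

theorem pairing_nonpos_symm (P : RootDatum ι X Y) [P.IsReduced] {i j : ι}
    (h : P.pairing i j ≤ 0) : P.pairing j i ≤ 0 := by
  have h1 := pairing_mem_set P i j
  simp only [Set.mem_insert_iff, Set.mem_singleton_iff, Prod.mk.injEq] at h1
  omega

theorem IsHighest.pairing_nonpos {b : P.Base} {j k : ι} (hj : IsHighest b j)
    (hk : IsHighest b k) (hjk : j ≠ k) : P.pairing j k ≤ 0 := by
  by_contra! h
  have h1 := P.root_sub_root_mem_of_pairingIn_pos (i := j) (j := k)
    (by rwa [pairingIn_int]) hjk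
  obtain ⟨m, hm⟩ := h1
  by_cases hpos : b.IsPos m
  · exact hk.not_add_pos (m := j) hpos (by rw [hm]; abel)
  · rw [← isPos_reflectionPerm_self] at hpos
    exact hj.not_add_pos (m := k) hpos (by rw [root_reflectionPerm_self, hm]; abel)

/-- Ordinary nodes pair nonpositively by the base axioms, an ordinary node pairs nonpositively with
`-θ` because `θ` is dominant, and two distinct highest roots cannot pair positively since their
difference would be a root. -/
theorem pairing_nodeRoot_nonpos (b : P.Base) {i j : AffNode b} (hij : i ≠ j) :
    P.pairing (nodeRoot b i).1 (nodeRoot b j).1 ≤ 0 := by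
  have key : ∀ (i : b.support) (j : {j : ι // IsHighest b j}),
      P.pairing (nodeRoot b (Sum.inl i)).1 (nodeRoot b (Sum.inr j)).1 ≤ 0 := fun i j => by
    have h := j.2.pairing_nonneg (isPos_of_mem_closure b (i := i.1)
      (AddSubmonoid.subset_closure ⟨i, i.2, rfl⟩))
    simpa [nodeRoot] using h
  rcases i with i | i <;> rcases j with j | j
  · rw [← pairingIn_int]
    exact b.pairingIn_le_zero_of_ne (fun h => hij (by rw [Subtype.ext h])) i.2 j.2
  · exact key i j
  · exact pairing_nonpos_symm P (key j i)
  · have h := i.2.pairing_nonpos j.2 fun h => hij (by rw [Subtype.ext h])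
    simpa [nodeRoot] using h

theorem neg_affVec_mem_affCone {b : P.Base} {p : ι × ℤ} (h : ¬ AffPos b p) :
    -affVec P p ∈ affCone b := by
  rw [← affVec_affNeg, ← affPos_iff_mem_affCone, affPos_affNeg]
  exact h

theorem not_affPos_of_neg_mem {b : P.Base} {p : ι × ℤ} (h : -affVec P p ∈ affCone b) :
    ¬ AffPos b p := by
  rwa [← affPos_affNeg, affPos_iff_mem_affCone, affVec_affNeg]

theorem nonneg_of_mem_affCone {b : P.Base} {n : ℤ} {x : X} (h : (x, n) ∈ affCone b) : 0 ≤ n := by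
  have key : ∀ v ∈ affCone b, 0 ≤ v.2 := fun v hv => by
    induction hv using AddSubmonoid.closure_induction with
    | mem v hv =>
      obtain ⟨i, rfl⟩ := hv
      rcases i with i | i <;> simp [affVec, nodeRoot]
    | zero => exact le_rfl
    | add v w _ _ hv hw => exact add_nonneg hv hw
  exact key _ h

/-- This excludes the infinite dihedral case. If the finite parts were opposite, the two simple
affine roots would add up to a multiple of `δ`, which every `w` fixes. Two descents force this
multiple to be nonpositive, so both nodes are ordinary, and then two positive finite roots would be
opposite. -/
theorem root_ne_neg_of_descents {b : P.Base} {i j : AffNode b} {w : ExtWeyl P}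
    (hi : ¬ AffPos b (affAct w (nodeRoot b i))) (hj : ¬ AffPos b (affAct w (nodeRoot b j))) :
    P.root (nodeRoot b i).1 ≠ -P.root (nodeRoot b j).1 := by
  intro h
  have h1 := (affCone b).add_mem (neg_affVec_mem_affCone hi) (neg_affVec_mem_affCone hj)
  rw [affVec_affAct, affVec_affAct, ← neg_add, ← map_add] at h1
  have h2 : affVec P (nodeRoot b i) + affVec P (nodeRoot b j) =
      (0, (nodeRoot b i).2 + (nodeRoot b j).2) := by
    simp [affVec, h]
  rw [h2, linAct_apply] at h1
  have h3 := nonneg_of_mem_affCone (x := _) (n := _) h1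
  simp only [smul_zero, map_zero, LinearMap.zero_apply, sub_zero] at h3
  have h4 : (nodeRoot b i).2 + (nodeRoot b j).2 ≤ 0 := by
    have : 0 ≤ -((nodeRoot b i).2 + (nodeRoot b j).2) := by simpa using h3
    omega
  rcases i with i | i <;> rcases j with j | j <;> simp only [nodeRoot] at h4 h <;> try omega
  have hi' : b.IsPos i := isPos_of_mem_closure b (AddSubmonoid.subset_closure ⟨i, i.2, rfl⟩)
  have hj' : b.IsPos j := isPos_of_mem_closure b (AddSubmonoid.subset_closure ⟨j, j.2, rfl⟩)
  rw [← root_reflectionPerm_self] at h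
  rw [P.root.injective h, isPos_reflectionPerm_self] at hi'
  exact hi' hj'

/-- The action of two simple reflections on the coordinates `(m, n)` of `mα + nβ`. -/
def reflPair (a a' : ℤ) : Bool → ℤ × ℤ → ℤ × ℤ
  | true, p => (-p.1 + a * p.2, p.2)
  | false, p => (p.1, a' * p.1 - p.2)

/-- A word, read from right to left, in two simple reflections is a chain of descents starting at
any element with both descents. -/
def IsDescentChain (a a' : ℤ) : List Bool → Prop
  | [] => True
  | x :: l =>
    IsDescentChain a a' l ∧
      0 ≤ (l.foldl (fun p y => reflPair a a' y p) (bif x then (1, 0) else (0, 1))).1 ∧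
      0 ≤ (l.foldl (fun p y => reflPair a a' y p) (bif x then (1, 0) else (0, 1))).2

/-- The product of `w` with a word read from right to left. -/
def wordMul (b : P.Base) (i j : AffNode b) (w : ExtWeyl P) : List Bool → ExtWeyl P
  | [] => w
  | x :: l => wordMul b i j w l * simpleRefl b (bif x then i else j)

variable {b : P.Base} {i j : AffNode b} {a a' : ℤ}

theorem wordMul_mul (w : ExtWeyl P) (l : List Bool) :
    wordMul b i j w l * ((l.map fun x => bif x then i else j).map (simpleRefl b)).prod = w := by
  induction l with
  | nil => simp [wordMul]
  | cons x l ih =>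
    rw [wordMul, List.map_cons, List.map_cons, List.prod_cons, mul_assoc, ← mul_assoc (simpleRefl b
        _),
      simpleRefl_mul_self, one_mul, ih]

theorem linAct_simpleRefl_comb
    (ha : P.pairing (nodeRoot b j).1 (nodeRoot b i).1 = -a)
    (ha' : P.pairing (nodeRoot b i).1 (nodeRoot b j).1 = -a') (y : Bool) (p : ℤ × ℤ) :
    linAct (simpleRefl b (bif y then i else j))
        (p.1 • affVec P (nodeRoot b i) + p.2 • affVec P (nodeRoot b j)) =
      (reflPair a a' y p).1 • affVec P (nodeRoot b i) +
        (reflPair a a' y p).2 • affVec P (nodeRoot b j) := by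
  cases y <;>
  · simp only [cond_true, cond_false, simpleRefl_eq, linAct_affRefl, reflPair, affVec,
      map_add, map_zsmul, P.root_coroot_eq_pairing, ha, ha', P.pairing_same]
    module

theorem linAct_wordMul (ha : P.pairing (nodeRoot b j).1 (nodeRoot b i).1 = -a)
    (ha' : P.pairing (nodeRoot b i).1 (nodeRoot b j).1 = -a') (w : ExtWeyl P) (l : List Bool)
    (p : ℤ × ℤ) :
    linAct (wordMul b i j w l)
        (p.1 • affVec P (nodeRoot b i) + p.2 • affVec P (nodeRoot b j)) =
      linAct w ((l.foldl (fun p y => reflPair a a' y p) p).1 • affVec P (nodeRoot b i) +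
        (l.foldl (fun p y => reflPair a a' y p) p).2 • affVec P (nodeRoot b j)) := by
  induction l generalizing p with
  | nil => rfl
  | cons y l ih => rw [wordMul, linAct_mul, linAct_simpleRefl_comb ha ha', ih, List.foldl_cons]

/-- Each letter strips a descent: transporting its simple root back through the previous letters
gives a combination `mα_i + nα_j` with `m, n ≥ 0`, and `w` sends both `α_i` and `α_j` to negative
roots. -/
theorem len_wordMul (ha : P.pairing (nodeRoot b j).1 (nodeRoot b i).1 = -a)
    (ha' : P.pairing (nodeRoot b i).1 (nodeRoot b j).1 = -a') {w : ExtWeyl P}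
    (hi : ¬ AffPos b (affAct w (nodeRoot b i))) (hj : ¬ AffPos b (affAct w (nodeRoot b j)))
    (l : List Bool) (hl : IsDescentChain a a' l) :
    len b (wordMul b i j w l) + l.length = len b w := by
  induction l with
  | nil => rfl
  | cons x l ih =>
    obtain ⟨h1, h2, h3⟩ := hl
    rw [← ih h1, wordMul, List.length_cons, add_comm l.length, ← add_assoc]
    congr 1
    refine len_mul_simpleRefl_of_neg b (not_affPos_of_neg_mem ?_)
    have h4 : affVec P (nodeRoot b (bif x then i else j)) =
        (bif x then ((1 : ℤ), (0 : ℤ)) else (0, 1)).1 • affVec P (nodeRoot b i) +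
        (bif x then ((1 : ℤ), (0 : ℤ)) else (0, 1)).2 • affVec P (nodeRoot b j) := by
      cases x <;> simp
    rw [affVec_affAct, h4, linAct_wordMul ha ha', map_add, map_zsmul, map_zsmul, neg_add,
      ← zsmul_neg, ← zsmul_neg, ← affVec_affAct, ← affVec_affAct]
    generalize l.foldl _ _ = p at h2 h3
    obtain ⟨m, n⟩ := p
    lift m to ℕ using h2
    lift n to ℕ using h3
    simp only [natCast_zsmul]
    exact add_mem ((affCone b).nsmul_mem (neg_affVec_mem_affCone hi) m)
      ((affCone b).nsmul_mem (neg_affVec_mem_affCone hj) n)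

end Descents

/-! ### Braid relations of the affine Demazure elements -/

section Braid

variable {ι X Y : Type*} [AddCommGroup X] [AddCommGroup Y] {P : RootDatum ι X Y} [Finite ι]
  [P.IsReduced] {b : P.Base} {i j : AffNode b} {a a' : ℤ}

/-- The braid relations of a family `t`, used at an element with the descents `i` and `j`. -/
def HasBraid (b : P.Base) (i j : AffNode b) (w : ExtWeyl P) : Prop :=
  ∃ (v : ExtWeyl P) (l l' : List (AffNode b)),
    w = v * ((l ++ [i]).map (simpleRefl b)).prod ∧
    w = v * ((l' ++ [j]).map (simpleRefl b)).prod ∧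
    len b v + l.length + 1 = len b w ∧ len b v + l'.length + 1 = len b w ∧
    ((l ++ [i]).map (simpleT b)).prod = ((l' ++ [j]).map (simpleT b)).prod

theorem HasBraid.symm {w : ExtWeyl P} (h : HasBraid b i j w) : HasBraid b j i w := by
  obtain ⟨v, l, l', h1, h2, h3, h4, h5⟩ := h
  exact ⟨v, l', l, h2, h1, h4, h3, h5.symm⟩

theorem hasBraid_of_words (ha : P.pairing (nodeRoot b j).1 (nodeRoot b i).1 = -a)
    (ha' : P.pairing (nodeRoot b i).1 (nodeRoot b j).1 = -a') {w : ExtWeyl P}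
    (hi : ¬ AffPos b (affAct w (nodeRoot b i))) (hj : ¬ AffPos b (affAct w (nodeRoot b j)))
    (l l' : List Bool) (hl : IsDescentChain a a' (l ++ [true]))
    (hl' : IsDescentChain a a' (l' ++ [false]))
    (hg : (((l ++ [true]).map fun x => bif x then i else j).map (simpleRefl b)).prod =
      (((l' ++ [false]).map fun x => bif x then i else j).map (simpleRefl b)).prod)
    (hT : (((l ++ [true]).map fun x => bif x then i else j).map (simpleT b)).prod =
      (((l' ++ [false]).map fun x => bif x then i else j).map (simpleT b)).prod) :
    HasBraid b i j w := by
  have h1 := wordMul_mul (b := b) (i := i) (j := j) w (l ++ [true])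
  have h2 := wordMul_mul (b := b) (i := i) (j := j) w (l' ++ [false])
  have h3 : wordMul b i j w (l ++ [true]) = wordMul b i j w (l' ++ [false]) := by
    rw [← h2, hg] at h1
    rw [h2] at h1
    exact mul_right_cancel (h1.trans h2.symm)
  refine ⟨wordMul b i j w (l ++ [true]), l.map fun x => bif x then i else j,
    l'.map fun x => bif x then i else j, ?_, ?_, ?_, ?_, ?_⟩
  · simpa using h1.symm
  · rw [h3]
    simpa using h2.symm
  · simpa [add_assoc] using len_wordMul ha ha' hi hj _ hl
  · rw [h3]
    simpa [add_assoc] using len_wordMul ha ha' hi hj _ hl'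
  · simpa using hT

theorem grp_simpleRefl_mul_self (b : P.Base) (i : AffNode b) :
    grp P (simpleRefl b i) * grp P (simpleRefl b i) = 1 := by
  rw [← map_mul, simpleRefl_mul_self, map_one]

/-- The pairing of `X × ℤ` with a coroot. -/
def corootHom (P : RootDatum ι X Y) (k : ι) : X × ℤ →+ ℤ :=
  (P.toLinearMap.flip (P.coroot k)).toAddMonoidHom.comp (AddMonoidHom.fst X ℤ)

theorem linAct_simpleRefl (b : P.Base) (i : AffNode b) (v : X × ℤ) :
    linAct (simpleRefl b i) v =
      v - corootHom P (nodeRoot b i).1 v • affVec P (nodeRoot b i) := by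
  rw [simpleRefl_eq, linAct_affRefl]
  rfl

theorem corootHom_affVec (k : ι) (p : ι × ℤ) : corootHom P k (affVec P p) = P.pairing p.1 k :=
  P.root_coroot_eq_pairing p.1 k

theorem corootHom_affVec_self (p : ι × ℤ) : corootHom P p.1 (affVec P p) = 2 := by
  rw [corootHom_affVec, P.pairing_same]

theorem pairLoc_one_zero (k l : ι) : pairLoc P k l 1 0 = invLoc P (P.root k) := by
  rw [pairLoc, one_smul, zero_smul, add_zero]

theorem pairLoc_zero_one (k l : ι) : pairLoc P k l 0 1 = invLoc P (P.root l) := by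
  rw [pairLoc, one_smul, zero_smul, zero_add]

variable [Module.Finite ℤ X]

theorem hasBraid_zero (ha : P.pairing (nodeRoot b j).1 (nodeRoot b i).1 = -0)
    (ha' : P.pairing (nodeRoot b i).1 (nodeRoot b j).1 = -0) {w : ExtWeyl P}
    (hi : ¬ AffPos b (affAct w (nodeRoot b i))) (hj : ¬ AffPos b (affAct w (nodeRoot b j))) :
    HasBraid b i j w := by
  have := isDomain_RLoc P
  have hg : simpleRefl b i * simpleRefl b j =
      simpleRefl b j * simpleRefl b i := by
    refine linAct_injective fun v => ?_
    simp only [linAct_mul]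
    exact reflection_braid_zero (linAct (simpleRefl b i)) (linAct (simpleRefl b j))
      (corootHom P (nodeRoot b i).1) (corootHom P (nodeRoot b j).1)
      (affVec P (nodeRoot b i)) (affVec P (nodeRoot b j)) (linAct_simpleRefl b i)
      (linAct_simpleRefl b j) ((corootHom_affVec _ _).trans ha)
      ((corootHom_affVec _ _).trans ha') v
  have hg' := congrArg (grp P) hg
  simp only [map_mul] at hg'
  have hT := demazure_braid_zero (algebraMap (RLoc P) (FractionRing (RLoc P)))
    (IsFractionRing.injective _ _)
    (MulSemiringAction.toRingHom (ExtWeyl P) (RLoc P) (simpleRefl b i))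
    (MulSemiringAction.toRingHom (ExtWeyl P) (RLoc P) (simpleRefl b j))
    (grp P (simpleRefl b i)) (grp P (simpleRefl b j)) (simpleT b i) (simpleT b j)
    (grp_mul_smul _) (grp_mul_smul _) (grp_simpleRefl_mul_self b i)
    (grp_simpleRefl_mul_self b j) hg' (pairLoc P (nodeRoot b i).1 (nodeRoot b j).1)
    (smul_pairLoc_left b i j ha) (smul_pairLoc_right b i j ha') _ _
    (by
      simp only [List.forall_mem_cons]
      exact ⟨map_pairLoc _ (IsFractionRing.injective _ _) (isRootComb_left _ _), map_pairLoc _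
          (IsFractionRing.injective _ _) (isRootComb_right _ _), by simp⟩)
    (fun z => by rw [simpleT_mul, pairLoc_one_zero]) (fun z => by rw [simpleT_mul,
      pairLoc_zero_one])
  exact hasBraid_of_words ha ha' hi hj [false] [true]
    (by simp [IsDescentChain, reflPair]) (by simp [IsDescentChain, reflPair])
    (by simpa [mul_assoc] using hg.symm) (by simpa [mul_assoc] using hT.symm)

theorem hasBraid_one_one (ha : P.pairing (nodeRoot b j).1 (nodeRoot b i).1 = -1)
    (ha' : P.pairing (nodeRoot b i).1 (nodeRoot b j).1 = -1) {w : ExtWeyl P}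
    (hi : ¬ AffPos b (affAct w (nodeRoot b i))) (hj : ¬ AffPos b (affAct w (nodeRoot b j))) :
    HasBraid b i j w := by
  have := isDomain_RLoc P
  have hg : simpleRefl b i * simpleRefl b j * simpleRefl b i =
      simpleRefl b j * simpleRefl b i * simpleRefl b j := by
    refine linAct_injective fun v => ?_
    simp only [linAct_mul]
    exact reflection_braid_one_one (linAct (simpleRefl b i)) (linAct (simpleRefl b j))
      (corootHom P (nodeRoot b i).1) (corootHom P (nodeRoot b j).1)
      (affVec P (nodeRoot b i)) (affVec P (nodeRoot b j)) (linAct_simpleRefl b i)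
      (linAct_simpleRefl b j) (corootHom_affVec_self _) (corootHom_affVec_self _)
        ((corootHom_affVec _ _).trans ha)
      ((corootHom_affVec _ _).trans ha') v
  have hg' := congrArg (grp P) hg
  simp only [map_mul] at hg'
  have r1 : IsRootComb P (nodeRoot b i).1 (nodeRoot b j).1 (1) (1) :=
    (isRootComb_left _ _).reflect_right ha'
  have hT := demazure_braid_one_one (algebraMap (RLoc P) (FractionRing (RLoc P)))
    (IsFractionRing.injective _ _)
    (MulSemiringAction.toRingHom (ExtWeyl P) (RLoc P) (simpleRefl b i))
    (MulSemiringAction.toRingHom (ExtWeyl P) (RLoc P) (simpleRefl b j))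
    (grp P (simpleRefl b i)) (grp P (simpleRefl b j)) (simpleT b i) (simpleT b j)
    (grp_mul_smul _) (grp_mul_smul _) (grp_simpleRefl_mul_self b i)
    (grp_simpleRefl_mul_self b j) hg' (pairLoc P (nodeRoot b i).1 (nodeRoot b j).1)
    (smul_pairLoc_left b i j ha) (smul_pairLoc_right b i j ha') _ _
    (by
      simp only [List.forall_mem_cons]
      exact ⟨map_pairLoc _ (IsFractionRing.injective _ _) (isRootComb_left _ _), map_pairLoc _
          (IsFractionRing.injective _ _) (isRootComb_right _ _), map_pairLoc _
          (IsFractionRing.injective _ _) r1, by simp⟩)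
    (fun z => by rw [simpleT_mul, pairLoc_one_zero]) (fun z => by rw [simpleT_mul,
      pairLoc_zero_one])
  exact hasBraid_of_words ha ha' hi hj [true, false] [false, true]
    (by simp [IsDescentChain, reflPair]) (by simp [IsDescentChain, reflPair])
    (by simpa [mul_assoc] using hg) (by simpa [mul_assoc] using hT)

theorem hasBraid_two_one (ha : P.pairing (nodeRoot b j).1 (nodeRoot b i).1 = -2)
    (ha' : P.pairing (nodeRoot b i).1 (nodeRoot b j).1 = -1) {w : ExtWeyl P}
    (hi : ¬ AffPos b (affAct w (nodeRoot b i))) (hj : ¬ AffPos b (affAct w (nodeRoot b j))) :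
    HasBraid b i j w := by
  have := isDomain_RLoc P
  have hg : simpleRefl b i * simpleRefl b j * simpleRefl b i * simpleRefl b j =
      simpleRefl b j * simpleRefl b i * simpleRefl b j * simpleRefl b i := by
    refine linAct_injective fun v => ?_
    simp only [linAct_mul]
    exact reflection_braid_two_one (linAct (simpleRefl b i)) (linAct (simpleRefl b j))
      (corootHom P (nodeRoot b i).1) (corootHom P (nodeRoot b j).1)
      (affVec P (nodeRoot b i)) (affVec P (nodeRoot b j)) (linAct_simpleRefl b i)
      (linAct_simpleRefl b j) (corootHom_affVec_self _) (corootHom_affVec_self _)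
        ((corootHom_affVec _ _).trans ha)
      ((corootHom_affVec _ _).trans ha') v
  have hg' := congrArg (grp P) hg
  simp only [map_mul] at hg'
  have r1 : IsRootComb P (nodeRoot b i).1 (nodeRoot b j).1 (1) (1) :=
    (isRootComb_left _ _).reflect_right ha'
  have r2 : IsRootComb P (nodeRoot b i).1 (nodeRoot b j).1 (2) (1) :=
    (isRootComb_right _ _).reflect_left ha
  have hT := demazure_braid_two_one (algebraMap (RLoc P) (FractionRing (RLoc P)))
    (IsFractionRing.injective _ _)
    (MulSemiringAction.toRingHom (ExtWeyl P) (RLoc P) (simpleRefl b i))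
    (MulSemiringAction.toRingHom (ExtWeyl P) (RLoc P) (simpleRefl b j))
    (grp P (simpleRefl b i)) (grp P (simpleRefl b j)) (simpleT b i) (simpleT b j)
    (grp_mul_smul _) (grp_mul_smul _) (grp_simpleRefl_mul_self b i)
    (grp_simpleRefl_mul_self b j) hg' (pairLoc P (nodeRoot b i).1 (nodeRoot b j).1)
    (smul_pairLoc_left b i j ha) (smul_pairLoc_right b i j ha') _ _
    (by
      simp only [List.forall_mem_cons]
      exact ⟨map_pairLoc _ (IsFractionRing.injective _ _) (isRootComb_left _ _), map_pairLoc _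
          (IsFractionRing.injective _ _) (isRootComb_right _ _), map_pairLoc _
          (IsFractionRing.injective _ _) r1, map_pairLoc _ (IsFractionRing.injective _ _) r2, by
          simp⟩)
    (fun z => by rw [simpleT_mul, pairLoc_one_zero]) (fun z => by rw [simpleT_mul,
      pairLoc_zero_one])
  exact hasBraid_of_words ha ha' hi hj [false, true, false] [true, false, true]
    (by simp [IsDescentChain, reflPair]) (by simp [IsDescentChain, reflPair])
    (by simpa [mul_assoc] using hg.symm) (by simpa [mul_assoc] using hT.symm)

theorem hasBraid_three_one (ha : P.pairing (nodeRoot b j).1 (nodeRoot b i).1 = -3)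
    (ha' : P.pairing (nodeRoot b i).1 (nodeRoot b j).1 = -1) {w : ExtWeyl P}
    (hi : ¬ AffPos b (affAct w (nodeRoot b i))) (hj : ¬ AffPos b (affAct w (nodeRoot b j))) :
    HasBraid b i j w := by
  have := isDomain_RLoc P
  have hg : simpleRefl b i * simpleRefl b j * simpleRefl b i * simpleRefl b j * simpleRefl b i *
      simpleRefl b j =
      simpleRefl b j * simpleRefl b i * simpleRefl b j * simpleRefl b i * simpleRefl b j *
          simpleRefl b i := by
    refine linAct_injective fun v => ?_
    simp only [linAct_mul]
    exact reflection_braid_three_one (linAct (simpleRefl b i)) (linAct (simpleRefl b j))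
      (corootHom P (nodeRoot b i).1) (corootHom P (nodeRoot b j).1)
      (affVec P (nodeRoot b i)) (affVec P (nodeRoot b j)) (linAct_simpleRefl b i)
      (linAct_simpleRefl b j) (corootHom_affVec_self _) (corootHom_affVec_self _)
        ((corootHom_affVec _ _).trans ha)
      ((corootHom_affVec _ _).trans ha') v
  have hg' := congrArg (grp P) hg
  simp only [map_mul] at hg'
  have r1 : IsRootComb P (nodeRoot b i).1 (nodeRoot b j).1 (1) (1) :=
    (isRootComb_left _ _).reflect_right ha'
  have r2 : IsRootComb P (nodeRoot b i).1 (nodeRoot b j).1 (3) (1) :=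
    (isRootComb_right _ _).reflect_left ha
  have r3 : IsRootComb P (nodeRoot b i).1 (nodeRoot b j).1 (2) (1) :=
    r1.reflect_left ha
  have r4 : IsRootComb P (nodeRoot b i).1 (nodeRoot b j).1 (3) (2) :=
    r2.reflect_right ha'
  have hT := demazure_braid_three_one (algebraMap (RLoc P) (FractionRing (RLoc P)))
    (IsFractionRing.injective _ _)
    (MulSemiringAction.toRingHom (ExtWeyl P) (RLoc P) (simpleRefl b i))
    (MulSemiringAction.toRingHom (ExtWeyl P) (RLoc P) (simpleRefl b j))
    (grp P (simpleRefl b i)) (grp P (simpleRefl b j)) (simpleT b i) (simpleT b j)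
    (grp_mul_smul _) (grp_mul_smul _) (grp_simpleRefl_mul_self b i)
    (grp_simpleRefl_mul_self b j) hg' (pairLoc P (nodeRoot b i).1 (nodeRoot b j).1)
    (smul_pairLoc_left b i j ha) (smul_pairLoc_right b i j ha') _ _
    (by
      simp only [List.forall_mem_cons]
      exact ⟨map_pairLoc _ (IsFractionRing.injective _ _) (isRootComb_left _ _), map_pairLoc _
          (IsFractionRing.injective _ _) (isRootComb_right _ _), map_pairLoc _
          (IsFractionRing.injective _ _) r1, map_pairLoc _ (IsFractionRing.injective _ _) r3,
          map_pairLoc _ (IsFractionRing.injective _ _) r2, map_pairLoc _ (IsFractionRing.injective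
          _ _) r4, by simp⟩)
    (fun z => by rw [simpleT_mul, pairLoc_one_zero]) (fun z => by rw [simpleT_mul,
      pairLoc_zero_one])
  exact hasBraid_of_words ha ha' hi hj [false, true, false, true, false] [true, false, true, false,
      true]
    (by simp [IsDescentChain, reflPair]) (by simp [IsDescentChain, reflPair])
    (by simpa [mul_assoc] using hg.symm) (by simpa [mul_assoc] using hT.symm)

/-- Nonpositive pairings and the exclusion of opposite roots leave, up to exchanging the nodes, the
four types `A₁ × A₁`, `A₂`, `B₂` and `G₂`. -/
theorem hasBraid (hij : i ≠ j) {w : ExtWeyl P}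
    (hi : ¬ AffPos b (affAct w (nodeRoot b i))) (hj : ¬ AffPos b (affAct w (nodeRoot b j))) :
    HasBraid b i j w := by
  have h1 := pairing_nodeRoot_nonpos b hij
  have h2 : (nodeRoot b i).1 ≠ (nodeRoot b j).1 := fun h => by
    rw [h, P.pairing_same] at h1
    omega
  have h3 := pairing_mem_set_of_ne P h2 (root_ne_neg_of_descents hi hj)
  simp only [Set.mem_insert_iff, Set.mem_singleton_iff, Prod.mk.injEq] at h3
  rcases h3 with h | h | h | h | h | h | h | h | h | h | h <;> try omega
  · exact hasBraid_zero (by rw [h.2, neg_zero]) (by rw [h.1, neg_zero]) hi hj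
  · exact hasBraid_one_one h.2 h.1 hi hj
  · exact hasBraid_two_one h.2 h.1 hi hj
  · exact (hasBraid_two_one h.1 h.2 hj hi).symm
  · exact hasBraid_three_one h.2 h.1 hi hj
  · exact (hasBraid_three_one h.1 h.2 hj hi).symm

end Braid

/-! ### Matsumoto's theorem, quadratic relations and the expansion of `D_w` -/

section Matsumoto

variable {ι X Y : Type*} [AddCommGroup X] [AddCommGroup Y] {P : RootDatum ι X Y} [Finite ι]
  [P.IsReduced] {b : P.Base}

theorem IsExpr.len_le {w σ : ExtWeyl P} {l : List (AffNode b)} (h : IsExpr b w σ l) :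
    len b w ≤ l.length := by
  rw [len_eq_ncard_invSet]
  exact h.ncard_invSet_le

theorem IsReducedExpr.of_append_singleton {w σ : ExtWeyl P} {l : List (AffNode b)} {i : AffNode b}
    (h : IsReducedExpr b w σ (l ++ [i])) :
    IsReducedExpr b (w * simpleRefl b i) σ l ∧ ¬ AffPos b (affAct w (nodeRoot b i)) := by
  obtain ⟨⟨hσ, hw⟩, hl⟩ := h
  have h1 : IsExpr b (w * simpleRefl b i) σ l := by
    refine ⟨hσ, ?_⟩
    rw [hw]
    simp [mul_assoc, simpleRefl_mul_self]
  have h2 := h1.len_le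
  rw [List.length_append, List.length_singleton] at hl
  have h3 : ¬ AffPos b (affAct w (nodeRoot b i)) := fun h => by
    have := len_mul_simpleRefl b h
    omega
  have := len_mul_simpleRefl_of_neg b h3
  exact ⟨⟨h1, by omega⟩, h3⟩

theorem IsReducedExpr.append {v w σ : ExtWeyl P} {l m : List (AffNode b)}
    (h : IsReducedExpr b v σ l) (hw : w = v * (m.map (simpleRefl b)).prod)
    (hl : len b v + m.length = len b w) : IsReducedExpr b w σ (l ++ m) := by
  obtain ⟨⟨hσ, hv⟩, hl'⟩ := h
  refine ⟨⟨hσ, ?_⟩, ?_⟩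
  · rw [hw, hv, List.map_append, List.prod_append, mul_assoc]
  · rw [List.length_append, hl', hl]

variable [Module.Finite ℤ X]

/-- Matsumoto's theorem for the products of the `T_i`. -/
theorem prod_simpleT_eq_of_isReducedExpr {w σ σ' : ExtWeyl P} {l l' : List (AffNode b)}
    (h : IsReducedExpr b w σ l) (h' : IsReducedExpr b w σ' l') :
    grp P σ * (l.map (simpleT b)).prod = grp P σ' * (l'.map (simpleT b)).prod := by
  induction hn : len b w generalizing w σ σ' l l' with
  | zero =>
    have e : l = [] := List.length_eq_zero_iff.mp (by rw [h.2, hn])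
    have e' : l' = [] := List.length_eq_zero_iff.mp (by rw [h'.2, hn])
    subst e e'
    have h1 : w = σ := by simpa using h.1.2
    have h2 : w = σ' := by simpa using h'.1.2
    rw [← h1, ← h2]
  | succ n ih =>
    obtain rfl | ⟨l, i, rfl⟩ := l.eq_nil_or_concat'
    · have := h.2
      simp [hn] at this
    obtain rfl | ⟨l', j, rfl⟩ := l'.eq_nil_or_concat'
    · have := h'.2
      simp [hn] at this
    obtain ⟨h1, h2⟩ := h.of_append_singleton
    obtain ⟨h1', h2'⟩ := h'.of_append_singleton
    -- A reduced word of `w` ending in `k` may be replaced by one that factors through `v`: the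
    -- induction hypothesis for `w s_k` exchanges `p` for `q ++ m`. Applied to both last letters,
    -- this leaves only the braid relation to compare.
    have key : ∀ (m : List (AffNode b)) (k : AffNode b) (τ v : ExtWeyl P) (q p : List (AffNode b))
        (ρ : ExtWeyl P) (_ : IsReducedExpr b w ρ (p ++ [k]))
        (_ : IsReducedExpr b v τ q) (_ : w = v * ((m ++ [k]).map (simpleRefl b)).prod)
        (_ : len b v + m.length + 1 = len b w),
        grp P ρ * ((p ++ [k]).map (simpleT b)).prod =
          grp P τ * (q.map (simpleT b)).prod * ((m ++ [k]).map (simpleT b)).prod := by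
      intro m k τ v q p ρ hp hq hw hl
      obtain ⟨h3, h4⟩ := hp.of_append_singleton
      have h5 := len_mul_simpleRefl_of_neg b h4
      have h6 := hq.append (m := m) (w := w * simpleRefl b k)
        (by rw [hw]; simp [mul_assoc, simpleRefl_mul_self]) (by omega)
      have h7 := ih h3 h6 (by omega)
      rw [List.map_append, List.prod_append, ← mul_assoc, h7]
      simp [mul_assoc]
    by_cases hij : i = j
    · subst hij
      have h3 := len_mul_simpleRefl_of_neg b h2
      have h4 := ih h1 h1' (by omega)
      rw [List.map_append, List.prod_append, List.map_append, List.prod_append, ← mul_assoc,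
        ← mul_assoc, h4]
    · obtain ⟨v, m, m', e1, e2, e3, e4, e5⟩ := hasBraid hij h2 h2'
      obtain ⟨τ, q, hq⟩ := exists_isReducedExpr b v
      rw [key m i τ v q l σ h hq e1 e3, key m' j τ v q l' σ' h' hq e2 e4, e5]

theorem elemT_eq {w σ : ExtWeyl P} {l : List (AffNode b)} (h : IsReducedExpr b w σ l) :
    elemT b w = grp P σ * (l.map (simpleT b)).prod := by
  have h1 : ∃ p : ExtWeyl P × List (AffNode b), IsReducedExpr b w p.1 p.2 := ⟨(σ, l), h⟩
  rw [elemT, dif_pos h1]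
  exact prod_simpleT_eq_of_isReducedExpr h1.choose_spec h

theorem isReducedExpr_of_mem_fundGroup {σ : ExtWeyl P} (hσ : σ ∈ fundGroup b) :
    IsReducedExpr b σ σ [] :=
  ⟨⟨hσ, by simp⟩, ((len_eq_zero_iff b).mpr hσ).symm⟩

theorem elemT_of_mem_fundGroup {σ : ExtWeyl P} (hσ : σ ∈ fundGroup b) : elemT b σ = grp P σ := by
  rw [elemT_eq (isReducedExpr_of_mem_fundGroup hσ)]
  simp

theorem elemT_mul_simpleT {w : ExtWeyl P} {i : AffNode b}
    (h : AffPos b (affAct w (nodeRoot b i))) :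
    elemT b w * simpleT b i = elemT b (w * simpleRefl b i) := by
  obtain ⟨σ, l, hl⟩ := exists_isReducedExpr b w
  rw [elemT_eq hl, elemT_eq (hl.append (m := [i]) (w := w * simpleRefl b i) (by simp)
    (len_mul_simpleRefl b h).symm)]
  simp [mul_assoc]

/-- Induction on the length by right multiplication. -/
theorem len_induction {p : ExtWeyl P → Prop} (b : P.Base) (h0 : ∀ σ ∈ fundGroup b, p σ)
    (h1 : ∀ w i, AffPos b (affAct w (nodeRoot b i)) → p w → p (w * simpleRefl b i))
    (w : ExtWeyl P) : p w := by
  induction hn : len b w generalizing w with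
  | zero => exact h0 w ((len_eq_zero_iff b).mp hn)
  | succ n ih =>
    obtain ⟨i, hi⟩ := exists_descent b (w := w) fun h => by
      rw [(len_eq_zero_iff b).mpr h] at hn
      omega
    have h2 := len_mul_simpleRefl_of_neg b hi
    have h3 := h1 (w * simpleRefl b i) i ((affPos_mul_simpleRefl_iff b w i).mpr hi)
      (ih _ (by omega))
    rwa [mul_assoc, simpleRefl_mul_self, mul_one] at h3

/-- The identity `(1 - z)⁻¹ + (1 - z⁻¹)⁻¹ = 1` is the source of the quadratic relation `T_i² =
-T_i`. -/
theorem invLoc_add_neg (k : ι) : invLoc P (P.root k) + invLoc P (-P.root k) = 1 := by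
  have := isDomain_RLoc P
  have h1 := invLoc_mul (P := P) k
  have h2 := invLoc_mul (P := P) (P.reflectionPerm k k)
  rw [root_reflectionPerm_self] at h2
  have h3 : expLoc P (P.root k) * expLoc P (-P.root k) = 1 := by
    rw [← expLoc_add, add_neg_cancel, expLoc_zero]
  have h4 : 1 - expLoc P (P.root k) ≠ 0 := right_ne_zero_of_mul_eq_one h1
  refine mul_right_cancel₀ h4 ?_
  linear_combination h1 - expLoc P (P.root k) * h2 - invLoc P (-P.root k) * h3

theorem simpleRefl_smul_root (b : P.Base) (i : AffNode b) :
    (simpleRefl b i).right • P.root (nodeRoot b i).1 = -P.root (nodeRoot b i).1 := by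
  rw [simpleRefl_right_smul, P.root_coroot_eq_pairing, P.pairing_same]
  module

theorem simpleT_eq (b : P.Base) (i : AffNode b) :
    simpleT b i = invLoc P (P.root (nodeRoot b i).1) • (grp P (simpleRefl b i) - 1) := by
  rw [← mul_one (simpleT b i), simpleT_mul, mul_one]

theorem simpleT_mul_self (b : P.Base) (i : AffNode b) :
    simpleT b i * simpleT b i = -simpleT b i := by
  rw [simpleT_mul, simpleT_eq, grp_mul_smul, KDelta.mul_sub, grp_simpleRefl_mul_self, mul_one,
    smul_invLoc, simpleRefl_smul_root, ← KDelta.smul_neg]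
  congr 1
  have h : invLoc P (P.root (nodeRoot b i).1) • (grp P (simpleRefl b i) - 1) =
      (grp P (simpleRefl b i) - 1) -
        invLoc P (-P.root (nodeRoot b i).1) • (grp P (simpleRefl b i) - 1) := by
    rw [eq_sub_of_add_eq (invLoc_add_neg (P := P) (nodeRoot b i).1), KDelta.sub_smul, one_smul]
  rw [h, KDelta.smul_sub, KDelta.smul_sub]
  abel

theorem elemT_mul_simpleT_of_neg {w : ExtWeyl P} {i : AffNode b}
    (h : ¬ AffPos b (affAct w (nodeRoot b i))) :
    elemT b w * simpleT b i = -elemT b w := by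
  have h1 := elemT_mul_simpleT ((affPos_mul_simpleRefl_iff b w i).mpr h)
  rw [mul_assoc w, simpleRefl_mul_self, mul_one] at h1
  rw [← h1, mul_assoc, simpleT_mul_self, KDelta.mul_neg]

open Classical in
/-- The expansion of a product of the `D_i` along a reduced expression. -/
theorem prod_simpleD_eq_sum {w σ : ExtWeyl P} {l : List (AffNode b)}
    (h : IsReducedExpr b w σ l) :
    grp P σ * (l.map (simpleD b)).prod = ∑ v ∈ (finite_bruhatLE b w).toFinset, elemT b v := by
  induction l using List.reverseRecOn generalizing w with
  | nil =>
    have h1 : w = σ := by simpa using h.1.2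
    have h2 : (finite_bruhatLE b w).toFinset = {w} := by
      ext v
      rw [Set.Finite.mem_toFinset, Finset.mem_singleton, Set.mem_ofPred_eq]
      refine ⟨fun h3 => h3.eq_of_len_le ?_, fun h3 => h3 ▸ .refl⟩
      rw [← h.2]
      exact Nat.zero_le _
    rw [h2, Finset.sum_singleton, elemT_eq h]
    rfl
  | append_singleton l i ih =>
    obtain ⟨h1, h2⟩ := h.of_append_singleton
    have h3 := (affPos_mul_simpleRefl_iff b w i).mpr h2
    rw [List.map_append, List.prod_append, ← mul_assoc, ih h1, List.map_singleton,
      List.prod_singleton, simpleD, mul_add, mul_one, Finset.sum_mul]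
    set p : ExtWeyl P → Prop := fun v => AffPos b (affAct v (nodeRoot b i)) with hp
    set B := (finite_bruhatLE b (w * simpleRefl b i)).toFinset.filter p with hB
    have hmem : ∀ v, v ∈ B ↔ BruhatLE b v (w * simpleRefl b i) ∧ p v := fun v => by
      rw [hB, Finset.mem_filter, Set.Finite.mem_toFinset, Set.mem_ofPred_eq]
    -- Multiplication by `T_i + 1` kills `T_v` when `v` has the descent `i`, and gives `T_{v s_i} +
    -- T_v` otherwise.
    have e1 : ∑ v ∈ (finite_bruhatLE b (w * simpleRefl b i)).toFinset, elemT b v * simpleT b i +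
        ∑ v ∈ (finite_bruhatLE b (w * simpleRefl b i)).toFinset, elemT b v =
        ∑ v ∈ B, elemT b (v * simpleRefl b i) + ∑ v ∈ B, elemT b v := by
      rw [← Finset.sum_add_distrib, ← Finset.sum_add_distrib, hB, Finset.sum_filter]
      refine Finset.sum_congr rfl fun v _ => ?_
      split_ifs with hv
      · rw [elemT_mul_simpleT hv]
      · rw [elemT_mul_simpleT_of_neg hv, KDelta.neg_add]
    -- By the lifting property, the interval below `w` is the union of `B` and `B s_i`, where `B`
    -- consists of the elements below `w s_i` without the descent `i`.
    have e2 : (finite_bruhatLE b w).toFinset = B.image (· * simpleRefl b i) ∪ B := by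
      ext v
      have h4 := bruhatLE_mul_simpleRefl_iff b h3 v
      rw [mul_assoc w, simpleRefl_mul_self, mul_one] at h4
      rw [Set.Finite.mem_toFinset, Set.mem_ofPred_eq, h4, Finset.mem_union, Finset.mem_image,
        hmem, lower]
      split_ifs with hv
      · refine ⟨fun h => .inr ⟨h, hv⟩, ?_⟩
        rintro (⟨u, hu, rfl⟩ | h5)
        · exact absurd ((hmem u).mp hu).2 ((affPos_mul_simpleRefl_iff b u i).mp hv)
        · exact h5.1
      · refine ⟨fun h => .inl ⟨v * simpleRefl b i, (hmem _).mpr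
          ⟨h, (affPos_mul_simpleRefl_iff b v i).mpr hv⟩, ?_⟩, ?_⟩
        · change v * simpleRefl b i * simpleRefl b i = v
          rw [mul_assoc, simpleRefl_mul_self, mul_one]
        · rintro (⟨u, hu, rfl⟩ | h5)
          · rw [mul_assoc u, simpleRefl_mul_self, mul_one]
            exact ((hmem u).mp hu).1
          · exact absurd h5.2 hv
    have e3 : Disjoint (B.image (· * simpleRefl b i)) B := by
      rw [Finset.disjoint_left]
      intro v hv hv'
      obtain ⟨u, hu, rfl⟩ := Finset.mem_image.mp hv
      exact absurd ((hmem u).mp hu).2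
        ((affPos_mul_simpleRefl_iff b u i).mp ((hmem _).mp hv').2)
    rw [e1, e2, Finset.sum_union e3, Finset.sum_image]
    exact fun x _ y _ h => mul_right_cancel h

theorem elemD_eq_sum (b : P.Base) (w : ExtWeyl P) :
    elemD b w = ∑ v ∈ (finite_bruhatLE b w).toFinset, elemT b v := by
  have h1 : ∃ p : ExtWeyl P × List (AffNode b), IsReducedExpr b w p.1 p.2 := by
    obtain ⟨σ, l, h⟩ := exists_isReducedExpr b w
    exact ⟨(σ, l), h⟩
  rw [elemD, dif_pos h1]
  exact prod_simpleD_eq_sum h1.choose_spec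

end Matsumoto

/-! ### The nil-Hecke ring as the span of the `T_w` -/

section NilHeckeSpan

variable {ι X Y : Type*} [AddCommGroup X] [AddCommGroup Y] {P : RootDatum ι X Y} [Finite ι]
  [P.IsReduced] {b : P.Base} [Module.Finite ℤ X]

theorem simpleT_mul_grp {σ : ExtWeyl P} {i j : AffNode b}
    (h : affAct σ (nodeRoot b j) = nodeRoot b i) :
    simpleT b i * grp P σ = grp P σ * simpleT b j := by
  have h1 : simpleRefl b i * σ = σ * simpleRefl b j := by
    rw [simpleRefl_eq, simpleRefl_eq, ← h, ← affRefl_conj, inv_mul_cancel_right]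
  have h2 : σ.right • P.root (nodeRoot b j).1 = P.root (nodeRoot b i).1 := by
    rw [weylGroup_apply_root, ← h]
    rfl
  rw [simpleT_mul, simpleT_eq, grp_mul_smul, smul_invLoc, h2, KDelta.mul_sub, mul_one, ← map_mul,
    ← map_mul, h1]

theorem elemT_mul_grp (w : ExtWeyl P) {σ : ExtWeyl P} (hσ : σ ∈ fundGroup b) :
    elemT b w * grp P σ = elemT b (w * σ) := by
  induction w using len_induction b with
  | h0 τ hτ =>
    rw [elemT_of_mem_fundGroup hτ, elemT_of_mem_fundGroup (mul_mem hτ hσ), map_mul]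
  | h1 w i hi ih =>
    obtain ⟨j, hj⟩ := exists_affAct_nodeRoot_of_mem_fundGroup b (inv_mem hσ) i
    have h1 : affAct σ (nodeRoot b j) = nodeRoot b i := by rw [← hj, affAct_affAct_inv]
    have h2 : simpleRefl b i * σ = σ * simpleRefl b j := by
      rw [simpleRefl_eq, simpleRefl_eq, ← h1, ← affRefl_conj, inv_mul_cancel_right]
    rw [← elemT_mul_simpleT hi, mul_assoc, simpleT_mul_grp h1, ← mul_assoc, ih,
      elemT_mul_simpleT (by rwa [affAct_mul, h1]), mul_assoc, mul_assoc, h2]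

theorem c_dvd_single_zsmul_sub_one (x : X) (n : ℤ) :
    c x ∣ (AddMonoidAlgebra.single (n • x) 1 : RT X) - 1 := by
  have h1 : ∀ y z : X, (AddMonoidAlgebra.single (y + z) 1 : RT X) =
      AddMonoidAlgebra.single y 1 * AddMonoidAlgebra.single z 1 := fun y z => by
    rw [AddMonoidAlgebra.single_mul_single, one_mul]
  have h0 : (AddMonoidAlgebra.single (0 : X) 1 : RT X) = 1 := rfl
  induction n using Int.induction_on with
  | zero => simp [h0]
  | succ n ih =>
    rw [add_smul, one_smul, h1]
    have e : (AddMonoidAlgebra.single ((n : ℤ) • x) 1 : RT X) * AddMonoidAlgebra.single x 1 - 1 =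
        (AddMonoidAlgebra.single ((n : ℤ) • x) 1 - 1) * AddMonoidAlgebra.single x 1 - c x := by
      rw [c]
      ring
    rw [e]
    exact dvd_sub (Dvd.dvd.mul_right ih _) dvd_rfl
  | pred n ih =>
    have h2 : (AddMonoidAlgebra.single (-x) 1 : RT X) * AddMonoidAlgebra.single x 1 = 1 := by
      rw [← h1, neg_add_cancel, h0]
    rw [sub_smul, one_smul, sub_eq_add_neg (-(n : ℤ) • x), h1]
    have e : (AddMonoidAlgebra.single (-(n : ℤ) • x) 1 : RT X) *
        AddMonoidAlgebra.single (-x) 1 - 1 =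
        (AddMonoidAlgebra.single (-(n : ℤ) • x) 1 - 1) * AddMonoidAlgebra.single (-x) 1 +
          c x * AddMonoidAlgebra.single (-x) 1 := by
      rw [c]
      linear_combination h2
    rw [e]
    exact dvd_add (Dvd.dvd.mul_right ih _) (Dvd.intro _ rfl)

/-- On `e^x` the difference `s_i e^x - e^x` is `e^x` times `e^{nα} - 1` for an integer `n`.
Divisibility by `1 - e^α` says that Demazure operators preserve `R(T)`. -/
theorem c_dvd_weylRT_sub (b : P.Base) (i : AffNode b) (f : RT X) :
    c (P.root (nodeRoot b i).1) ∣ weylRT P (simpleRefl b i).right f - f := by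
  induction f using AddMonoidAlgebra.induction_linear with
  | zero => simp
  | add f g hf hg =>
    rw [map_add, add_sub_add_comm]
    exact dvd_add hf hg
  | single x n =>
    have h : weylRT P (simpleRefl b i).right (AddMonoidAlgebra.single x n) -
        AddMonoidAlgebra.single x n = (AddMonoidAlgebra.single
          ((-P.toLinearMap x (P.coroot (nodeRoot b i).1)) • P.root (nodeRoot b i).1) 1 - 1) *
          AddMonoidAlgebra.single x n := by
      rw [weylRT_single, simpleRefl_right_smul, sub_mul, one_mul,
        AddMonoidAlgebra.single_mul_single, one_mul, neg_smul, neg_add_eq_sub]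
    rw [h]
    exact Dvd.dvd.mul_right (c_dvd_single_zsmul_sub_one _ _) _

theorem smul_eq_scalRT_mul (f : RT X) (x : KDelta P) : f • x = scalRT P f * x := by
  rw [scalRT, RingHom.comp_apply, scal_mul, algebraMap_smul]

theorem grp_mul_scalRT (w : ExtWeyl P) (f : RT X) :
    grp P w * scalRT P f = scalRT P (weylRT P w.right f) * grp P w := by
  rw [scalRT, RingHom.comp_apply, grp_mul_scal, smul_algebraMap]
  rfl

theorem scal_sub (f g : RLoc P) : scal P (f - g) = scal P f - scal P g := by
  have h := map_add (scal P) (f - g) g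
  rw [sub_add_cancel] at h
  rw [h]
  abel

theorem KDelta.neg_mem {S : Submodule (RT X) (KDelta P)} {x : KDelta P} (hx : x ∈ S) : -x ∈ S := by
  have h : (-1 : RT X) • x = -x := KDelta.eq_neg (by
    nth_rewrite 2 [← one_smul (RT X) x]
    rw [← add_smul, neg_add_cancel, zero_smul])
  rw [← h]
  exact S.smul_mem _ hx

/-- The twisted Leibniz rule moves scalars to the left of `T_i` without introducing denominators, so
the left span of the `T_w` is stable under right multiplication by `R(T)`. -/
theorem exists_simpleT_mul_scalRT (b : P.Base) (i : AffNode b) (f : RT X) :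
    ∃ g, simpleT b i * scalRT P f =
      scalRT P (weylRT P (simpleRefl b i).right f) * simpleT b i + scalRT P g := by
  obtain ⟨g, hg⟩ := c_dvd_weylRT_sub b i f
  refine ⟨g, ?_⟩
  have h1 : scalRT P g = invLoc P (P.root (nodeRoot b i).1) •
      (scalRT P (weylRT P (simpleRefl b i).right f) - scalRT P f) := by
    have h2 := congrArg (algebraMap (RT X) (RLoc P)) hg
    rw [map_mul, algebraMap_c] at h2
    rw [scalRT, RingHom.comp_apply, RingHom.comp_apply, RingHom.comp_apply, ← scal_sub,
      ← map_sub, h2, ← scal_mul, ← map_mul, ← mul_assoc, invLoc_mul, one_mul]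
  rw [h1, simpleT_mul, grp_mul_scalRT, ← mul_one (simpleT b i), simpleT_mul, mul_one,
    ← scal_mul, ← scal_mul, ← scal_mul, ← mul_assoc, scalRT, RingHom.comp_apply,
        RingHom.comp_apply, ← map_mul,
    mul_comm, map_mul, mul_assoc, ← mul_add]
  congr 1
  rw [KDelta.mul_sub, mul_one]
  abel

/-- The span of the `T_w` over the representation ring. -/
def spanT (b : P.Base) : Submodule (RT X) (KDelta P) :=
  Submodule.span (RT X) (Set.range (elemT b))

theorem elemT_mem_spanT (w : ExtWeyl P) : elemT b w ∈ spanT b := Submodule.subset_span ⟨w, rfl⟩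

theorem mul_mem_spanT_of_forall {y : KDelta P} (h : ∀ w, elemT b w * y ∈ spanT b) {x : KDelta P}
    (hx : x ∈ spanT b) : x * y ∈ spanT b := by
  induction hx using Submodule.span_induction with
  | mem x hx =>
    obtain ⟨w, rfl⟩ := hx
    exact h w
  | zero => rw [zero_mul]; exact zero_mem _
  | add x z _ _ hx hz => rw [add_mul]; exact add_mem hx hz
  | smul f x _ hx =>
    rw [smul_eq_scalRT_mul, mul_assoc, ← smul_eq_scalRT_mul]
    exact Submodule.smul_mem _ _ hx

theorem mul_simpleT_mem_spanT {x : KDelta P} (hx : x ∈ spanT b) (i : AffNode b) :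
    x * simpleT b i ∈ spanT b := by
  refine mul_mem_spanT_of_forall (fun w => ?_) hx
  by_cases h : AffPos b (affAct w (nodeRoot b i))
  · rw [elemT_mul_simpleT h]
    exact elemT_mem_spanT _
  · rw [elemT_mul_simpleT_of_neg h]
    exact KDelta.neg_mem (elemT_mem_spanT _)

theorem mul_scalRT_mem_spanT {x : KDelta P} (hx : x ∈ spanT b) (f : RT X) :
    x * scalRT P f ∈ spanT b := by
  refine mul_mem_spanT_of_forall (fun w => ?_) hx
  induction w using len_induction b generalizing f with
  | h0 σ hσ =>
    rw [elemT_of_mem_fundGroup hσ, grp_mul_scalRT, ← smul_eq_scalRT_mul,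
      ← elemT_of_mem_fundGroup hσ]
    exact Submodule.smul_mem _ _ (elemT_mem_spanT _)
  | h1 w i hi ih =>
    obtain ⟨g, hg⟩ := exists_simpleT_mul_scalRT b i f
    rw [← elemT_mul_simpleT hi, mul_assoc, hg, mul_add, ← mul_assoc]
    exact add_mem (mul_simpleT_mem_spanT (ih _) i) (ih g)

theorem simpleT_mem_KG (i : AffNode b) : simpleT b i ∈ KG b :=
  Subring.subset_closure (.inl (.inr ⟨i, rfl⟩))

theorem scalRT_mem_KG (f : RT X) : scalRT P f ∈ KG b :=
  Subring.subset_closure (.inl (.inl ⟨f, rfl⟩))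

theorem grp_mem_KG_of_mem_fundGroup {σ : ExtWeyl P} (hσ : σ ∈ fundGroup b) : grp P σ ∈ KG b :=
  Subring.subset_closure (.inr ⟨σ, hσ, rfl⟩)

theorem elemT_mem_KG (w : ExtWeyl P) : elemT b w ∈ KG b := by
  induction w using len_induction b with
  | h0 σ hσ =>
    rw [elemT_of_mem_fundGroup hσ]
    exact grp_mem_KG_of_mem_fundGroup hσ
  | h1 w i hi ih =>
    rw [← elemT_mul_simpleT hi]
    exact mul_mem ih (simpleT_mem_KG i)

theorem mem_KG_iff_mem_spanT {x : KDelta P} : x ∈ KG b ↔ x ∈ spanT b := by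
  constructor
  · intro hx
    -- The induction on `x` has to carry right multiplication on the whole span, because membership
    -- of two factors alone says nothing about their product.
    have key : ∀ y ∈ spanT b, y * x ∈ spanT b := by
      induction hx using Subring.closure_induction with
      | mem x hx =>
        rintro y hy
        rcases hx with (⟨f, rfl⟩ | ⟨i, rfl⟩) | ⟨σ, hσ, rfl⟩
        · exact mul_scalRT_mem_spanT hy f
        · exact mul_simpleT_mem_spanT hy i
        · refine mul_mem_spanT_of_forall (fun w => ?_) hy
          rw [elemT_mul_grp w hσ]
          exact elemT_mem_spanT _
      | zero => intro y _; rw [mul_zero]; exact zero_mem _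
      | one => intro y hy; rwa [mul_one]
      | add x z _ _ hx hz => intro y hy; rw [mul_add]; exact add_mem (hx y hy) (hz y hy)
      | neg x _ hx => intro y hy; rw [KDelta.mul_neg]; exact KDelta.neg_mem (hx y hy)
      | mul x z _ _ hx hz => intro y hy; rw [← mul_assoc]; exact hz _ (hx y hy)
    have h1 : (1 : KDelta P) ∈ spanT b := by
      rw [← map_one (grp P), ← elemT_of_mem_fundGroup (one_mem (fundGroup b))]
      exact elemT_mem_spanT _
    simpa using key 1 h1
  · intro hx
    induction hx using Submodule.span_induction with
    | mem x hx =>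
      obtain ⟨w, rfl⟩ := hx
      exact elemT_mem_KG w
    | zero => exact zero_mem _
    | add x y _ _ hx hy => exact add_mem hx hy
    | smul f x _ hx =>
      rw [smul_eq_scalRT_mul]
      exact mul_mem (scalRT_mem_KG f) hx

theorem grp_simpleRefl_mem_KG (i : AffNode b) : grp P (simpleRefl b i) ∈ KG b := by
  have h : grp P (simpleRefl b i) = scalRT P (c (P.root (nodeRoot b i).1)) * simpleT b i + 1 := by
    rw [simpleT_eq, scalRT, RingHom.comp_apply, algebraMap_c, scal_mul, smul_smul, mul_comm,
      invLoc_mul, one_smul]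
    abel
  rw [h]
  exact add_mem (mul_mem (scalRT_mem_KG _) (simpleT_mem_KG i)) (one_mem _)

theorem grp_mem_KG (b : P.Base) (w : ExtWeyl P) : grp P w ∈ KG b := by
  induction w using len_induction b with
  | h0 σ hσ => exact grp_mem_KG_of_mem_fundGroup hσ
  | h1 w i _ ih =>
    rw [map_mul]
    exact mul_mem ih (grp_simpleRefl_mem_KG i)

theorem coeff_mul_simpleT (x : KDelta P) (i : AffNode b) (w : ExtWeyl P) :
    (x * simpleT b i).coeff w =
      x.coeff (w * simpleRefl b i) *
        ((w * simpleRefl b i) • invLoc P (P.root (nodeRoot b i).1)) -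
      x.coeff w * (w • invLoc P (P.root (nodeRoot b i).1)) := by
  have h : simpleT b i =
      SkewMonoidAlgebra.single (simpleRefl b i) (invLoc P (P.root (nodeRoot b i).1)) -
      SkewMonoidAlgebra.single 1 (invLoc P (P.root (nodeRoot b i).1)) := by
    rw [simpleT_eq, KDelta.smul_sub, grp, SkewMonoidAlgebra.smul_of, ← map_one (grp P), grp,
      SkewMonoidAlgebra.smul_of]
  rw [h, KDelta.mul_sub, SkewMonoidAlgebra.coeff_sub, Finsupp.sub_apply,
    SkewMonoidAlgebra.coeff_mul_single, SkewMonoidAlgebra.coeff_mul_single_one, simpleRefl_inv]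

theorem smul_invLoc_root_ne_zero (w : ExtWeyl P) (k : ι) : w • invLoc P (P.root k) ≠ 0 := by
  have := isDomain_RLoc P
  rw [smul_ne_zero_iff_ne]
  exact left_ne_zero_of_mul_eq_one (invLoc_mul k)

/-- Multiplying by `T_i` on the right changes support elements only by `s_i`, so lengths grow by at
most one. The coefficient at the top element is multiplied by a translate of `(1 - e^α)⁻¹`, which is
nonzero in a domain. -/
theorem coeff_elemT (w : ExtWeyl P) :
    (elemT b w).coeff w ≠ 0 ∧ ∀ v, (elemT b w).coeff v ≠ 0 → v = w ∨ len b v < len b w := by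
  have := isDomain_RLoc P
  induction w using len_induction b with
  | h0 σ hσ =>
    rw [elemT_of_mem_fundGroup hσ]
    have h : grp P σ = SkewMonoidAlgebra.single σ 1 := rfl
    rw [h]
    refine ⟨by simp, fun v hv => .inl ?_⟩
    by_contra hne
    exact hv (by rw [SkewMonoidAlgebra.coeff_single, Finsupp.single_eq_of_ne hne])
  | h1 w i hi ih =>
    have hl := len_mul_simpleRefl b hi
    rw [← elemT_mul_simpleT hi]
    constructor
    · have h1 : (elemT b w).coeff (w * simpleRefl b i) = 0 := by
        by_contra h
        rcases ih.2 _ h with h | h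
        · rw [h] at hl
          omega
        · omega
      rw [coeff_mul_simpleT, h1, zero_mul, sub_zero, mul_assoc, simpleRefl_mul_self, mul_one]
      exact mul_ne_zero ih.1 (smul_invLoc_root_ne_zero _ _)
    · intro v hv
      rw [coeff_mul_simpleT] at hv
      by_cases h1 : (elemT b w).coeff v = 0
      · rw [h1, zero_mul, sub_zero] at hv
        rcases ih.2 _ (left_ne_zero_of_mul hv) with h2 | h2
        · left
          rw [← h2, mul_assoc, simpleRefl_mul_self, mul_one]
        · right
          have h3 := len_mul_simpleRefl_le b (v * simpleRefl b i) i
          rw [mul_assoc, simpleRefl_mul_self, mul_one] at h3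
          omega
      · right
        rcases ih.2 _ h1 with h2 | h2
        · rw [h2]
          omega
        · omega

end NilHeckeSpan

/-! ### Projection to the span of the translations -/

section TranslationProjection

variable {ι X Y : Type*} [AddCommGroup X] [AddCommGroup Y] {P : RootDatum ι X Y} [Finite ι]
  [P.IsReduced]

/-- The projection of the smash product to the span of the translations, `f t_μ u ↦ f t_μ`. Its
kernel is the left ideal generated by the `u - 1` for `u` in the finite Weyl group. -/
def translProj (P : RootDatum ι X Y) : KDelta P →+ KDelta P :=
  SkewMonoidAlgebra.mapDomain fun w : ExtWeyl P => transl P (translPart w)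

@[elab_as_elim]
theorem KDelta.induction {p : KDelta P → Prop} (x : KDelta P) (zero : p 0)
    (single : ∀ (f : RLoc P) (w : ExtWeyl P), p (f • grp P w))
    (add : ∀ x y, p x → p y → p (x + y)) : p x := by
  refine SkewMonoidAlgebra.induction_on x zero (fun w f => ?_) add
  have := single f w
  rwa [grp, SkewMonoidAlgebra.smul_of] at this

theorem translProj_smul (f : RLoc P) (x : KDelta P) :
    translProj P (f • x) = f • translProj P x :=
  SkewMonoidAlgebra.mapDomain_smul

theorem translProj_grp (w : ExtWeyl P) :
    translProj P (grp P w) = grp P (transl P (translPart w)) :=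
  SkewMonoidAlgebra.mapDomain_single

theorem translPart_transl (μ : Y) : translPart (transl P μ) = μ := rfl

theorem translPart_finW (u : P.weylGroup) : translPart (finW P u) = 0 := rfl

theorem transl_zero : transl P 0 = 1 := map_one _

theorem translPart_mul_transl (v w : ExtWeyl P) :
    translPart (v * transl P (translPart w)) = translPart (v * w) := by
  rw [translPart_mul, translPart_mul, translPart_transl]

/-- The translation part of `v w` depends on `w` only through its translation part. Equivalently the
kernel of the projection is a left ideal, and this makes the star action associative. -/
theorem translProj_mul_translProj (x y : KDelta P) :
    translProj P (x * translProj P y) = translProj P (x * y) := by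
  induction x using KDelta.induction with
  | zero => simp only [zero_mul]
  | add x z hx hz => simp only [add_mul, map_add, hx, hz]
  | single f v =>
    induction y using KDelta.induction with
    | zero => simp only [map_zero, mul_zero]
    | add y z hy hz => simp only [mul_add, map_add, hy, hz]
    | single g w =>
      rw [translProj_smul, translProj_grp, smul_mul_assoc, smul_mul_assoc, grp_mul_smul,
        grp_mul_smul, translProj_smul, translProj_smul, translProj_smul, translProj_smul,
        ← map_mul, ← map_mul, translProj_grp, translProj_grp, translPart_mul_transl]

theorem translProj_one : translProj P 1 = 1 := by
  rw [← map_one (grp P), translProj_grp]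
  exact congrArg _ transl_zero

theorem translProj_translProj (x : KDelta P) :
    translProj P (translProj P x) = translProj P x := by
  have h := translProj_mul_translProj 1 x
  rwa [one_mul, one_mul] at h

theorem translProj_mul_grp_finW (x : KDelta P) (u : P.weylGroup) :
    translProj P (x * grp P (finW P u)) = translProj P x := by
  rw [← translProj_mul_translProj, translProj_grp, translPart_finW, transl_zero, map_one, mul_one]

theorem transl_smul (μ : Y) (f : RLoc P) : transl P μ • f = f := by
  change IsLocalization.map (RLoc P) (weylRT P 1) (delta_le P 1) f = f
  simp only [weylRT_one]
  exact IsLocalization.map_id f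

theorem translProj_mul_scal (x : KDelta P) (f : RLoc P) :
    translProj P x * scal P f = scal P f * translProj P x := by
  induction x using KDelta.induction with
  | zero => simp only [map_zero, zero_mul, mul_zero]
  | add x y hx hy => simp only [map_add, add_mul, mul_add, hx, hy]
  | single g w =>
    rw [translProj_smul, translProj_grp, ← scal_mul, mul_assoc, grp_mul_scal, transl_smul,
      ← mul_assoc, ← mul_assoc, ← map_mul, ← map_mul, mul_comm]

theorem KDelta.coeff_sum {κ : Type*} (s : Finset κ) (f : κ → KDelta P) (w : ExtWeyl P) :
    (∑ k ∈ s, f k).coeff w = ∑ k ∈ s, (f k).coeff w := by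
  classical
  induction s using Finset.induction_on with
  | empty => rfl
  | insert a s ha ih =>
    rw [Finset.sum_insert ha, Finset.sum_insert ha, SkewMonoidAlgebra.coeff_add,
      Finsupp.add_apply, ih]

theorem translProj_eq_of_support {x : KDelta P} (h : ∀ w, x.coeff w ≠ 0 → w.right = 1) :
    translProj P x = x := by
  have h1 := SkewMonoidAlgebra.sum_single x
  rw [SkewMonoidAlgebra.sum_def'] at h1
  rw [← h1, map_sum]
  refine Finset.sum_congr rfl fun w hw => ?_
  have h2 := h w (SkewMonoidAlgebra.mem_support_iff.mp hw)
  refine SkewMonoidAlgebra.mapDomain_single.trans ?_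
  congr 1
  conv_rhs => rw [← transl_mul_finW w, h2, finW_one, mul_one]

/-- The projected coefficient is the sum of the coefficients over the coset `vW`; under the
hypothesis only the term at `v` survives. -/
theorem coeff_translProj {x : KDelta P} {v : ExtWeyl P}
    (h : ∀ u : P.weylGroup, u ≠ 1 → x.coeff (v * finW P u) = 0) :
    (translProj P x).coeff (transl P (translPart v)) = x.coeff v := by
  classical
  have h1 := SkewMonoidAlgebra.sum_single x
  rw [SkewMonoidAlgebra.sum_def'] at h1
  have h2 : translProj P x =
      ∑ w ∈ x.support, SkewMonoidAlgebra.single (transl P (translPart w)) (x.coeff w) := by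
    conv_lhs => rw [← h1, map_sum]
    exact Finset.sum_congr rfl fun w _ => SkewMonoidAlgebra.mapDomain_single
  rw [h2, KDelta.coeff_sum, Finset.sum_eq_single v]
  · rw [SkewMonoidAlgebra.coeff_single, Finsupp.single_eq_same]
  · intro w hw hwv
    rw [SkewMonoidAlgebra.coeff_single]
    refine Finsupp.single_eq_of_ne fun h3 => ?_
    have h4 : translPart v = translPart w  := by
      rw [← translPart_transl (P := P) (translPart v), h3, translPart_transl]
    have h5 : w = v * finW P (v.right⁻¹ * w.right) := by
      rw [← transl_mul_finW w, ← transl_mul_finW v, h4, mul_assoc, ← finW_mul]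
      simp [finW, transl]
    refine SkewMonoidAlgebra.mem_support_iff.mp hw ?_
    rw [h5]
    refine h _ fun h6 => hwv ?_
    rw [h5, h6, finW_one, mul_one]
  · intro hv
    rw [SkewMonoidAlgebra.notMem_support_iff.mp hv, SkewMonoidAlgebra.single_zero,
      SkewMonoidAlgebra.coeff_zero]
    rfl

end TranslationProjection

/-! ### The Peterson subalgebra and the star action -/

section Peterson

variable {ι X Y : Type*} [AddCommGroup X] [AddCommGroup Y] {P : RootDatum ι X Y} [Finite ι]
  [P.IsReduced] {b : P.Base} [Module.Finite ℤ X]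

/-- Comparing coefficients at `w` gives `e^y = e^{wy}` for every `y` wherever the coefficient is
nonzero, so the finite part of `w` acts trivially on `X` and is the identity. -/
theorem translProj_eq_of_commute {x : KDelta P}
    (h : ∀ f : RT X, scalRT P f * x = x * scalRT P f) : translProj P x = x := by
  have := isDomain_RLoc P
  refine translProj_eq_of_support fun w hw => weylGroup_ext fun y => ?_
  have h1 := congrArg (fun z : KDelta P => z.coeff w) (h (AddMonoidAlgebra.single y 1))
  have h2 : (scalRT P (AddMonoidAlgebra.single y 1) * x).coeff w = expLoc P y * x.coeff w :=
    SkewMonoidAlgebra.coeff_single_one_mul x _ w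
  have h3 : (x * scalRT P (AddMonoidAlgebra.single y 1)).coeff w =
      x.coeff w * (w • expLoc P y) :=
    SkewMonoidAlgebra.coeff_mul_single_one x _ w
  simp only [h2, h3] at h1
  rw [mul_comm] at h1
  have h4 := mul_left_cancel₀ hw h1
  rw [smul_expLoc] at h4
  rw [one_smul]
  exact (expLoc_injective h4).symm

theorem mem_LG_iff {x : KDelta P} : x ∈ LG b ↔ x ∈ KG b ∧ translProj P x = x := by
  rw [LG, Subring.mem_inf, Subring.mem_centralizer_iff]
  refine and_congr_right fun _ => ⟨fun h => translProj_eq_of_commute fun f => h _ ⟨f, rfl⟩, ?_⟩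
  rintro h _ ⟨f, rfl⟩
  rw [← h]
  exact (translProj_mul_scal x _).symm

theorem grp_transl_mem_LG (b : P.Base) (μ : Y) : grp P (transl P μ) ∈ LG b := by
  rw [mem_LG_iff]
  exact ⟨grp_mem_KG b _, by rw [translProj_grp, translPart_transl]⟩

/-- Elements of `LG b` are fixed by the projection, which is linear. Conversely a fixed element is a
combination of translations, and these belong to `LG b`. -/
theorem mem_LDelta_iff {x : KDelta P} : x ∈ LDelta b ↔ translProj P x = x := by
  constructor
  · intro hx
    induction hx using Submodule.span_induction with
    | mem x hx => exact (mem_LG_iff.mp hx).2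
    | zero => exact map_zero _
    | add x y _ _ hx hy => rw [map_add, hx, hy]
    | smul f x _ hx => rw [translProj_smul, hx]
  · intro h
    rw [← h]
    clear h
    induction x using KDelta.induction with
    | zero => rw [map_zero]; exact zero_mem _
    | add x y hx hy => rw [map_add]; exact add_mem hx hy
    | single f w =>
      rw [translProj_smul, translProj_grp]
      exact Submodule.smul_mem _ _ (Submodule.subset_span (grp_transl_mem_LG b _))

theorem translProj_mem_LDelta (x : KDelta P) : translProj P x ∈ LDelta b :=
  mem_LDelta_iff.mpr (translProj_translProj x)

theorem commute_scal_of_mem_LDelta {x : KDelta P} (hx : x ∈ LDelta b) (f : RLoc P) :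
    x * scal P f = scal P f * x := by
  rw [← mem_LDelta_iff.mp hx]
  exact translProj_mul_scal x f

theorem mul_smul_of_mem_LDelta {x : KDelta P} (hx : x ∈ LDelta b) (f : RLoc P) (y : KDelta P) :
    x * (f • y) = f • (x * y) := by
  rw [← scal_mul, ← mul_assoc, commute_scal_of_mem_LDelta hx, mul_assoc, scal_mul]

/-- The projection ignores right multiplication by `u⁻¹`, and `u x u⁻¹` commutes with scalars
because `x` does, so it is already fixed by the projection. -/
theorem translProj_grp_finW_mul (u : P.weylGroup) {x : KDelta P} (hx : x ∈ LDelta b) :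
    translProj P (grp P (finW P u) * x) =
      grp P (finW P u) * x * grp P (finW P u)⁻¹ := by
  have h : (finW P u)⁻¹ = finW P u⁻¹ := (map_inv _ u).symm
  have h1 := translProj_mul_grp_finW (grp P (finW P u) * x) u⁻¹
  rw [← h1, ← h]
  refine translProj_eq_of_commute fun f => ?_
  rw [scalRT, RingHom.comp_apply]
  set g := algebraMap (RT X) (RLoc P) f
  have h2 : grp P (finW P u) * x * grp P (finW P u)⁻¹ * scal P g =
      grp P (finW P u) * (x * scal P ((finW P u)⁻¹ • g)) * grp P (finW P u)⁻¹ := by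
    rw [mul_assoc _ _ (scal P g), grp_mul_scal]
    simp only [mul_assoc]
  rw [h2, commute_scal_of_mem_LDelta hx, ← mul_assoc (grp P (finW P u)) (scal P _) x, grp_mul_scal,
    smul_inv_smul]
  simp only [mul_assoc]

theorem translProj_grp_transl_mul (μ : Y) {x : KDelta P} (hx : x ∈ LDelta b) :
    translProj P (grp P (transl P μ) * x) = grp P (transl P μ) * x := by
  have h1 := mem_LDelta_iff.mp hx
  refine translProj_eq_of_commute fun f => ?_
  rw [scalRT, RingHom.comp_apply, mul_assoc, commute_scal_of_mem_LDelta hx, ← mul_assoc,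
    ← mul_assoc, grp_mul_scal, transl_smul]

/-- The star action of the smash product on the localized Peterson subalgebra. -/
def starHom (b : P.Base) : KDelta P →+* AddMonoid.End (LDelta b) where
  toFun a :=
    { toFun := fun x => ⟨translProj P (a * x), translProj_mem_LDelta _⟩
      map_zero' := Subtype.ext (by
        change translProj P (a * 0) = 0
        rw [mul_zero, map_zero])
      map_add' := fun x y => Subtype.ext (by
        change translProj P (a * (x.1 + y.1)) = translProj P (a * x.1) + translProj P (a * y.1)
        rw [mul_add, map_add]) }
  map_one' := by
    refine AddMonoidHom.ext fun x => Subtype.ext ?_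
    change translProj P (1 * x.1) = x.1
    rw [one_mul, mem_LDelta_iff.mp x.2]
  map_mul' a c := by
    refine AddMonoidHom.ext fun x => Subtype.ext ?_
    change translProj P (a * c * x.1) = translProj P (a * translProj P (c * x.1))
    rw [translProj_mul_translProj, mul_assoc]
  map_zero' := by
    refine AddMonoidHom.ext fun x => Subtype.ext ?_
    change translProj P (0 * x.1) = 0
    rw [zero_mul, map_zero]
  map_add' a c := by
    refine AddMonoidHom.ext fun x => Subtype.ext ?_
    change translProj P ((a + c) * x.1) = translProj P (a * x.1) + translProj P (c * x.1)
    rw [add_mul, map_add]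

theorem starHom_apply (a : KDelta P) (x : LDelta b) :
    (starHom b a x : KDelta P) = translProj P (a * x) := rfl

theorem isStarAction_starHom (b : P.Base) : IsStarAction b (starHom b) where
  scalar f x := Subtype.ext (by
    rw [starHom_apply, scal_mul, translProj_smul, mem_LDelta_iff.mp x.2]
    rfl)
  finite_weyl u x := translProj_grp_finW_mul u x.2
  translation μ x := translProj_grp_transl_mul μ x.2

/-- The three axioms determine the action of `f t_μ u`, the composite of a scalar, a translation and
a finite Weyl element, and such elements span additively. -/
theorem IsStarAction.eq {star star' : KDelta P →+* AddMonoid.End (LDelta b)}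
    (h : IsStarAction b star) (h' : IsStarAction b star') : star = star' := by
  refine RingHom.ext fun a => ?_
  induction a using KDelta.induction with
  | zero => rw [map_zero, map_zero]
  | add x y hx hy => rw [map_add, map_add, hx, hy]
  | single f w =>
    refine AddMonoidHom.ext fun x => ?_
    have key : ∀ {s : KDelta P →+* AddMonoid.End (LDelta b)}, IsStarAction b s →
        (s (f • grp P w) x : KDelta P) = f • (grp P (transl P (translPart w)) *
          (grp P (finW P w.right) * (x : KDelta P) * grp P (finW P w.right)⁻¹)) := fun {s} hs => by
      have h1 : s (f • grp P w) x =
          s (scal P f) (s (grp P (transl P (translPart w))) (s (grp P (finW P w.right)) x)) := by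
        rw [← scal_mul, map_mul]
        conv_lhs => rw [← transl_mul_finW w, map_mul, map_mul]
        rfl
      rw [h1, hs.scalar, Submodule.coe_smul, hs.translation, hs.finite_weyl]
    exact Subtype.ext ((key h).trans (key h').symm)

end Peterson

/-! ### Integrality of the star action -/

section StarRestriction

variable {ι X Y : Type*} [AddCommGroup X] [AddCommGroup Y] {P : RootDatum ι X Y} [Finite ι]
  [P.IsReduced] {b : P.Base} [Module.Finite ℤ X]

/-- The Demazure operator `c(α)⁻¹ (s_α - 1)` of a finite root. -/
def rootT (P : RootDatum ι X Y) (k : ι) : KDelta P :=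
  invLoc P (P.root k) • (grp P (finW P (weylGroup.ofIdx P k)) - 1)

theorem rootT_inl (i : b.support) : simpleT b (Sum.inl i) = rootT P i := simpleT_eq b _

theorem affAct_affRefl_zero (j i : ι) :
    affAct (affRefl P (j, 0)) (i, 0) = (P.reflectionPerm j i, 0) := by
  refine affVec_injective (P := P) ?_
  rw [affVec_affAct, linAct_affRefl]
  simp [affVec, RootPairing.reflection_apply]

theorem grp_mul_rootT_mul (w : P.weylGroup) {i j : ι} (h : P.weylGroupToPerm w i = j) :
    grp P (finW P w) * rootT P i * grp P (finW P w)⁻¹ = rootT P j := by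
  have h1 : finW P w * finW P (weylGroup.ofIdx P i) * (finW P w)⁻¹ =
      finW P (weylGroup.ofIdx P j) := by
    rw [← affRefl_zero, affRefl_conj, affAct_finW, h, affRefl_zero]
  have h2 : (finW P w).right • P.root i = P.root j := by
    rw [weylGroup_apply_root, ← h]
    rfl
  rw [rootT, grp_mul_smul, smul_invLoc, h2, smul_mul_assoc, KDelta.mul_sub, KDelta.sub_mul,
    mul_one, ← map_mul, ← map_mul, ← map_mul, h1, mul_inv_cancel, map_one, rootT]

/-- Every root is obtained from a simple one by reflections, and conjugation by `W ⊂ KG b` carries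
the Demazure operators of roots into each other. The operator of `-θ` is needed at the affine nodes.
-/
theorem rootT_mem_KG (b : P.Base) (k : ι) : rootT P k ∈ KG b := by
  have key : ∀ (j i : ι), rootT P i ∈ KG b → rootT P (P.reflectionPerm j i) ∈ KG b := by
    intro j i h
    have h1 : P.weylGroupToPerm (weylGroup.ofIdx P j) i = P.reflectionPerm j i := by
      have h2 := affAct_affRefl_zero (P := P) j i
      rw [affRefl_zero, affAct_finW] at h2
      exact congrArg Prod.fst h2
    rw [← grp_mul_rootT_mul _ h1]
    exact mul_mem (mul_mem (grp_mem_KG b _) h) (grp_mem_KG b _)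
  refine b.induction_reflect (p := fun k => rootT P k ∈ KG b) k ?_ ?_ ?_
  · intro i h
    exact key i i h
  · intro i hi
    rw [← rootT_inl ⟨i, hi⟩]
    exact simpleT_mem_KG _
  · intro i j h _
    exact key j i h

theorem translProj_rootT_mul (k : ι) {x : KDelta P} (hx : x ∈ LDelta b) :
    translProj P (rootT P k * x) = invLoc P (P.root k) •
      (grp P (finW P (weylGroup.ofIdx P k)) * x * grp P (finW P (weylGroup.ofIdx P k)) - x) := by
  have h1 : (finW P (weylGroup.ofIdx P k))⁻¹ = finW P (weylGroup.ofIdx P k) := by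
    rw [← affRefl_zero, affRefl_inv]
  have h2 := translProj_grp_finW_mul (weylGroup.ofIdx P k) hx
  rw [h1] at h2
  rw [rootT, smul_mul_assoc, KDelta.sub_mul, one_mul, translProj_smul, map_sub, h2,
    mem_LDelta_iff.mp hx]

/-- Since `c(α) T_α = s_α - 1`, the right side collapses to `x T_α + T_α x s_α = c(α)⁻¹ (s_α x s_α -
x)`, using that `x` commutes with scalars. -/
theorem translProj_rootT_mul_eq (k : ι) {x : KDelta P} (hx : x ∈ LDelta b) :
    translProj P (rootT P k * x) = rootT P k * x + x * rootT P k +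
      rootT P k * x * scalRT P (c (P.root k)) * rootT P k := by
  have h1 : scalRT P (c (P.root k)) * rootT P k =
      grp P (finW P (weylGroup.ofIdx P k)) - 1 := by
    rw [rootT, scalRT, RingHom.comp_apply, algebraMap_c, scal_mul, smul_smul, mul_comm,
      invLoc_mul, one_smul]
  rw [translProj_rootT_mul k hx, mul_assoc _ (scalRT P _), h1, KDelta.mul_sub, mul_one]
  set s := grp P (finW P (weylGroup.ofIdx P k))
  have h2 : x * rootT P k = invLoc P (P.root k) • (x * s - x) := by
    rw [rootT, mul_smul_of_mem_LDelta hx, KDelta.mul_sub, mul_one]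
  have h3 : rootT P k * x * s = invLoc P (P.root k) • (s * x * s - x * s) := by
    rw [rootT, smul_mul_assoc, smul_mul_assoc, KDelta.sub_mul, KDelta.sub_mul, one_mul]
  rw [h2, h3, KDelta.smul_sub, KDelta.smul_sub, KDelta.smul_sub]
  abel

theorem translProj_rootT_mul_mem_KG (k : ι) {x : KDelta P} (hx : x ∈ LDelta b) (hx' : x ∈ KG b) :
    translProj P (rootT P k * x) ∈ KG b := by
  have h := rootT_mem_KG b k
  rw [translProj_rootT_mul_eq k hx]
  exact add_mem (add_mem (mul_mem h hx') (mul_mem hx' h))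
    (mul_mem (mul_mem (mul_mem h hx') (scalRT_mem_KG _)) h)

theorem mul_smul_of_transl (μ : Y) (f : RLoc P) (x : KDelta P) :
    grp P (transl P μ) * (f • x) = f • (grp P (transl P μ) * x) := by
  rw [grp_mul_smul, transl_smul]

theorem translProj_simpleT_inr_mul (j : {j : ι // IsHighest b j}) {x : KDelta P}
    (hx : x ∈ LDelta b) :
    translProj P (simpleT b (Sum.inr j) * x) =
      grp P (transl P (P.coroot j)) * scal P (cInv b (Sum.inr j)) *
          translProj P ((grp P (finW P (weylGroup.ofIdx P j)) - 1) * x) +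
        scal P (cInv b (Sum.inr j)) * (grp P (transl P (P.coroot j)) - 1) * x := by
  have h1 : translProj P (grp P (finW P (weylGroup.ofIdx P j)) * x) ∈ LDelta b :=
    translProj_mem_LDelta _
  have h2 : translProj P (grp P (simpleRefl b (Sum.inr j)) * x) =
      grp P (transl P (P.coroot j)) *
        translProj P (grp P (finW P (weylGroup.ofIdx P j)) * x) := by
    rw [← translProj_grp_transl_mul _ h1, translProj_mul_translProj, simpleRefl, map_mul (grp P),
      mul_assoc]
  rw [simpleT_mul, ← cInv_eq, translProj_smul, map_sub, h2, mem_LDelta_iff.mp hx,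
    KDelta.sub_mul, one_mul, map_sub, mem_LDelta_iff.mp hx, mul_assoc, mul_assoc, scal_mul,
    scal_mul, mul_smul_of_transl, KDelta.mul_sub, KDelta.sub_mul, one_mul, ← smul_add]
  congr 1
  abel

/-- The inverse of `c(-θ)` is harmless here because `c(-θ)⁻¹ (t_{θ^∨} - 1) = T_0 s_θ + T_{-θ}`,
where `T_{-θ}` is the finite Demazure operator. -/
theorem invLoc_smul_transl_sub_one_mem_KG (j : {j : ι // IsHighest b j}) :
    scal P (cInv b (Sum.inr j)) * (grp P (transl P (P.coroot j)) - 1) ∈ KG b := by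
  have h1 : scal P (cInv b (Sum.inr j)) * (grp P (transl P (P.coroot j)) - 1) =
      simpleT b (Sum.inr j) * grp P (finW P (weylGroup.ofIdx P j)) +
        rootT P (P.reflectionPerm j j) := by
    have h2 : finW P (weylGroup.ofIdx P (P.reflectionPerm j j)) =
        finW P (weylGroup.ofIdx P j) := by
      rw [← affRefl_zero, ← affRefl_zero, ← affRefl_affNeg (j.1, 0), affNeg, neg_zero]
    have h3 : finW P (weylGroup.ofIdx P j) * finW P (weylGroup.ofIdx P j) = 1 := by
      rw [← affRefl_zero, affRefl_mul_self]
    rw [simpleT_mul, cInv_eq, scal_mul, rootT, h2, ← map_mul, simpleRefl, mul_assoc, h3, mul_one]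
    change _ = _ + invLoc P (P.root (nodeRoot b (Sum.inr j)).1) • _
    rw [← smul_add]
    congr 1
    abel
  rw [h1]
  exact add_mem (mul_mem (simpleT_mem_KG _) (grp_mem_KG b _)) (rootT_mem_KG b _)

theorem translProj_simpleT_mul_mem_KG (i : AffNode b) {x : KDelta P} (hx : x ∈ LDelta b)
    (hx' : x ∈ KG b) : translProj P (simpleT b i * x) ∈ KG b := by
  rcases i with i | j
  · rw [rootT_inl]
    exact translProj_rootT_mul_mem_KG _ hx hx'
  · rw [translProj_simpleT_inr_mul j hx, mul_assoc (grp P _)]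
    refine add_mem (mul_mem (grp_mem_KG b _) ?_)
      (mul_mem (invLoc_smul_transl_sub_one_mem_KG j) hx')
    have h1 := translProj_rootT_mul_mem_KG (P.reflectionPerm j j) hx hx'
    have h2 : finW P (weylGroup.ofIdx P (P.reflectionPerm j j)) =
        finW P (weylGroup.ofIdx P j) := by
      rw [← affRefl_zero, ← affRefl_zero, ← affRefl_affNeg (j.1, 0), affNeg, neg_zero]
    rw [rootT, h2, smul_mul_assoc, translProj_smul, ← scal_mul] at h1
    rw [cInv_eq]
    exact h1

/-- The star action of the nil-Hecke ring preserves the Peterson subalgebra. -/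
theorem translProj_mul_mem_LG {a x : KDelta P} (ha : a ∈ KG b) (hx : x ∈ LG b) :
    translProj P (a * x) ∈ LG b := by
  rw [mem_LG_iff]
  refine ⟨?_, translProj_translProj _⟩
  -- The statement is proved for all `x` at once, since a product acts by two successive operators.
  have key : ∀ x ∈ LDelta b, x ∈ KG b → translProj P (a * x) ∈ KG b := by
    induction ha using Subring.closure_induction with
    | mem a ha =>
      intro x hx hx'
      rcases ha with (⟨f, rfl⟩ | ⟨i, rfl⟩) | ⟨σ, -, rfl⟩
      · rw [← smul_eq_scalRT_mul, ← algebraMap_smul (RLoc P), translProj_smul, algebraMap_smul,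
          mem_LDelta_iff.mp hx, smul_eq_scalRT_mul]
        exact mul_mem (scalRT_mem_KG f) hx'
      · exact translProj_simpleT_mul_mem_KG i hx hx'
      · have h := translProj_grp_finW_mul σ.right hx
        rw [← transl_mul_finW σ, map_mul (grp P), mul_assoc, ← translProj_mul_translProj,
          translProj_grp_transl_mul _ (translProj_mem_LDelta (b := b) _), h]
        exact mul_mem (grp_mem_KG b _) (mul_mem (mul_mem (grp_mem_KG b _) hx') (grp_mem_KG b _))
    | zero => intro x _ _; rw [zero_mul, map_zero]; exact zero_mem _
    | one => intro x hx hx'; rwa [one_mul, mem_LDelta_iff.mp hx]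
    | add y z _ _ hy hz =>
      intro x hx hx'
      rw [add_mul, map_add]
      exact add_mem (hy x hx hx') (hz x hx hx')
    | neg y _ hy =>
      intro x hx hx'
      rw [KDelta.neg_mul, KDelta.eq_neg (x := translProj P (-(y * x)))
        (by rw [← map_add, KDelta.neg_add, map_zero])]
      exact neg_mem (hy x hx hx')
    | mul y z _ _ hy hz =>
      intro x hx hx'
      rw [mul_assoc, ← translProj_mul_translProj]
      exact hy _ (translProj_mem_LDelta _) (hz x hx hx')
  exact key x (mem_LDelta_iff.mpr (mem_LG_iff.mp hx).2) (mem_LG_iff.mp hx).1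

theorem translProj_mem_LG {a : KDelta P} (ha : a ∈ KG b) : translProj P a ∈ LG b := by
  have := translProj_mul_mem_LG ha (LG b).one_mem
  rwa [mul_one] at this

end StarRestriction

/-- A family that is triangular with respect to a rank function is linearly independent. -/
theorem linearIndependent_of_triangular {R M F J : Type*} [CommRing R] [AddCommMonoid M]
    [Module R M] [CommRing F] [IsDomain F] [Algebra R F]
    (hRF : Function.Injective (algebraMap R F)) (k : J → M) (rk : J → ℕ)
    (φ : J → M →+ F) (hφ : ∀ j (f : R) m, φ j (f • m) = algebraMap R F f * φ j m)
    (h1 : ∀ j, φ j (k j) ≠ 0) (h2 : ∀ i j, i ≠ j → rk i ≤ rk j → φ j (k i) = 0) :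
    LinearIndependent R k := by
  intro f g hfg
  rw [← sub_eq_zero]
  by_contra hne
  -- At an index of maximal rank in a relation, `φ j` kills all other terms.
  obtain ⟨j, hj, hmax⟩ := Finset.exists_max_image (f - g).support rk
    (Finsupp.support_nonempty_iff.mpr hne)
  have h3 : ∀ l : J →₀ R, φ j (Finsupp.linearCombination R k l) =
      l.sum fun i r => algebraMap R F r * φ j (k i) := fun l => by
    rw [Finsupp.linearCombination_apply, Finsupp.sum, Finsupp.sum, map_sum]
    exact Finset.sum_congr rfl fun i _ => hφ _ _ _
  have h4 : ((f - g).sum fun i r => algebraMap R F r * φ j (k i)) = 0 := by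
    rw [Finsupp.sum_sub_index fun i r r' => by rw [map_sub, sub_mul], ← h3, ← h3, hfg, sub_self]
  rw [Finsupp.sum, Finset.sum_eq_single j] at h4
  · rcases mul_eq_zero.mp h4 with h5 | h5
    · exact Finsupp.mem_support_iff.mp hj (hRF (by rw [h5, map_zero]))
    · exact h1 j h5
  · intro i hi hij
    rw [h2 i j hij (hmax i hi), mul_zero]
  · exact fun h => absurd hj h

/-! ### Schubert elements and the two bases -/

section SchubertBases

variable {ι X Y : Type*} [AddCommGroup X] [AddCommGroup Y] {P : RootDatum ι X Y} [Finite ι]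
  [P.IsReduced] {b : P.Base} [Module.Finite ℤ X]

theorem translProj_simpleT_inl (i : b.support) : translProj P (simpleT b (Sum.inl i)) = 0 := by
  rw [simpleT_eq, translProj_smul, map_sub, translProj_one, simpleRefl_inl, translProj_grp,
    translPart_finW, transl_zero, map_one, sub_self, smul_zero]

/-- A finite descent `i` gives `T_v = T_{v s_i} T_i`, and `T_i` lies in the kernel of the
projection, which is a left ideal. -/
theorem translProj_elemT_of_not_isGr {v : ExtWeyl P} (hv : ¬ IsGr b v) :
    translProj P (elemT b v) = 0 := by
  rw [isGr_iff] at hv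
  push Not at hv
  obtain ⟨i, hi⟩ := hv
  have h := elemT_mul_simpleT ((affPos_mul_simpleRefl_iff b v _).mpr hi)
  rw [mul_assoc v, simpleRefl_mul_self, mul_one] at h
  rw [← h, ← translProj_mul_translProj, translProj_simpleT_inl, mul_zero, map_zero]

/-- The coefficient of the translation `t_μ` after projection, where `v = t_μ u`. -/
def projCoeff (v : ExtWeyl P) : KDelta P →+ RLoc P where
  toFun x := (translProj P x).coeff (transl P (translPart v))
  map_zero' := by rw [map_zero]; rfl
  map_add' x y := by rw [map_add, SkewMonoidAlgebra.coeff_add, Finsupp.add_apply]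

theorem projCoeff_apply (v : ExtWeyl P) (x : KDelta P) :
    projCoeff v x = (translProj P x).coeff (transl P (translPart v)) := rfl

theorem projCoeff_smul (v : ExtWeyl P) (f : RLoc P) (x : KDelta P) :
    projCoeff v (f • x) = f * projCoeff v x := by
  rw [projCoeff_apply, translProj_smul, SkewMonoidAlgebra.coeff_smul]
  rfl

theorem projCoeff_smul_RT (v : ExtWeyl P) (f : RT X) (x : KDelta P) :
    projCoeff v (f • x) = algebraMap (RT X) (RLoc P) f * projCoeff v x := by
  rw [← algebraMap_smul (RLoc P) f x, projCoeff_smul]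

theorem projCoeff_translProj (v : ExtWeyl P) (x : KDelta P) :
    projCoeff v (translProj P x) = projCoeff v x := by
  rw [projCoeff_apply, translProj_translProj, projCoeff_apply]

/-- For `u ≠ 1` the element `v u` is longer than `v`, hence longer than `w`, and so is outside the
support of `T_w`. -/
theorem coeff_elemT_mul_finW {v w : ExtWeyl P} (hv : IsGr b v) (h : len b w ≤ len b v)
    {u : P.weylGroup} (hu : u ≠ 1) : (elemT b w).coeff (v * finW P u) = 0 := by
  by_contra hne
  obtain ⟨h1, h2⟩ := hv.len_le_mul_finW u
  rcases (coeff_elemT w).2 _ hne with h3 | h3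
  · exact hu (h2 (by rw [h3]; exact h))
  · omega

theorem projCoeff_elemT {v w : ExtWeyl P} (hv : IsGr b v) (h : len b w ≤ len b v) :
    projCoeff v (elemT b w) = (elemT b w).coeff v :=
  coeff_translProj fun _ hu => coeff_elemT_mul_finW hv h hu

theorem projCoeff_elemT_self {v : ExtWeyl P} (hv : IsGr b v) : projCoeff v (elemT b v) ≠ 0 := by
  rw [projCoeff_elemT hv le_rfl]
  exact (coeff_elemT v).1

theorem projCoeff_elemT_of_ne {v w : ExtWeyl P} (hv : IsGr b v) (hne : w ≠ v)
    (h : len b w ≤ len b v) : projCoeff v (elemT b w) = 0 := by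
  rw [projCoeff_elemT hv h]
  by_contra h1
  rcases (coeff_elemT w).2 _ h1 with h2 | h2
  · exact hne h2.symm
  · omega

theorem linearIndependent_translProj_elemT (b : P.Base) :
    LinearIndependent (RT X) fun w : {w // IsGr b w} => translProj P (elemT b w.1) := by
  have := isDomain_RLoc P
  refine linearIndependent_of_triangular (F := RLoc P) (algebraMap_RLoc_injective P) _
    (fun w => len b w.1) (fun w => projCoeff w.1) (fun w => projCoeff_smul_RT w.1) ?_ ?_
  · intro w
    rw [projCoeff_translProj]
    exact projCoeff_elemT_self w.2
  · intro v w hne h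
    rw [projCoeff_translProj]
    exact projCoeff_elemT_of_ne w.2 (fun h1 => hne (Subtype.ext h1)) h

theorem translProj_smul_RT (f : RT X) (x : KDelta P) :
    translProj P (f • x) = f • translProj P x := by
  rw [← algebraMap_smul (RLoc P) f x, translProj_smul, algebraMap_smul]

variable (P) in
/-- The projection to the translations as a linear map. -/
def translProjₗ : KDelta P →ₗ[RT X] KDelta P where
  toFun := translProj P
  map_add' := map_add _
  map_smul' := translProj_smul_RT

/-- The span of the `T_v` for the `v` that are not affine Grassmannian. -/
def spanNotGr (b : P.Base) : Submodule (RT X) (KDelta P) :=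
  Submodule.span (RT X) (elemT b '' {v | ¬ IsGr b v})

theorem translProj_of_mem_spanNotGr {x : KDelta P} (hx : x ∈ spanNotGr b) :
    translProj P x = 0 := by
  have h : spanNotGr b ≤ LinearMap.ker (translProjₗ P) := by
    rw [spanNotGr, Submodule.span_le]
    rintro _ ⟨v, hv, rfl⟩
    exact translProj_elemT_of_not_isGr hv
  exact h hx

theorem spanT_eq_sup (b : P.Base) :
    spanT b = Submodule.span (RT X) (Set.range fun w : {w // IsGr b w} => elemT b w.1) ⊔
      spanNotGr b := by
  rw [spanT, spanNotGr, ← Submodule.span_union]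
  congr 1
  ext x
  constructor
  · rintro ⟨w, rfl⟩
    by_cases h : IsGr b w
    · exact .inl ⟨⟨w, h⟩, rfl⟩
    · exact .inr ⟨w, h, rfl⟩
  · rintro (⟨w, rfl⟩ | ⟨w, -, rfl⟩)
    · exact ⟨_, rfl⟩
    · exact ⟨_, rfl⟩

/-- The affine Grassmannian part of the `T`-expansion must vanish, because its projection is zero
and the projected `T_w` are independent. Hence the kernel on `KG b` consists of the admissible
correction terms of the Schubert elements. -/
theorem mem_spanNotGr_of_translProj_eq_zero {x : KDelta P} (hx : x ∈ KG b)
    (h0 : translProj P x = 0) : x ∈ spanNotGr b := by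
  rw [mem_KG_iff_mem_spanT, spanT_eq_sup, Submodule.mem_sup] at hx
  obtain ⟨y, hy, z, hz, rfl⟩ := hx
  rw [map_add, translProj_of_mem_spanNotGr hz, add_zero] at h0
  obtain ⟨f, rfl⟩ := Finsupp.mem_span_range_iff_exists_finsupp.mp hy
  have h1 : Finsupp.linearCombination (RT X)
      (fun w : {w // IsGr b w} => translProj P (elemT b w.1)) f = 0 := by
    rw [← h0, Finsupp.linearCombination_apply, Finsupp.sum, Finsupp.sum, map_sum]
    exact Finset.sum_congr rfl fun w _ => (translProj_smul_RT _ _).symm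
  have h2 : f = 0 := linearIndependent_translProj_elemT b (by rw [h1, map_zero])
  rw [h2, Finsupp.sum_zero_index, zero_add]
  exact hz

theorem isSchubertK_translProj_elemT (w : ExtWeyl P) :
    IsSchubertK b w (translProj P (elemT b w)) := by
  have h := translProj_mem_LG (elemT_mem_KG (b := b) w)
  refine ⟨h, mem_spanNotGr_of_translProj_eq_zero ?_ ?_⟩
  · exact sub_mem (mem_LG_iff.mp h).1 (elemT_mem_KG w)
  · rw [map_sub, translProj_translProj, sub_self]

/-- The projection fixes `k` and kills every correction term, so it leaves only the projection of
`T_w`. -/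
theorem IsSchubertK.eq {w : ExtWeyl P} {k : KDelta P} (h : IsSchubertK b w k) :
    k = translProj P (elemT b w) := by
  have h1 := translProj_of_mem_spanNotGr h.2
  rw [map_sub, (mem_LG_iff.mp h.1).2] at h1
  have h2 : k = (k - translProj P (elemT b w)) + translProj P (elemT b w) := by abel
  rw [h2, h1, zero_add]

theorem schubertK_eq (b : P.Base) (w : ExtWeyl P) :
    schubertK b w = translProj P (elemT b w) := by
  have h : ∃ k, IsSchubertK b w k := ⟨_, isSchubertK_translProj_elemT w⟩
  rw [schubertK, dif_pos h]
  exact h.choose_spec.eq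

theorem finite_gr_bruhatLE (b : P.Base) (w : ExtWeyl P) :
    {v | IsGr b v ∧ BruhatLE b v w}.Finite :=
  (finite_bruhatLE b w).subset fun _ h => h.2

theorem schubertL_eq_sum (b : P.Base) (w : ExtWeyl P) :
    schubertL b w = ∑ v ∈ (finite_gr_bruhatLE b w).toFinset, schubertK b v := by
  rw [schubertL, finsum_mem_eq_finite_toFinset_sum _ (finite_gr_bruhatLE b w)]

/-- Projecting `D_w`, the sum of `T_v` over `v ≤ w`, discards exactly the terms with `v` not affine
Grassmannian. -/
theorem schubertL_eq (b : P.Base) (w : ExtWeyl P) :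
    schubertL b w = translProj P (elemD b w) := by
  rw [schubertL_eq_sum, elemD_eq_sum, map_sum]
  simp only [schubertK_eq]
  refine Finset.sum_subset ?_ ?_
  · intro v hv
    rw [Set.Finite.mem_toFinset] at hv ⊢
    exact hv.2
  · intro v hv hv'
    rw [Set.Finite.mem_toFinset] at hv hv'
    exact translProj_elemT_of_not_isGr fun h => hv' ⟨h, hv⟩

theorem schubertK_mem_LG (w : ExtWeyl P) : schubertK b w ∈ LG b := by
  rw [schubertK_eq]
  exact translProj_mem_LG (elemT_mem_KG w)

theorem schubertL_mem_LG (w : ExtWeyl P) : schubertL b w ∈ LG b := by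
  rw [schubertL_eq_sum]
  exact sum_mem fun v _ => schubertK_mem_LG v

theorem linearIndependent_schubertK (b : P.Base) :
    LinearIndependent (RT X) fun w : {w // IsGr b w} => schubertK b w.1 := by
  simp only [schubertK_eq]
  exact linearIndependent_translProj_elemT b

theorem linearIndependent_schubertL (b : P.Base) :
    LinearIndependent (RT X) fun w : {w // IsGr b w} => schubertL b w.1 := by
  have := isDomain_RLoc P
  have key : ∀ (w u : ExtWeyl P), IsGr b u → len b w ≤ len b u →
      ∀ v ∈ (finite_gr_bruhatLE b w).toFinset, v ≠ u → projCoeff u (schubertK b v) = 0 := by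
    intro w u hu hl v hv hne
    rw [Set.Finite.mem_toFinset] at hv
    rw [schubertK_eq, projCoeff_translProj]
    exact projCoeff_elemT_of_ne hu hne (hv.2.len_le.trans hl)
  refine linearIndependent_of_triangular (F := RLoc P) (algebraMap_RLoc_injective P) _
    (fun w => len b w.1) (fun w => projCoeff w.1) (fun w => projCoeff_smul_RT w.1) ?_ ?_
  · intro w
    rw [schubertL_eq_sum, map_sum, Finset.sum_eq_single w.1 (key w.1 w.1 w.2 le_rfl),
      schubertK_eq, projCoeff_translProj]
    · exact projCoeff_elemT_self w.2
    · intro h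
      refine absurd ?_ h
      rw [Set.Finite.mem_toFinset]
      exact ⟨w.2, .refl⟩
  · intro v w hne h
    rw [schubertL_eq_sum, map_sum]
    refine Finset.sum_eq_zero fun u hu => key v.1 w.1 w.2 h u hu fun h1 => hne ?_
    rw [Set.Finite.mem_toFinset] at hu
    subst h1
    exact Subtype.ext (hu.2.eq_of_len_le h).symm

theorem smul_mem_LG {x : KDelta P} (hx : x ∈ LG b) (f : RT X) : f • x ∈ LG b := by
  rw [mem_LG_iff] at hx ⊢
  refine ⟨?_, by rw [translProj_smul_RT, hx.2]⟩
  rw [smul_eq_scalRT_mul]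
  exact mul_mem (scalRT_mem_KG f) hx.1

theorem span_le_LG {s : Set (KDelta P)} (hs : s ⊆ LG b) {x : KDelta P}
    (hx : x ∈ Submodule.span (RT X) s) : x ∈ LG b := by
  induction hx using Submodule.span_induction with
  | mem x hx => exact hs hx
  | zero => exact zero_mem _
  | add x y _ _ hx hy => exact add_mem hx hy
  | smul f x _ hx => exact smul_mem_LG hx f

theorem span_schubertK (b : P.Base) :
    (Submodule.span (RT X) (schubertK b '' {w | IsGr b w}) : Set (KDelta P)) = LG b := by
  ext x
  refine ⟨span_le_LG ?_, fun hx => ?_⟩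
  · rintro _ ⟨w, -, rfl⟩
    exact schubertK_mem_LG w
  · obtain ⟨h1, h2⟩ := mem_LG_iff.mp hx
    rw [mem_KG_iff_mem_spanT, spanT_eq_sup, Submodule.mem_sup] at h1
    obtain ⟨y, hy, z, hz, rfl⟩ := h1
    rw [map_add, translProj_of_mem_spanNotGr hz, add_zero] at h2
    rw [← h2]
    have h3 : Submodule.span (RT X) (Set.range fun w : {w // IsGr b w} => elemT b w.1) ≤
        (Submodule.span (RT X) (schubertK b '' {w | IsGr b w})).comap (translProjₗ P) := by
      rw [Submodule.span_le]
      rintro _ ⟨w, rfl⟩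
      exact Submodule.subset_span ⟨w.1, w.2, schubertK_eq b w.1⟩
    exact h3 hy

theorem span_schubertL (b : P.Base) :
    (Submodule.span (RT X) (schubertL b '' {w | IsGr b w}) : Set (KDelta P)) = LG b := by
  refine Set.Subset.antisymm (fun x => span_le_LG ?_) ?_
  · rintro _ ⟨w, -, rfl⟩
    exact schubertL_mem_LG w
  · rw [← span_schubertK]
    refine Submodule.span_le.mpr ?_
    rintro _ ⟨w, hw, rfl⟩
    induction hn : len b w using Nat.strong_induction_on generalizing w with
    | _ n ih =>
      classical
      have hmem : w ∈ (finite_gr_bruhatLE b w).toFinset :=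
        (Set.Finite.mem_toFinset _).mpr ⟨hw, .refl⟩
      have h1 := schubertL_eq_sum b w
      rw [← Finset.sum_erase_add _ _ hmem] at h1
      -- Unitriangular inversion: every other summand of `ℓ_w` is a `k_v` with `v` strictly shorter
      -- than `w`, already in the span by induction.
      have h2 : schubertK b w = schubertL b w +
          -∑ v ∈ (finite_gr_bruhatLE b w).toFinset.erase w, schubertK b v := by
        rw [h1]
        abel
      rw [h2]
      refine Submodule.add_mem _ (Submodule.subset_span ⟨w, hw, rfl⟩)
        (KDelta.neg_mem (Submodule.sum_mem _ fun v hv => ?_))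
      obtain ⟨h3, h4⟩ := Finset.mem_erase.mp hv
      rw [Set.Finite.mem_toFinset] at h4
      refine ih _ ?_ v h4.1 rfl
      rw [← hn]
      by_contra h5
      exact h3 (h4.2.eq_of_len_le (by omega))

end SchubertBases

end KPeterson

end

open KPeterson in
theorem propositionP {ι X Y : Type*} [Finite ι] [AddCommGroup X] [AddCommGroup Y]
    [Module.Finite ℤ X] [Module.Finite ℤ Y] (P : RootDatum ι X Y) [P.IsReduced] (b : P.Base) :
    -- `T_w` and `D_w` are well defined, independently of the reduced expression
    (∀ w, (∃ σ l, IsReducedExpr b w σ l) ∧ ∀ σ l, IsReducedExpr b w σ l →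
      elemT b w = grp P σ * (l.map (simpleT b)).prod ∧
      elemD b w = grp P σ * (l.map (simpleD b)).prod) ∧
    -- `k_w` and `ℓ_w` are well defined
    (∀ w, IsGr b w → (∃! k, IsSchubertK b w k) ∧ IsSchubertK b w (schubertK b w)) ∧
    (∀ w, {v | BruhatLE b v w}.Finite) ∧
    -- the nil-Hecke ring contains the extended affine Weyl group
    (∀ w, grp P w ∈ KG b) ∧
    ∃ star : KDelta P →+* AddMonoid.End (LDelta b),
      -- the star action exists and is unique
      IsStarAction b star ∧ (∀ star', IsStarAction b star' → star' = star) ∧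
      -- it restricts to an action of `KG b` on `LG b`
      (∀ a ∈ KG b, ∀ x : LDelta b, (x : KDelta P) ∈ LG b → (star a x : KDelta P) ∈ LG b) ∧
      -- the action of `T_i` at the ordinary and at the affine nodes
      (∀ (i : b.support) (x : LDelta b), (x : KDelta P) ∈ LG b →
        (star (simpleT b (Sum.inl i)) x : KDelta P) =
          simpleT b (Sum.inl i) * (x : KDelta P) + (x : KDelta P) * simpleT b (Sum.inl i) +
            simpleT b (Sum.inl i) * (x : KDelta P) * scalRT P (c (P.root i)) *
              simpleT b (Sum.inl i)) ∧
      (∀ (j : {j : ι // IsHighest b j}) (x : LDelta b), (x : KDelta P) ∈ LG b →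
        (star (simpleT b (Sum.inr j)) x : KDelta P) =
          grp P (transl P (P.coroot j)) * scal P (cInv b (Sum.inr j)) *
              (star (grp P (finW P (RootPairing.weylGroup.ofIdx P j)) - 1) x : KDelta P) +
            scal P (cInv b (Sum.inr j)) * (grp P (transl P (P.coroot j)) - 1) *
              (x : KDelta P)) ∧
      -- the Schubert bases
      (∀ w, IsGr b w → schubertK b w = star (elemT b w) (oneL b)) ∧
      (∀ w, IsGr b w → schubertL b w = star (elemD b w) (oneL b)) ∧
      -- the Peterson subalgebra is the orbit of `1`
      {x : KDelta P | ∃ a ∈ KG b, x = star a (oneL b)} = (LG b : Set (KDelta P)) ∧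
      -- both families are bases of the Peterson subalgebra over `R(T)`
      LinearIndependent (RT X) (fun w : {w // IsGr b w} => schubertK b w.1) ∧
      (Submodule.span (RT X) (schubertK b '' {w | IsGr b w}) : Set (KDelta P)) = LG b ∧
      LinearIndependent (RT X) (fun w : {w // IsGr b w} => schubertL b w.1) ∧
      (Submodule.span (RT X) (schubertL b '' {w | IsGr b w}) : Set (KDelta P)) = LG b := by
  refine ⟨fun w => ⟨exists_isReducedExpr b w, fun σ l h => ⟨elemT_eq h, ?_⟩⟩, fun w _ => ?_,
    finite_bruhatLE b, grp_mem_KG b, starHom b, isStarAction_starHom b,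
    fun star' h => h.eq (isStarAction_starHom b), ?_, ?_, ?_, ?_, ?_, ?_,
    linearIndependent_schubertK b, span_schubertK b, linearIndependent_schubertL b,
    span_schubertL b⟩
  · rw [elemD_eq_sum, prod_simpleD_eq_sum h]
  · refine ⟨⟨_, isSchubertK_translProj_elemT w, fun k hk => hk.eq⟩, ?_⟩
    rw [schubertK_eq]
    exact isSchubertK_translProj_elemT w
  · exact fun a ha x hx => translProj_mul_mem_LG ha hx
  · intro i x _
    rw [starHom_apply, rootT_inl]
    exact translProj_rootT_mul_eq _ x.2
  · intro j x _
    exact translProj_simpleT_inr_mul j x.2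
  · intro w _
    rw [schubertK_eq, starHom_apply, oneL, mul_one]
  · intro w _
    rw [schubertL_eq, starHom_apply, oneL, mul_one]
  · ext x
    -- An element of the Peterson subalgebra is its own witness, since `x * 1` is the projection of
    -- `x`.
    refine ⟨?_, fun hx => ⟨x, (mem_LG_iff.mp hx).1, ?_⟩⟩
    · rintro ⟨a, ha, rfl⟩
      rw [starHom_apply, oneL, mul_one]
      exact translProj_mem_LG ha
    · rw [starHom_apply, oneL, mul_one, (mem_LG_iff.mp hx).2]
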